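/- **Setting.** Fix tiers $\mathcal K=\{1,2\}$ (write $\tilde\jmath$ for the tier other than $j$), densities $\lambda^{(j)}>0$, association weights $t^{(j)}>0$, a path loss slope $\tau>0$ and exponent $\alpha>2$, and $p_0,i_0>0$, $p_{\max}\in(0,\infty]$, $\epsilon\in\mathbb R$. Put $$p_{\mathrm{MT}}(r,u)=\min\big(p_0(\tau r)^{\alpha\epsilon},\ i_0(\tau u)^{\alpha},\ p_{\max}\big).$$ Base stations (BSs) of tier $j$ form a homogeneous Poisson point process (PPP) $\Phi^{(j)}$ in $\mathbb R^2$ of density $\lambda^{(j)}$. Let $R^{(j)}_{(q)}$ be the distance from the origin, where the typical mobile terminal $\mathrm{MT}_0$ is located, to the $q$-th nearest point of $\Phi^{(j)}$. Define the events $$\mathcal X^{(j)}=\big\{t^{(j)}(\tau R^{(j)}_{(1)})^{-\alpha}>t^{(\tilde\jmath)}(\tau R^{(\tilde\jmath)}_{(1)})^{-\alpha}\big\}$$ (association with tier $j$) and, for a terminal associated with tier $j$, $\mathcal Q^{(m)}=\{R^{(j)}_{(2)}>R^{(m)}_{(1)}\}$ if $m\ne j$ and $\mathcal Q^{(j)}=\{R^{(j)}_{(2)}<R^{(\tilde\jmath)}_{(1)}\}$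 (the most interfered BS is in tier $m$); let $\mathcal X^{(j,m)}=\mathcal X^{(j)}\cap\mathcal Q^{(m)}$. On $\mathcal X^{(j)}$ the distances to the serving and to the most interfered BS are $R=R^{(j)}_{(1)}$ and $U=\min(R^{(j)}_{(2)},R^{(\tilde\jmath)}_{(1)})$, and the probe BS $\mathrm{BS}_0$ is the point of $\Phi^{(j)}$ nearest to the origin. **Interference model.** For each tier $k$ the interfering terminals $\mathrm{MT}_i$ form a PPP $\Psi^{(k)}$ in $\mathbb R^2$ of density $\lambda^{(k)}$. Each carries a pair $(R_i,U_i)$ (distances to its own serving and most interfered BSs) with the conditional law of $(R,U)$ given $\mathcal X^{(k)}$, and a fading $H_i$ that is exponential with mean $1$. The processes $\Phi^{(1)},\Phi^{(2)},\Psi^{(1)},\Psi^{(2)}$, all pairs $(R_i,U_i)$ and all $H_i$ are mutually independent. With $D_i=\|\mathrm{MT}_i-\mathrm{BS}_0\|$ and $P_i=p_{\mathrm{MT}}(R_i,U_i)$, the interference for a probe terminal associated with tier $j$ is $$I=\sum_{k\in\mathcal K}\ \sum_{\mathrm{MT}_i\in\Psi^{(k)}}H_i(\tau D_i)^{-\alpha}P_i\,\mathbf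 1\big(t^{(k)}(\tau R_i)^{-\alpha}>t^{(j)}(\tau D_i)^{-\alpha}\big)\,\mathbf 1\big(P_i(\tau D_i)^{-\alpha}<i_0\big).$$ **Claim.** (a) For all $k,n\in\mathcal K$, conditionally on $\mathcal X^{(k,n)}$ the pair $(R,U)$ has the joint density $f(r,u\mid\mathcal X^{(k,n)})$ which vanishes unless $r>0$ and $u>(t^{(n)}/t^{(k)})^{1/\alpha}r$, and which on that set equals $$\frac{2\pi\lambda^{(n)}u\,e^{-\pi\lambda^{(n)}u^2}\cdot 2\pi\lambda^{(k)}r\,e^{-\pi\lambda^{(k)}\max(r,u)^2}}{\Pr(\mathcal X^{(k,n)})}\quad(n\neq k),$$ $$\frac{e^{-\pi\lambda^{(\tilde k)}\max\left((t^{(\tilde k)}/t^{(k)})^{1/\alpha}r,\;u\right)^2}\cdot 4(\pi\lambda^{(k)})^2\,r\,u\,e^{-\pi\lambda^{(k)}u^2}}{\Pr(\mathcal X^{(k,k)})}\quad(n=k).$$ (b) For every $j\in\mathcal K$ we have $\Pr(\mathcal X^{(j)})>0$, and conditionally on $\mathcal X^{(j)}$ the interference $I$ is almost surely finite. For every real $s\ge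 0$, $$\mathcal L_I(s\mid\mathcal X^{(j)})=\mathbb E\big[e^{-sI}\mid\mathcal X^{(j)}\big]=\exp\big(\beta^{(j)}(s)\big),$$ $$\beta^{(j)}(s)=-\sum_{k\in\mathcal K}2\pi\lambda^{(k)}\sum_{n\in\mathcal K}\Pr(\mathcal Q^{(n)}\mid\mathcal X^{(k)})\int_0^\infty\int_{(t^{(n)}/t^{(k)})^{1/\alpha}r}^\infty f(r,u\mid\mathcal X^{(k,n)})\,\chi(s,r,u)\,\mathrm du\,\mathrm dr,$$ where all the double integrals converge absolutely and $$\chi(s,r,u)=\frac{s\,p_{\mathrm{MT}}(r,u)\,\tau^{-\alpha}}{\alpha-2}\,M^{2-\alpha}\,{}_2F_1\Big(1,\tfrac{\alpha-2}{\alpha};2-\tfrac2\alpha;-s\,p_{\mathrm{MT}}(r,u)\,\tau^{-\alpha}M^{-\alpha}\Big),$$ $$M=M^{(j,k)}(r,u)=\max\Big(\big(\tfrac{t^{(j)}}{t^{(k)}}\big)^{1/\alpha}r,\ \tfrac1\tau\big(\tfrac{p_{\mathrm{MT}}(r,u)}{i_0}\big)^{1/\alpha}\Big).$$ Here ${}_2F_1$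 is the Gauss hypergeometric function, i.e. on $(-\infty,1)$ the analytic continuation of the hypergeometric series. -/

import Mathlib

open MeasureTheory ProbabilityTheory Set
open scoped ENNReal

noncomputable section

namespace IAFPC

/-! ### Gauss hypergeometric function on the half-line `x < 1` -/

/-- The Gauss hypergeometric function `₂F₁(a, b; c; x)` for real `x < 1`: the (unique) real-analytic
continuation to `(-∞, 1)` of the hypergeometric series, which converges only for `|x| < 1`. -/
def gaussHypergeometric (a b c x : ℝ) : ℝ :=
  open Classical in
  if h : ∃ f : ℝ → ℝ, AnalyticOnNhd ℝ f (Iio 1) ∧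
      ∀ y : ℝ, |y| < 1 → f y = ordinaryHypergeometric a b c y
  then h.choose x else 0

/-! ### Point processes in the plane -/

/-- The plane with its Euclidean norm. -/
abbrev Plane : Type := EuclideanSpace ℝ (Fin 2)

/-- The counting measure `∑ᵢ δ_{Xᵢ(ω)}` of a random sequence of points. -/
def pointMeasure {Ω : Type*} (X : ℕ → Ω → Plane) (ω : Ω) : Measure Plane :=
  Measure.sum fun i => Measure.dirac (X i ω)

/-- The points `X₀, X₁, …` form a Poisson point process with intensity measure `ν`: the number of
points in a measurable set of finite intensity is Poisson, and the numbers of points in pairwise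
disjoint measurable sets are independent. -/
structure IsPoissonPointProcess {Ω : Type*} [MeasurableSpace Ω] (X : ℕ → Ω → Plane)
    (ν : Measure Plane) (P : Measure Ω) : Prop where
  measurable : ∀ i, Measurable (X i)
  poisson : ∀ A : Set Plane, MeasurableSet A → ν A ≠ ∞ →
    HasLaw (fun ω => pointMeasure X ω A)
      ((poissonMeasure (ν A).toNNReal).map (fun n : ℕ => (n : ℝ≥0∞))) P
  indep : ∀ (n : ℕ) (A : Fin n → Set Plane), (∀ i, MeasurableSet (A i)) →
    Pairwise (fun i i' => Disjoint (A i) (A i')) →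
    iIndepFun (fun (i : Fin n) (ω : Ω) => pointMeasure X ω (A i)) P

/-- Distance from `x` to its `q`-th nearest point (`q = 1, 2, …`). -/
def nthNearestDist {Ω : Type*} (X : ℕ → Ω → Plane) (x : Plane) (q : ℕ) (ω : Ω) : ℝ :=
  sInf {ρ : ℝ | 0 ≤ ρ ∧ (q : ℝ≥0∞) ≤ pointMeasure X ω (Metric.closedBall x ρ)}

/-- The point nearest to the origin. -/
def nearestPoint {Ω : Type*} (X : ℕ → Ω → Plane) (ω : Ω) : Plane :=
  open Classical in
  if h : ∃ i : ℕ, ∀ i' : ℕ, ‖X i ω‖ ≤ ‖X i' ω‖ then X (Nat.find h) ω else 0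

/-! ### The two-tier network -/

/-- Parameters: BS densities and association weights of the two tiers, path loss slope and
exponent, power control parameters. The value `pmax = ∞` (no power limit) is allowed. -/
structure Params where
  lam : Fin 2 → ℝ
  t : Fin 2 → ℝ
  τ : ℝ
  α : ℝ
  ε : ℝ
  p0 : ℝ
  i0 : ℝ
  pmax : ℝ≥0∞
  lam_pos : ∀ j, 0 < lam j
  t_pos : ∀ j, 0 < t j
  τ_pos : 0 < τ
  two_lt_α : 2 < α
  p0_pos : 0 < p0
  i0_pos : 0 < i0
  pmax_pos : 0 < pmax

/-- The complementary tier. -/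
def otherTier (j : Fin 2) : Fin 2 := 1 - j

/-- Transmit power `min (p₀ (τ r)^(α ε), i₀ (τ u)^α, p_max)`. -/
def pMT (p : Params) (r u : ℝ) : ℝ :=
  (min (ENNReal.ofReal (min (p.p0 * (p.τ * r) ^ (p.α * p.ε)) (p.i0 * (p.τ * u) ^ p.α)))
    p.pmax).toReal

section Typical

variable {Ω : Type*}

/-- The typical MT, at the origin, is associated with tier `j`. -/
def assocEvent (p : Params) (bs : Fin 2 → ℕ → Ω → Plane) (j : Fin 2) : Set Ω :=
  {ω | p.t j * (p.τ * nthNearestDist (bs j) 0 1 ω) ^ (-p.α) >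
    p.t (otherTier j) * (p.τ * nthNearestDist (bs (otherTier j)) 0 1 ω) ^ (-p.α)}

/-- For a typical MT served by tier `j`, the most interfered BS belongs to tier `m`. -/
def mostInterferedEvent (bs : Fin 2 → ℕ → Ω → Plane) (j m : Fin 2) : Set Ω :=
  if j = m then
    {ω | nthNearestDist (bs j) 0 2 ω < nthNearestDist (bs (otherTier j)) 0 1 ω}
  else
    {ω | nthNearestDist (bs j) 0 2 ω > nthNearestDist (bs m) 0 1 ω}

/-- Distances from the typical MT, served by tier `j`, to its serving BS (the nearest one of tier
`j`) and to its most interfered BS (the nearest one among all the others). -/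
def typicalDistances (bs : Fin 2 → ℕ → Ω → Plane) (j : Fin 2) (ω : Ω) : ℝ × ℝ :=
  (nthNearestDist (bs j) 0 1 ω,
    min (nthNearestDist (bs j) 0 2 ω) (nthNearestDist (bs (otherTier j)) 0 1 ω))

end Typical

/-! ### Interference -/

section Model

variable {Ω : Type*}

/-- The sigma-algebras generated by the sources of randomness: BS locations of each tier, interfering MT locations of each tier,
pair of distances of each interfering MT, and fading of each interfering MT. -/
@[reducible]
def sourceSigma (bs mt : Fin 2 → ℕ → Ω → Plane) (ru : Fin 2 → ℕ → Ω → ℝ × ℝ)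
    (h : Fin 2 → ℕ → Ω → ℝ) :
    Fin 2 ⊕ Fin 2 ⊕ (Fin 2 × ℕ) ⊕ (Fin 2 × ℕ) → MeasurableSpace Ω
  | .inl k => MeasurableSpace.comap (fun ω (i : ℕ) => bs k i ω) inferInstance
  | .inr (.inl k) => MeasurableSpace.comap (fun ω (i : ℕ) => mt k i ω) inferInstance
  | .inr (.inr (.inl (k, i))) => MeasurableSpace.comap (ru k i) inferInstance
  | .inr (.inr (.inr (k, i))) => MeasurableSpace.comap (h k i) inferInstance

/-- The stochastic model. BSs of tier `k`, and interfering MTs of tier `k`, form Poisson point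
processes of density `lam k`. An interfering MT of tier `k` carries its distances to its own serving
and most interfered BSs, distributed as those of the typical MT conditioned on association with
tier `k`, and a unit-mean exponential fading. All these objects are independent. -/
structure IsUplinkModel [MeasurableSpace Ω] (p : Params) (P : Measure Ω)
    (bs mt : Fin 2 → ℕ → Ω → Plane) (ru : Fin 2 → ℕ → Ω → ℝ × ℝ)
    (h : Fin 2 → ℕ → Ω → ℝ) : Prop where
  bs_poisson : ∀ k, IsPoissonPointProcess (bs k) (ENNReal.ofReal (p.lam k) • volume) P
  mt_poisson : ∀ k, IsPoissonPointProcess (mt k) (ENNReal.ofReal (p.lam k) • volume) P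
  ru_measurable : ∀ k i, Measurable (ru k i)
  ru_law : ∀ k i, HasLaw (ru k i)
    ((ProbabilityTheory.cond P (assocEvent p bs k)).map (typicalDistances bs k)) P
  h_measurable : ∀ k i, Measurable (h k i)
  h_law : ∀ k i, HasLaw (h k i) (expMeasure 1) P
  indep : iIndep (sourceSigma bs mt ru h) P

/-- Distance from the `i`-th interfering MT of tier `k` to the probe BS, i.e. to the nearest BS of
tier `j` to the typical MT (which is its serving BS if it is associated with tier `j`). -/
def probeDist (bs mt : Fin 2 → ℕ → Ω → Plane) (j k : Fin 2) (i : ℕ) (ω : Ω) : ℝ :=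
  dist (mt k i ω) (nearestPoint (bs j) ω)

/-- The interfering MT receives higher weighted power from its serving BS than from the probe BS. -/
def eventO (p : Params) (bs mt : Fin 2 → ℕ → Ω → Plane) (ru : Fin 2 → ℕ → Ω → ℝ × ℝ)
    (j k : Fin 2) (i : ℕ) : Set Ω :=
  {ω | p.t k * (p.τ * (ru k i ω).1) ^ (-p.α) > p.t j * (p.τ * probeDist bs mt j k i ω) ^ (-p.α)}

/-- The interfering MT causes less interference than `i₀` to the probe BS. -/
def eventZ (p : Params) (bs mt : Fin 2 → ℕ → Ω → Plane) (ru : Fin 2 → ℕ → Ω → ℝ × ℝ)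
    (j k : Fin 2) (i : ℕ) : Set Ω :=
  {ω | pMT p (ru k i ω).1 (ru k i ω).2 * (p.τ * probeDist bs mt j k i ω) ^ (-p.α) < p.i0}

/-- The interference for a probe MT associated with tier `j`, a sum of nonnegative terms. -/
def interference (p : Params) (bs mt : Fin 2 → ℕ → Ω → Plane) (ru : Fin 2 → ℕ → Ω → ℝ × ℝ)
    (h : Fin 2 → ℕ → Ω → ℝ) (j : Fin 2) (ω : Ω) : ℝ≥0∞ :=
  ∑ k : Fin 2, ∑' i : ℕ, ENNReal.ofReal
    (h k i ω * (p.τ * probeDist bs mt j k i ω) ^ (-p.α) * pMT p (ru k i ω).1 (ru k i ω).2 *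
      (eventO p bs mt ru j k i).indicator 1 ω * (eventZ p bs mt ru j k i).indicator 1 ω)

end Model

/-! ### The joint density of the distances and the exponent -/

/-- Density at `w ≥ 0` of the distance to the nearest point of a planar Poisson process. -/
def nearestPDF (l w : ℝ) : ℝ := 2 * Real.pi * l * w * Real.exp (-(Real.pi * l * w ^ 2))

/-- Complementary cdf at `w ≥ 0` of the distance to the nearest point. -/
def nearestCCDF (l w : ℝ) : ℝ := Real.exp (-(Real.pi * l * w ^ 2))

/-- Joint density at `0 ≤ r₁ < r₂` of the distances to the nearest and second nearest points. -/
def nearestTwoPDF (l r₁ r₂ : ℝ) : ℝ :=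
  4 * (Real.pi * l) ^ 2 * r₁ * r₂ * Real.exp (-(Real.pi * l * r₂ ^ 2))

/-- `ζ^{(j)}(v, w)`. -/
def zeta (l v w : ℝ) : ℝ :=
  2 * Real.pi * l * v * Real.exp (-(Real.pi * l * (max v w) ^ 2))

/-- Joint density of the distances to the serving and most interfered BSs given that the typical MT
is associated with tier `j` and the most interfered BS belongs to tier `m`. -/
def jointPDF {Ω : Type*} [MeasurableSpace Ω] (p : Params) (P : Measure Ω)
    (bs : Fin 2 → ℕ → Ω → Plane) (j m : Fin 2) (v w : ℝ) : ℝ :=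
  open Classical in
  if 0 < v ∧ (p.t m / p.t j) ^ (1 / p.α) * v < w then
    (if j = m then
      nearestCCDF (p.lam (otherTier j))
          (max ((p.t (otherTier j) / p.t j) ^ (1 / p.α) * v) w) *
        nearestTwoPDF (p.lam j) v w
    else nearestPDF (p.lam m) w * zeta (p.lam j) v w) /
      P.real (assocEvent p bs j ∩ mostInterferedEvent bs j m)
  else 0

/-- `max ((t^{(j)}/t^{(k)})^{1/α} r, (1/τ) (p_MT(r,u)/i₀)^{1/α})`. -/
def exclusionRadius (p : Params) (j k : Fin 2) (r u : ℝ) : ℝ :=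
  max ((p.t j / p.t k) ^ (1 / p.α) * r) (1 / p.τ * (pMT p r u / p.i0) ^ (1 / p.α))

/-- `χ(s, r, u)`, for a probe MT of tier `j` and an interfering MT of tier `k`. -/
def chi (p : Params) (j k : Fin 2) (s r u : ℝ) : ℝ :=
  s * pMT p r u * p.τ ^ (-p.α) / (p.α - 2) * exclusionRadius p j k r u ^ (2 - p.α) *
    gaussHypergeometric 1 ((p.α - 2) / p.α) (2 - 2 / p.α)
      (-(s * pMT p r u * p.τ ^ (-p.α) * exclusionRadius p j k r u ^ (-p.α)))

/-- The exponent `β^{(j)}(s)`. -/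
def beta {Ω : Type*} [MeasurableSpace Ω] (p : Params) (P : Measure Ω)
    (bs : Fin 2 → ℕ → Ω → Plane) (j : Fin 2) (s : ℝ) : ℝ :=
  -∑ k : Fin 2, 2 * Real.pi * p.lam k *
    ∑ n : Fin 2, (ProbabilityTheory.cond P (assocEvent p bs k)).real (mostInterferedEvent bs k n) *
      ∫ r in Ioi (0 : ℝ), ∫ u in Ioi ((p.t n / p.t k) ^ (1 / p.α) * r),
        jointPDF p P bs k n r u * chi p j k s r u

end IAFPC

end

namespace IAFPC

open Filter Topology

/-! ### The function `exp (-x)` on `[0, ∞]` -/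

/-! Given the base stations, the interferers form a homogeneous marked Poisson process independent
of them. The interference depends on the base stations only through the position of the probe base
station. By translation invariance its Laplace transform seen from a fixed point does not depend on
that point. Conditioning on association therefore changes nothing: the factor `P (assocEvent p bs
j)` splits off and cancels (`IsUplinkModel.setLIntegral_expNeg_interference`).

The Laplace functional of a marked Poisson process (`IsPoissonPointProcess.laplace_marked`) turns
the transform into exp(-λ ∫∫ (1 - E exp(-s·contribution))). The two indicators together say that the
interferer lies farther than `exclusionRadius`. Exponential fading gives 1 - E exp(-aH) = a/(1+a),
and polar coordinates with a scaling leave the integral that represents the hypergeometric function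
(`gaussHypergeometric_eq_hypIntegral`). Hence the mean loss of a terminal with distances (r,u) is
2πχ (`meanLoss_eq`). The average over (r,u) is a mixture over the tier of the most interfered base
station (`IsTwoTierPoisson.map_cond_assocEvent`).

The joint densities come from the law of the first two distances of one tier, obtained from counts
in a disc and an annulus (`measure_le_nearestDists`). This law is multiplied by that of the nearest
distance of the other tier, and the distance that is not observed is integrated out.

For finiteness, the cap i₀(τu)^α on the power and the value of the exclusion radius give χ ≤
s·C·(r²+u²) (`chi_le`), and r, u have finite second moments. The exponent is thus O(s), and s → 0
gives Pr(I < ∞) = 1. All transforms are first computed in [0,∞] with exp(-∞) = 0, so finiteness is a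
consequence and not a prerequisite. -/

/-- The function `x ↦ exp (-x)` on `[0, ∞]`, with value `0` at `∞`. -/
noncomputable def expNeg (x : ℝ≥0∞) : ℝ≥0∞ := EReal.exp (-(x : EReal))

lemma expNeg_zero : expNeg 0 = 1 := by simp [expNeg]

lemma expNeg_top : expNeg ∞ = 0 := by simp [expNeg]

lemma expNeg_add (x y : ℝ≥0∞) : expNeg (x + y) = expNeg x * expNeg y := by
  have h (z : ℝ≥0∞) : EReal.exp (z : EReal) ≠ 0 := by simp
  simp only [expNeg, EReal.exp_neg, EReal.coe_ennreal_add, EReal.exp_add]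
  rw [ENNReal.mul_inv (Or.inl (h x)) (Or.inr (h y))]

lemma expNeg_ofReal {x : ℝ} (hx : 0 ≤ x) :
    expNeg (ENNReal.ofReal x) = ENNReal.ofReal (Real.exp (-x)) := by
  rw [expNeg, EReal.coe_ennreal_ofReal, max_eq_left hx, ← EReal.coe_neg, EReal.exp_coe]

lemma expNeg_of_ne_top {x : ℝ≥0∞} (hx : x ≠ ∞) :
    expNeg x = ENNReal.ofReal (Real.exp (-x.toReal)) := by
  rw [← expNeg_ofReal ENNReal.toReal_nonneg, ENNReal.ofReal_toReal hx]

lemma expNeg_antitone : Antitone expNeg := fun x y hxy => by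
  simp only [expNeg, EReal.exp_le_exp_iff]
  exact EReal.neg_le_neg_iff.2 (EReal.coe_ennreal_le_coe_ennreal_iff.2 hxy)

lemma expNeg_le_one (x : ℝ≥0∞) : expNeg x ≤ 1 :=
  expNeg_zero ▸ expNeg_antitone (zero_le)

lemma continuous_expNeg : Continuous expNeg :=
  ENNReal.continuous_exp.comp (continuous_neg.comp continuous_coe_ennreal_ereal)

lemma measurable_expNeg : Measurable expNeg := continuous_expNeg.measurable

lemma expNeg_sum {ι : Type*} (s : Finset ι) (f : ι → ℝ≥0∞) :
    expNeg (∑ i ∈ s, f i) = ∏ i ∈ s, expNeg (f i) := by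
  classical
  induction s using Finset.induction_on with
  | empty => simp [expNeg_zero]
  | insert a s ha ih => rw [Finset.sum_insert ha, Finset.prod_insert ha, expNeg_add, ih]

/-- Continuity of `expNeg` up to ∞ makes this valid for divergent sums too; the product then tends
to 0. -/
lemma tendsto_prod_expNeg (f : ℕ → ℝ≥0∞) :
    Tendsto (fun n => ∏ i ∈ Finset.range n, expNeg (f i)) atTop (𝓝 (expNeg (∑' i, f i))) := by
  simp only [← expNeg_sum]
  exact (continuous_expNeg.tendsto _).comp ENNReal.summable.hasSum.tendsto_sum_nat

/-- The inverse of `expNeg` on `[0, 1]`. -/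
noncomputable def negLog (y : ℝ≥0∞) : ℝ≥0∞ := (-(ENNReal.log y)).toENNReal

lemma measurable_negLog : Measurable negLog :=
  measurable_ereal_toENNReal.comp (measurable_neg.comp ENNReal.measurable_log)

lemma expNeg_negLog {y : ℝ≥0∞} (hy : y ≤ 1) : expNeg (negLog y) = y := by
  have h : 0 ≤ -(ENNReal.log y) := by
    rw [EReal.neg_nonneg]
    exact ENNReal.log_one ▸ ENNReal.log_monotone hy
  rw [expNeg, negLog, EReal.coe_toENNReal h, neg_neg, ENNReal.exp_log]

/-! ### The Laplace functional of a Poisson point process -/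

/-- The Poisson generating function at e^(-a): the series ∑ e^(-r) (r e^(-a))^n / n! sums to
exp(-r(1 - e^(-a))). -/
lemma lintegral_expNeg_poissonMeasure (r : NNReal) {a : ℝ≥0∞} (ha : a ≠ ∞) :
    ∫⁻ n, expNeg (a * (n : ℝ≥0∞)) ∂(poissonMeasure r) =
      expNeg ((1 - expNeg a) * (r : ℝ≥0∞)) := by
  have hval (n : ℕ) : ENNReal.ofReal (Real.exp (-r) * r ^ n / n.factorial) *
      expNeg (a * (n : ℝ≥0∞)) = ENNReal.ofReal
        (Real.exp (-r) * ((r * Real.exp (-a.toReal)) ^ n / n.factorial)) := by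
    rw [expNeg_of_ne_top (ENNReal.mul_ne_top ha (by simp)), ← ENNReal.ofReal_mul (by positivity)]
    congr 1
    rw [ENNReal.toReal_mul, ENNReal.toReal_natCast, mul_pow, ← Real.exp_nat_mul]
    rw [show -(a.toReal * (n : ℝ)) = n * -a.toReal by ring]
    ring
  have hs := (NormedSpace.expSeries_div_hasSum_exp (r * Real.exp (-a.toReal) : ℝ)).mul_left
    (Real.exp (-r))
  rw [poissonMeasure, lintegral_sum_measure]
  simp only [lintegral_smul_measure, lintegral_dirac, smul_eq_mul, hval]
  rw [← ENNReal.ofReal_tsum_of_nonneg (fun n => by positivity) hs.summable, hs.tsum_eq,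
    ← Real.exp_eq_exp_ℝ, ← Real.exp_add, expNeg_of_ne_top (ENNReal.mul_ne_top (by simp) (by simp))]
  congr 2
  rw [ENNReal.toReal_mul, ENNReal.toReal_sub_of_le (expNeg_le_one a) (by simp),
    expNeg_of_ne_top ha, ENNReal.toReal_ofReal (Real.exp_nonneg _)]
  simp
  ring

lemma lintegral_pointMeasure {Ω : Type*} (X : ℕ → Ω → Plane) (ω : Ω) {f : Plane → ℝ≥0∞} (hf : Measurable f) :
    ∫⁻ x, f x ∂(pointMeasure X ω) = ∑' i, f (X i ω) := by
  rw [pointMeasure, lintegral_sum_measure]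
  simp [lintegral_dirac' _ hf]

lemma pointMeasure_apply {Ω : Type*} (X : ℕ → Ω → Plane) (ω : Ω) {A : Set Plane} (hA : MeasurableSet A) :
    pointMeasure X ω A = ∑' i, A.indicator 1 (X i ω) := by
  rw [← lintegral_indicator_one hA, lintegral_pointMeasure X ω (measurable_one.indicator hA)]

section Laplace

variable {Ω : Type*} [MeasurableSpace Ω] {X : ℕ → Ω → Plane} {ν : Measure Plane} {P : Measure Ω}

lemma IsPoissonPointProcess.measurable_pointMeasure (hX : IsPoissonPointProcess X ν P)
    {A : Set Plane} (hA : MeasurableSet A) : Measurable fun ω => pointMeasure X ω A := by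
  simp only [pointMeasure_apply X _ hA]
  exact Measurable.tsum fun i =>
    (measurable_one.indicator hA).comp (hX.measurable i)

lemma IsPoissonPointProcess.lintegral_expNeg_count (hX : IsPoissonPointProcess X ν P)
    {A : Set Plane} (hA : MeasurableSet A) (hν : ν A ≠ ∞) {a : ℝ≥0∞} (ha : a ≠ ∞) :
    ∫⁻ ω, expNeg (a * pointMeasure X ω A) ∂P = expNeg ((1 - expNeg a) * ν A) := by
  have hm : Measurable fun z : ℝ≥0∞ => expNeg (a * z) := by
    exact measurable_expNeg.comp (measurable_id.const_mul a)
  rw [(hX.poisson A hA hν).lintegral_comp hm.aemeasurable, lintegral_map hm .of_discrete,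
    lintegral_expNeg_poissonMeasure _ ha, ENNReal.coe_toNNReal hν]

/-- The level sets of `g` are disjoint, so their counts are independent and the transform is a
product of Poisson transforms. -/
lemma IsPoissonPointProcess.laplace_simpleFunc (hX : IsPoissonPointProcess X ν P)
    (g : SimpleFunc Plane ℝ≥0∞) (hg : ∀ x, g x ≠ ∞) (hν : ∀ a, a ≠ 0 → ν (g ⁻¹' {a}) ≠ ∞) :
    ∫⁻ ω, expNeg (∑' i, g (X i ω)) ∂P = expNeg (∫⁻ x, (1 - expNeg (g x)) ∂ν) := by
  classical
  -- The level 0 contributes nothing and may have infinite intensity, so it is left out.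
  set s := g.range.filter (· ≠ 0) with hs
  have hsum (μ : Measure Plane) (c : ℝ≥0∞ → ℝ≥0∞) (hc : c 0 = 0) :
      ∫⁻ x, c (g x) ∂μ = ∑ a ∈ s, c a * μ (g ⁻¹' {a}) := by
    rw [← lintegral_congr fun x => SimpleFunc.map_apply c g x, SimpleFunc.lintegral_eq_lintegral,
      SimpleFunc.map_lintegral, hs, Finset.sum_filter]
    refine Finset.sum_congr rfl fun a _ => ?_
    split_ifs with h
    · rfl
    · rw [not_not.1 h, hc, zero_mul]
  have hind : iIndepFun (fun (a : s) ω => pointMeasure X ω (g ⁻¹' {(a : ℝ≥0∞)})) P := by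
    -- Independence of counts is assumed for families over `Fin n`, hence the enumeration of the
    -- values.
    have h := hX.indep s.card (fun i => g ⁻¹' {(s.equivFin.symm i : ℝ≥0∞)})
      (fun i => g.measurableSet_preimage _) (fun i i' hi => by
        refine Disjoint.preimage _ ?_
        rw [disjoint_singleton]
        exact fun h => hi (s.equivFin.symm.injective (Subtype.ext h)))
    have h' := h.precomp s.equivFin.injective
    simpa [Function.comp_def] using h'
  simp only [← lintegral_pointMeasure X _ g.measurable]
  rw [hsum ν (fun a => 1 - expNeg a) (by simp [expNeg_zero]), expNeg_sum]
  simp only [hsum _ (fun a => a) rfl, expNeg_sum]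
  have hm (a : ℝ≥0∞) : Measurable fun z : ℝ≥0∞ => expNeg (a * z) :=
    measurable_expNeg.comp (measurable_id.const_mul a)
  have h2 := lintegral_prod_eq_prod_lintegral_of_indepFun Finset.univ _
    (hind.comp (fun (a : s) z => expNeg (a * z)) (fun a => hm a))
    (fun a => (hm a).comp (hX.measurable_pointMeasure (g.measurableSet_preimage _)))
  simp only [Function.comp_def] at h2
  have h3 (ω : Ω) := Finset.prod_coe_sort s
    (fun a : ℝ≥0∞ => expNeg (a * pointMeasure X ω (g ⁻¹' {a})))
  have h4 := Finset.prod_coe_sort s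
    (fun a : ℝ≥0∞ => ∫⁻ ω, expNeg (a * pointMeasure X ω (g ⁻¹' {a})) ∂P)
  simp only [h3] at h2
  rw [h2, h4]
  refine Finset.prod_congr rfl fun a ha => ?_
  obtain ⟨ha1, ha2⟩ := Finset.mem_filter.1 ha
  obtain ⟨x, rfl⟩ := SimpleFunc.mem_range.1 ha1
  exact hX.lintegral_expNeg_count (g.measurableSet_preimage _) (hν _ ha2) (hg x)

/-- `f` is the increasing limit of finite-valued simple functions cut off to sets of finite
intensity. The left side passes to the limit by domination by 1, the right side by monotone
convergence. -/
theorem IsPoissonPointProcess.laplace [IsProbabilityMeasure P] [SigmaFinite ν]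
    (hX : IsPoissonPointProcess X ν P)
    {f : Plane → ℝ≥0∞} (hf : Measurable f) :
    ∫⁻ ω, expNeg (∑' i, f (X i ω)) ∂P = expNeg (∫⁻ x, (1 - expNeg (f x)) ∂ν) := by
  classical
  set g : ℕ → SimpleFunc Plane ℝ≥0∞ := fun n =>
    (SimpleFunc.eapprox f n).restrict (spanningSets ν n) with hgdef
  have hgx (n : ℕ) (x : Plane) : g n x =
      (spanningSets ν n).indicator (SimpleFunc.eapprox f n) x := by
    rw [hgdef, SimpleFunc.restrict_apply _ (measurableSet_spanningSets ν n)]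
  have hmono (x : Plane) : Monotone fun n => g n x := fun n m hnm => by
    simp only [hgx]
    refine (indicator_le_indicator_of_subset (monotone_spanningSets ν hnm) (fun _ => zero_le) x).trans
      (indicator_le_indicator (SimpleFunc.monotone_eapprox f hnm x))
  have hlim (x : Plane) : Tendsto (fun n => g n x) atTop (𝓝 (f x)) := by
    have h1 : Tendsto (fun n => SimpleFunc.eapprox f n x) atTop (𝓝 (f x)) := by
      have := tendsto_atTop_iSup (f := fun n => SimpleFunc.eapprox f n x)
        (fun n m h => SimpleFunc.monotone_eapprox f h x)
      rwa [SimpleFunc.iSup_eapprox_apply hf] at this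
    refine h1.congr' ?_
    filter_upwards [eventually_ge_atTop (spanningSetsIndex ν x)] with n hn
    rw [hgx, indicator_of_mem (mem_spanningSets_of_index_le ν x hn)]
  have hcase (n : ℕ) : ∫⁻ ω, expNeg (∑' i, g n (X i ω)) ∂P =
      expNeg (∫⁻ x, (1 - expNeg (g n x)) ∂ν) := by
    refine hX.laplace_simpleFunc (g n) (fun x => ?_) (fun a ha => ?_)
    · rw [hgx]
      refine ne_top_of_le_ne_top (SimpleFunc.eapprox_lt_top f n x).ne (indicator_le_self' (fun _ _ => zero_le) x)
    · refine ne_top_of_le_ne_top (measure_spanningSets_lt_top ν n).ne (measure_mono fun x hx => ?_)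
      by_contra hxs
      rw [mem_preimage, hgx, indicator_of_notMem hxs] at hx
      exact ha hx.symm
  have hL : Tendsto (fun n => ∫⁻ ω, expNeg (∑' i, g n (X i ω)) ∂P) atTop
      (𝓝 (∫⁻ ω, expNeg (∑' i, f (X i ω)) ∂P)) := by
    refine tendsto_lintegral_of_dominated_convergence (fun _ => 1) (fun n => ?_) (fun n => ?_)
      (by simp) ?_
    · exact measurable_expNeg.comp (Measurable.tsum fun i =>
        (g n).measurable.comp (hX.measurable i))
    · exact ae_of_all _ fun ω => expNeg_le_one _
    · refine ae_of_all _ fun ω => (continuous_expNeg.tendsto _).comp ?_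
      simp only [← lintegral_pointMeasure X ω hf, ← lintegral_pointMeasure X ω (g _).measurable]
      exact lintegral_tendsto_of_tendsto_of_monotone (fun n => (g n).measurable.aemeasurable)
        (ae_of_all _ hmono) (ae_of_all _ hlim)
  have hR : Tendsto (fun n => expNeg (∫⁻ x, (1 - expNeg (g n x)) ∂ν)) atTop
      (𝓝 (expNeg (∫⁻ x, (1 - expNeg (f x)) ∂ν))) := by
    refine (continuous_expNeg.tendsto _).comp ?_
    refine lintegral_tendsto_of_tendsto_of_monotone
      (fun n => (measurable_const.sub (measurable_expNeg.comp (g n).measurable)).aemeasurable)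
      (ae_of_all _ fun x n m h => tsub_le_tsub_left (expNeg_antitone (hmono x h)) 1)
      (ae_of_all _ fun x => ?_)
    exact ENNReal.Tendsto.sub tendsto_const_nhds ((continuous_expNeg.tendsto _).comp (hlim x))
      (Or.inl ENNReal.one_ne_top)
  simp only [hcase] at hL
  exact tendsto_nhds_unique hL hR

end Laplace

/-! ### Independent marks -/

section Marks

variable {Ω E : Type*} [MeasurableSpace Ω] [MeasurableSpace E] {P : Measure Ω}

/-- Independence factors the finite products. Writing each factor as `expNeg` of its `negLog` keeps
the answer in the form of a sum over points, to which the unmarked Laplace functional applies. -/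
lemma lintegral_expNeg_tsum_of_iIndepFun [IsProbabilityMeasure P] {G : ℕ → Ω → E}
    (hG : ∀ i, Measurable (G i)) (hind : iIndepFun G P) {f : ℕ → E → ℝ≥0∞}
    (hf : ∀ i, Measurable (f i)) :
    ∫⁻ ω, expNeg (∑' i, f i (G i ω)) ∂P =
      expNeg (∑' i, negLog (∫⁻ ω, expNeg (f i (G i ω)) ∂P)) := by
  have hm (i : ℕ) : Measurable fun e => expNeg (f i e) := measurable_expNeg.comp (hf i)
  have h1 (n : ℕ) : ∫⁻ ω, ∏ i ∈ Finset.range n, expNeg (f i (G i ω)) ∂P =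
      ∏ i ∈ Finset.range n, expNeg (negLog (∫⁻ ω, expNeg (f i (G i ω)) ∂P)) := by
    have h := lintegral_prod_eq_prod_lintegral_of_indepFun (Finset.range n) _
      (hind.comp (fun i e => expNeg (f i e)) hm) (fun i => (hm i).comp (hG i))
    simp only [Function.comp_def] at h
    rw [h]
    refine Finset.prod_congr rfl fun i _ => (expNeg_negLog ?_).symm
    refine (lintegral_mono fun ω => expNeg_le_one _).trans_eq (by simp)
  refine tendsto_nhds_unique ?_ (tendsto_prod_expNeg _)
  simp only [← h1]
  refine tendsto_lintegral_of_dominated_convergence (fun _ => 1) (fun n => ?_) (fun n => ?_)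
    (by simp) (ae_of_all _ fun ω => tendsto_prod_expNeg _)
  · exact Finset.measurable_fun_prod _ fun i _ => (hm i).comp (hG i)
  · exact ae_of_all _ fun ω => Finset.prod_le_one' fun i _ => expNeg_le_one _

/-- Averaging over the marks with the points frozen replaces the marked sum by the sum of `negLog`
φ(Xᵢ), where φ(x) is the mark average at x. The unmarked formula for `negLog` φ then gives the
result. -/
theorem IsPoissonPointProcess.laplace_marked [IsProbabilityMeasure P] {X : ℕ → Ω → Plane}
    {ν : Measure Plane} [SigmaFinite ν] (hX : IsPoissonPointProcess X ν P)
    {G : ℕ → Ω → E} (hG : ∀ i, Measurable (G i)) (hind : iIndepFun G P)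
    {μ : Measure E} [SFinite μ] (hμ : ∀ i, P.map (G i) = μ)
    (hXG : IndepFun (fun ω i => X i ω) (fun ω i => G i ω) P)
    {f : Plane → E → ℝ≥0∞} (hf : Measurable (Function.uncurry f)) :
    ∫⁻ ω, expNeg (∑' i, f (X i ω) (G i ω)) ∂P =
      expNeg (∫⁻ x, (1 - ∫⁻ e, expNeg (f x e) ∂μ) ∂ν) := by
  have hXm : Measurable fun ω i => X i ω := measurable_pi_lambda _ hX.measurable
  have hGm : Measurable fun ω i => G i ω := measurable_pi_lambda _ hG
  have hmap := (indepFun_iff_map_prod_eq_prod_map_map hXm.aemeasurable hGm.aemeasurable).1 hXG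
  have := Measure.isProbabilityMeasure_map (μ := P) hGm.aemeasurable
  have hF : Measurable fun z : (ℕ → Plane) × (ℕ → E) => expNeg (∑' i, f (z.1 i) (z.2 i)) := by
    refine measurable_expNeg.comp (Measurable.tsum fun i => ?_)
    have h : Measurable fun z : (ℕ → Plane) × (ℕ → E) => (z.1 i, z.2 i) := by fun_prop
    exact hf.comp h
  have hφ : Measurable fun x => ∫⁻ e, expNeg (f x e) ∂μ :=
    (measurable_expNeg.comp hf).lintegral_prod_right'
  have hfx (x : Plane) : Measurable fun e => expNeg (f x e) :=
    measurable_expNeg.comp (hf.comp measurable_prodMk_left)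
  have hφ1 (x : Plane) : ∫⁻ e, expNeg (f x e) ∂μ ≤ 1 := by
    rw [← hμ 0, lintegral_map (hfx x) (hG 0)]
    exact (lintegral_mono fun ω => expNeg_le_one _).trans_eq (by simp)
  calc ∫⁻ ω, expNeg (∑' i, f (X i ω) (G i ω)) ∂P
      = ∫⁻ z, expNeg (∑' i, f (z.1 i) (z.2 i)) ∂(P.map fun ω => (fun i => X i ω, fun i => G i ω)) :=
        (lintegral_map hF (hXm.prodMk hGm)).symm
    _ = ∫⁻ x, ∫⁻ g, expNeg (∑' i, f (x i) (g i)) ∂(P.map fun ω i => G i ω)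
          ∂(P.map fun ω i => X i ω) := by rw [hmap, lintegral_prod _ hF.aemeasurable]
    _ = ∫⁻ x, expNeg (∑' i, negLog (∫⁻ e, expNeg (f (x i) e) ∂μ)) ∂(P.map fun ω i => X i ω) := by
        refine lintegral_congr fun x => ?_
        have hFx : Measurable fun g : ℕ → E => expNeg (∑' i, f (x i) (g i)) :=
          hF.comp measurable_prodMk_left
        refine (lintegral_map hFx hGm).trans ((lintegral_expNeg_tsum_of_iIndepFun hG hind
          (f := fun i => f (x i)) (fun i => hf.comp measurable_prodMk_left)).trans ?_)
        congr 2 with i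
        rw [← hμ i, lintegral_map (hfx (x i)) (hG i)]
    _ = ∫⁻ ω, expNeg (∑' i, negLog (∫⁻ e, expNeg (f (X i ω) e) ∂μ)) ∂P := by
        refine lintegral_map ?_ hXm
        exact measurable_expNeg.comp (Measurable.tsum fun i =>
          measurable_negLog.comp (hφ.comp (measurable_pi_apply i)))
    _ = _ := by
        rw [hX.laplace (f := fun x => negLog (∫⁻ e, expNeg (f x e) ∂μ)) (measurable_negLog.comp hφ)]
        simp only [expNeg_negLog (hφ1 _)]

end Marks

/-! ### An integral representation of the hypergeometric function -/

section Hypergeometric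

lemma rpow_neg_mem_Ioc {α y : ℝ} (hα : 2 < α) (hy : 1 < y) : y ^ (-α) ∈ Ioc (0 : ℝ) 1 :=
  ⟨Real.rpow_pos_of_pos (by linarith) _, Real.rpow_le_one_of_one_le_of_nonpos hy.le (by linarith)⟩

/-- The real part of 1 - zw is at least 1 - (1-δ)w ≥ δ. This bounds the denominators uniformly in
the integration variable. -/
lemma le_norm_one_sub_mul {z : ℂ} {w δ : ℝ} (hδ1 : δ ≤ 1) (hz : z.re ≤ 1 - δ)
    (hw : w ∈ Ioc (0 : ℝ) 1) : δ ≤ ‖1 - z * (w : ℂ)‖ := by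
  have h1 : (1 - z * (w : ℂ)).re = 1 - z.re * w := by simp
  refine le_trans ?_ (Complex.re_le_norm _)
  rw [h1]
  nlinarith [hw.1, hw.2, mul_nonneg hw.1.le (sub_nonneg.2 hz)]

/-- The integral `∫_1^∞ y^(1-α) / (1 - z y^(-α)) dy`. -/
noncomputable def stieltjesIntegral (α : ℝ) (z : ℂ) : ℂ :=
  ∫ y in Ioi (1 : ℝ), ((y ^ (1 - α) : ℝ) : ℂ) / (1 - z * ((y ^ (-α) : ℝ) : ℂ))

/-- The detour through ℂ pays off because one complex derivative under the integral sign already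
yields analyticity. -/
lemma differentiableOn_stieltjesIntegral {α : ℝ} (hα : 2 < α) :
    DifferentiableOn ℂ (stieltjesIntegral α) {z | z.re < 1} := by
  intro z₀ hz₀
  have hz₀ : z₀.re < 1 := hz₀
  -- Half the distance to the line Re z = 1: points within δ of z₀ still have real part at most 1 -
  -- δ. The cap at 1 is what `le_norm_one_sub_mul` requires.
  set δ : ℝ := min 1 ((1 - z₀.re) / 2) with hδ
  have hδ0 : 0 < δ := lt_min one_pos (by linarith)
  have hδ1 : δ ≤ 1 := min_le_left _ _
  have hδ2 : δ ≤ (1 - z₀.re) / 2 := min_le_right _ _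
  have hball : ∀ z ∈ Metric.ball z₀ δ, z.re ≤ 1 - δ := by
    intro z hz
    have h1 : |(z - z₀).re| ≤ ‖z - z₀‖ := Complex.abs_re_le_norm _
    rw [mem_ball_iff_norm] at hz
    have := (le_abs_self _).trans (h1.trans hz.le)
    rw [Complex.sub_re] at this
    linarith
  have hint : IntegrableOn (fun y : ℝ => y ^ (1 - α)) (Ioi 1) :=
    integrableOn_Ioi_rpow_of_lt (by linarith) one_pos
  have hmeas (z : ℂ) : Measurable fun y : ℝ =>
      ((y ^ (1 - α) : ℝ) : ℂ) / (1 - z * ((y ^ (-α) : ℝ) : ℂ)) := by fun_prop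
  have hnorm {y : ℝ} (hy : 1 < y) : ‖((y ^ (1 - α) : ℝ) : ℂ)‖ = y ^ (1 - α) := by
    rw [Complex.norm_real, Real.norm_of_nonneg (Real.rpow_nonneg (by linarith) _)]
  have key := hasDerivAt_integral_of_dominated_loc_of_deriv_le
    (μ := volume.restrict (Ioi (1 : ℝ))) (𝕜 := ℂ)
    (F := fun z y => ((y ^ (1 - α) : ℝ) : ℂ) / (1 - z * ((y ^ (-α) : ℝ) : ℂ)))
    (F' := fun z y => ((y ^ (1 - α) : ℝ) : ℂ) * ((y ^ (-α) : ℝ) : ℂ) /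
      (1 - z * ((y ^ (-α) : ℝ) : ℂ)) ^ 2)
    (x₀ := z₀) (s := Metric.ball z₀ δ) (bound := fun y => y ^ (1 - α) * (δ⁻¹) ^ 2)
    (Metric.ball_mem_nhds z₀ hδ0)
    (Eventually.of_forall fun z => (hmeas z).aestronglyMeasurable)
    ?_ ?_ ?_ (hint.mul_const _) ?_
  · exact key.2.differentiableAt.differentiableWithinAt
  · refine (hint.mul_const δ⁻¹).mono' (hmeas z₀).aestronglyMeasurable ?_
    refine (ae_restrict_mem measurableSet_Ioi).mono fun y (hy : 1 < y) => ?_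
    rw [norm_div, hnorm hy, div_eq_mul_inv]
    refine mul_le_mul_of_nonneg_left ?_ (Real.rpow_nonneg (by linarith) _)
    exact inv_anti₀ hδ0 (le_norm_one_sub_mul hδ1 (hball z₀ (Metric.mem_ball_self hδ0))
      (rpow_neg_mem_Ioc hα hy))
  · exact (by fun_prop : Measurable _).aestronglyMeasurable
  · refine (ae_restrict_mem measurableSet_Ioi).mono fun y (hy : 1 < y) z hz => ?_
    have hw := rpow_neg_mem_Ioc hα hy
    rw [norm_div, norm_mul, hnorm hy, norm_pow, div_eq_mul_inv, ← inv_pow, Complex.norm_real,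
      Real.norm_of_nonneg hw.1.le]
    refine mul_le_mul ?_ ?_ (by positivity) (Real.rpow_nonneg (by linarith) _)
    · exact mul_le_of_le_one_right (Real.rpow_nonneg (by linarith) _) hw.2
    · exact pow_le_pow_left₀ (by positivity)
        (inv_anti₀ hδ0 (le_norm_one_sub_mul hδ1 (hball z hz) hw)) 2
  · refine (ae_restrict_mem measurableSet_Ioi).mono fun y (hy : 1 < y) z hz => ?_
    have hne : 1 - z * ((y ^ (-α) : ℝ) : ℂ) ≠ 0 := by
      rw [← norm_pos_iff]
      exact hδ0.trans_le (le_norm_one_sub_mul hδ1 (hball z hz) (rpow_neg_mem_Ioc hα hy))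
    have h1 : HasDerivAt (fun z : ℂ => 1 - z * ((y ^ (-α) : ℝ) : ℂ)) (-((y ^ (-α) : ℝ) : ℂ)) z := by
      simpa using ((hasDerivAt_id z).mul_const ((y ^ (-α) : ℝ) : ℂ)).const_sub 1
    exact ((hasDerivAt_const z ((y ^ (1 - α) : ℝ) : ℂ)).div h1 hne).congr_deriv (by ring)

/-- The integral representation of `₂F₁(1, (α - 2) / α; 2 - 2 / α; x)`. -/
noncomputable def hypIntegral (α x : ℝ) : ℝ :=
  (α - 2) * ∫ y in Ioi (1 : ℝ), y ^ (1 - α) / (1 - x * y ^ (-α))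

lemma analyticOnNhd_hypIntegral {α : ℝ} (hα : 2 < α) :
    AnalyticOnNhd ℝ (hypIntegral α) (Iio 1) := by
  have hopen : IsOpen {z : ℂ | z.re < 1} := isOpen_lt Complex.continuous_re continuous_const
  have h := (differentiableOn_stieltjesIntegral hα).analyticOnNhd hopen
  intro x hx
  have h1 := (h (x : ℂ) (by simpa using hx)).re_ofReal
  refine (analyticAt_const (v := α - 2)).mul (h1.congr (Eventually.of_forall fun x => ?_))
  have : stieltjesIntegral α (x : ℂ) =
      ((∫ y in Ioi (1 : ℝ), y ^ (1 - α) / (1 - x * y ^ (-α)) : ℝ) : ℂ) := by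
    rw [stieltjesIntegral, ← integral_complex_ofReal]
    congr with y
    push_cast
    rfl
  simp only [this, Complex.ofReal_re]

/-- It gives (b)ₙ/(b+1)ₙ = b/(b+n), which simplifies the hypergeometric coefficients because here c
= b + 1. -/
lemma ascPochhammer_eval_mul_add (b : ℝ) (n : ℕ) :
    (ascPochhammer ℝ n).eval b * (b + n) = b * (ascPochhammer ℝ n).eval (b + 1) := by
  induction n with
  | zero => simp
  | succ n ih =>
    rw [ascPochhammer_succ_eval, ascPochhammer_succ_eval, ih]
    push_cast
    ring

/-- The geometric expansion of 1/(1 - x y^(-α)) integrates term by term to xⁿ/(α-2+αn). With a = 1,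
b = (α-2)/α and c = b+1, the n-th hypergeometric coefficient is b/(b+n) = (α-2)/(α-2+αn). -/
lemma hypIntegral_eq_ordinaryHypergeometric {α : ℝ} (hα : 2 < α) {x : ℝ} (hx : |x| < 1) :
    hypIntegral α x = ordinaryHypergeometric 1 ((α - 2) / α) (2 - 2 / α) x := by
  have hα0 : α ≠ 0 := by linarith
  have hsum : HasSum (fun n : ℕ => ∫ y in Ioi (1 : ℝ), x ^ n * y ^ (1 - α - α * n))
      (∫ y in Ioi (1 : ℝ), y ^ (1 - α) / (1 - x * y ^ (-α))) := by
    refine hasSum_integral_of_dominated_convergence (fun n y => |x| ^ n * y ^ (1 - α))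
      (fun n => (by fun_prop : Measurable _).aestronglyMeasurable) (fun n => ?_) ?_ ?_ ?_
    · refine (ae_restrict_mem measurableSet_Ioi).mono fun y (hy : 1 < y) => ?_
      rw [norm_mul, norm_pow, Real.norm_eq_abs,
        Real.norm_of_nonneg (Real.rpow_nonneg (by linarith) _)]
      refine mul_le_mul_of_nonneg_left ?_ (by positivity)
      refine Real.rpow_le_rpow_of_exponent_le hy.le ?_
      have : 0 ≤ α * n := by positivity
      linarith
    · exact ae_of_all _ fun y => (summable_geometric_of_lt_one (abs_nonneg x) hx).mul_right _
    · simp only [tsum_mul_right]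
      exact (integrableOn_Ioi_rpow_of_lt (by linarith) one_pos).const_mul _
    · refine (ae_restrict_mem measurableSet_Ioi).mono fun y (hy : 1 < y) => ?_
      have hw := rpow_neg_mem_Ioc hα hy
      have hxw : |x * y ^ (-α)| < 1 := by
        rw [abs_mul, abs_of_pos hw.1]
        nlinarith [abs_nonneg x, hw.1, hw.2]
      have h := (hasSum_geometric_of_abs_lt_one hxw).mul_left (y ^ (1 - α))
      rw [← div_eq_mul_inv] at h
      refine h.congr_fun fun n => ?_
      rw [mul_pow, ← Real.rpow_mul_natCast (by linarith), show 1 - α - α * n = 1 - α + -α * n by ring,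
        Real.rpow_add (by linarith)]
      ring
  rw [hypIntegral, ordinaryHypergeometric_eq_tsum, ← hsum.tsum_eq, ← tsum_mul_left]
  refine tsum_congr fun n => ?_
  have hn : (0 : ℝ) ≤ α * n := by positivity
  have hb : 0 < (α - 2) / α := div_pos (by linarith) (by linarith)
  have hc : 2 - 2 / α = (α - 2) / α + 1 := by field_simp; ring
  have hpos : 0 < (ascPochhammer ℝ n).eval ((α - 2) / α + 1) :=
    ascPochhammer_pos n _ (by linarith)
  have hp := ascPochhammer_eval_mul_add ((α - 2) / α) n
  have h2 : (ascPochhammer ℝ n).eval ((α - 2) / α) =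
      (α - 2) / α * (ascPochhammer ℝ n).eval ((α - 2) / α + 1) / ((α - 2) / α + n) := by
    rw [eq_div_iff (by positivity), hp]
  rw [integral_const_mul, integral_Ioi_rpow_of_lt (by linarith) one_pos, Real.one_rpow,
    ascPochhammer_eval_one, hc, h2, smul_eq_mul]
  have hf : (n.factorial : ℝ) ≠ 0 := by positivity
  have h3 : (α - 2) / α + n = (α - 2 + α * n) / α := by field_simp
  have h4 : α - 2 + α * n ≠ 0 := by linarith
  have h5 : 1 - α - α * n + 1 = -(α - 2 + α * n) := by ring
  rw [h3, h5, neg_div_neg_eq]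
  generalize (ascPochhammer ℝ n).eval ((α - 2) / α + 1) = E at hpos
  field_simp

/-- The integral shows that a continuation exists. By the identity theorem on the connected
half-line, the function chosen in the definition must agree with it. -/
theorem gaussHypergeometric_eq_hypIntegral {α : ℝ} (hα : 2 < α) {x : ℝ} (hx : x < 1) :
    gaussHypergeometric 1 ((α - 2) / α) (2 - 2 / α) x = hypIntegral α x := by
  have hex : ∃ f : ℝ → ℝ, AnalyticOnNhd ℝ f (Iio 1) ∧
      ∀ y : ℝ, |y| < 1 → f y = ordinaryHypergeometric 1 ((α - 2) / α) (2 - 2 / α) y :=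
    ⟨hypIntegral α, analyticOnNhd_hypIntegral hα,
      fun y hy => hypIntegral_eq_ordinaryHypergeometric hα hy⟩
  rw [gaussHypergeometric, dif_pos hex]
  refine hex.choose_spec.1.eqOn_of_preconnected_of_eventuallyEq (analyticOnNhd_hypIntegral hα)
    isPreconnected_Iio (z₀ := 0) (by simp) ?_ hx
  filter_upwards [Metric.ball_mem_nhds (0 : ℝ) one_pos] with y hy
  have hy' : |y| < 1 := by simpa using hy
  rw [hex.choose_spec.2 y hy', hypIntegral_eq_ordinaryHypergeometric hα hy']

end Hypergeometric

/-! ### Bounds on the hypergeometric integral and the radial integral of the fading loss. -/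

section Radial

variable {α : ℝ}

lemma hypIntegral_nonneg (hα : 2 < α) {x : ℝ} (hx : x ≤ 0) : 0 ≤ hypIntegral α x := by
  refine mul_nonneg (by linarith) (setIntegral_nonneg measurableSet_Ioi fun y (hy : 1 < y) => ?_)
  have hw := rpow_neg_mem_Ioc hα hy
  exact div_nonneg (Real.rpow_nonneg (by linarith) _) (by nlinarith [hw.1])

lemma hypIntegral_le_one (hα : 2 < α) {x : ℝ} (hx : x ≤ 0) : hypIntegral α x ≤ 1 := by
  have hint : IntegrableOn (fun y : ℝ => y ^ (1 - α)) (Ioi 1) :=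
    integrableOn_Ioi_rpow_of_lt (by linarith) one_pos
  have h1 : ∫ y in Ioi (1 : ℝ), y ^ (1 - α) / (1 - x * y ^ (-α)) ≤
      ∫ y in Ioi (1 : ℝ), y ^ (1 - α) := by
    refine integral_mono_of_nonneg ?_ hint ?_
    · refine (ae_restrict_mem measurableSet_Ioi).mono fun y (hy : 1 < y) => ?_
      have hw := rpow_neg_mem_Ioc hα hy
      exact div_nonneg (Real.rpow_nonneg (by linarith) _) (by nlinarith [hw.1])
    · refine (ae_restrict_mem measurableSet_Ioi).mono fun y (hy : 1 < y) => ?_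
      have hw := rpow_neg_mem_Ioc hα hy
      exact div_le_self (Real.rpow_nonneg (by linarith) _) (by nlinarith [hw.1])
  rw [integral_Ioi_rpow_of_lt (by linarith) one_pos, Real.one_rpow] at h1
  calc hypIntegral α x ≤ (α - 2) * (-1 / (1 - α + 1)) :=
        mul_le_mul_of_nonneg_left h1 (by linarith)
    _ = 1 := by
        rw [show 1 - α + 1 = -(α - 2) by ring, neg_div_neg_eq]
        exact mul_one_div_cancel (by linarith)

/-- The value `1 - E exp (-A H x^(-α))` for an exponential variable `H` of mean `1`. -/
noncomputable def fadingLoss (α A x : ℝ) : ℝ := A * x ^ (-α) / (1 + A * x ^ (-α))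

lemma fadingLoss_nonneg {A x : ℝ} (hA : 0 ≤ A) (hx : 0 ≤ x) : 0 ≤ fadingLoss α A x := by
  have := mul_nonneg hA (Real.rpow_nonneg hx (-α))
  exact div_nonneg this (by linarith)

/-- The substitution x = M y reduces the range to (1,∞) and produces the powers of M. -/
lemma integral_mul_fadingLoss (hα : 2 < α) {A M : ℝ} (hM : 0 < M) :
    ∫ x in Ioi M, x * fadingLoss α A x =
      A * M ^ (2 - α) / (α - 2) * hypIntegral α (-(A * M ^ (-α))) := by
  have hα' : α - 2 ≠ 0 := by linarith
  rw [hypIntegral]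
  have h1 := integral_comp_mul_left_Ioi (fun x => x * fadingLoss α A x) 1 hM
  rw [mul_one, smul_eq_mul, eq_inv_mul_iff_mul_eq₀ hM.ne'] at h1
  rw [← h1, div_mul_eq_mul_div, mul_div_assoc, mul_div_cancel_left₀ _ hα', ← integral_const_mul,
    ← integral_const_mul]
  refine setIntegral_congr_fun measurableSet_Ioi fun y (hy : 1 < y) => ?_
  have hy0 : 0 < y := by linarith
  simp only [fadingLoss]
  rw [Real.mul_rpow hM.le hy0.le, show 2 - α = 1 + 1 + -α by ring, show 1 - α = 1 + -α by ring,
    Real.rpow_add hM, Real.rpow_add hM, Real.rpow_add hy0, Real.rpow_one, Real.rpow_one]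
  rw [show 1 - -(A * M ^ (-α)) * y ^ (-α) = 1 + A * (M ^ (-α) * y ^ (-α)) by ring]
  ring

lemma integrableOn_mul_fadingLoss (hα : 2 < α) {A M : ℝ} (hA : 0 ≤ A) (hM : 0 < M) :
    IntegrableOn (fun x => x * fadingLoss α A x) (Ioi M) := by
  have hint : IntegrableOn (fun y : ℝ => y ^ (1 - α)) (Ioi M) :=
    integrableOn_Ioi_rpow_of_lt (by linarith) hM
  have hmeas : Measurable fun x => x * fadingLoss α A x := by
    unfold fadingLoss
    fun_prop
  refine (hint.const_mul A).mono' hmeas.aestronglyMeasurable ?_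
  refine (ae_restrict_mem measurableSet_Ioi).mono fun y (hy : M < y) => ?_
  have hy0 : 0 < y := hM.trans hy
  have hw : 0 ≤ A * y ^ (-α) := mul_nonneg hA (Real.rpow_nonneg hy0.le _)
  rw [Real.norm_of_nonneg (mul_nonneg hy0.le (fadingLoss_nonneg hA hy0.le)),
    show 1 - α = 1 + -α by ring, Real.rpow_add hy0, Real.rpow_one, mul_left_comm]
  exact mul_le_mul_of_nonneg_left (div_le_self hw (by linarith)) hy0.le

theorem lintegral_fadingLoss (hα : 2 < α) {A M : ℝ} (hA : 0 ≤ A) (hM : 0 < M) :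
    ∫⁻ x : Plane, ENNReal.ofReal ((Ioi M).indicator (fadingLoss α A) ‖x‖) =
      ENNReal.ofReal (2 * Real.pi *
        (A * M ^ (2 - α) / (α - 2) * hypIntegral α (-(A * M ^ (-α))))) := by
  have hdim : Module.finrank ℝ Plane = 2 := by simp
  have heq (y : ℝ) : y ^ (Module.finrank ℝ Plane - 1) • (Ioi M).indicator (fadingLoss α A) y =
      (Ioi M).indicator (fun x => x * fadingLoss α A x) y := by
    rw [hdim]
    by_cases hy : y ∈ Ioi M <;> simp [hy]
  have hsub : Ioi M ∩ Ioi (0 : ℝ) = Ioi M := inter_eq_left.2 (Ioi_subset_Ioi hM.le)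
  have hint : Integrable fun x : Plane => (Ioi M).indicator (fadingLoss α A) ‖x‖ := by
    rw [integrable_fun_norm_addHaar]
    simp only [heq]
    rw [IntegrableOn, integrable_indicator_iff measurableSet_Ioi, IntegrableOn,
      Measure.restrict_restrict measurableSet_Ioi, hsub]
    exact integrableOn_mul_fadingLoss hα hA hM
  rw [← ofReal_integral_eq_lintegral_ofReal hint (ae_of_all _ fun x =>
    indicator_nonneg (fun y (hy : M < y) => fadingLoss_nonneg hA (hM.trans hy).le) _)]
  congr 1
  rw [integral_fun_norm_addHaar]
  simp only [heq]
  rw [setIntegral_indicator measurableSet_Ioi, inter_comm, hsub,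
    integral_mul_fadingLoss hα hM, hdim, Measure.real,
    EuclideanSpace.volume_ball_fin_two]
  simp only [nsmul_eq_mul, smul_eq_mul]
  simp [Real.pi_nonneg]
  ring

end Radial

/-! ### Distances to the nearest points -/

section NearestDist

/-- Counts are by index, so coinciding points are counted with multiplicity. -/
lemma natCast_le_pointMeasure_iff {Ω : Type*} (X : ℕ → Ω → Plane) (ω : Ω) {A : Set Plane}
    (hA : MeasurableSet A) (q : ℕ) :
    (q : ℝ≥0∞) ≤ pointMeasure X ω A ↔ ∃ t : Finset ℕ, t.card = q ∧ ∀ i ∈ t, X i ω ∈ A := by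
  have h1 : pointMeasure X ω A = ({i | X i ω ∈ A}.encard : ℝ≥0∞) := by
    rw [pointMeasure_apply X ω hA, ← ENNReal.tsum_set_one,
      tsum_subtype {i | X i ω ∈ A} (fun _ => (1 : ℝ≥0∞))]
    rfl
  have h2 : (q : ℝ≥0∞) = ((q : ℕ∞) : ℝ≥0∞) := by simp
  rw [h1, h2, ENat.toENNReal_le]
  constructor
  · intro h
    obtain ⟨t, ht, htq⟩ := exists_subset_encard_eq h
    have hfin : t.Finite := finite_of_encard_eq_coe htq
    refine ⟨hfin.toFinset, ?_, fun i hi => ht (hfin.mem_toFinset.1 hi)⟩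
    rw [hfin.encard_eq_coe_toFinset_card] at htq
    exact_mod_cast htq
  · rintro ⟨t, rfl, ht⟩
    rw [← encard_coe_eq_coe_finsetCard]
    exact encard_le_encard ht

variable {Ω : Type*} {X : ℕ → Ω → Plane} {ω : Ω}

lemma nthNearestDist_nonneg (X : ℕ → Ω → Plane) (q : ℕ) (ω : Ω) :
    0 ≤ nthNearestDist X 0 q ω := Real.sInf_nonneg fun _ hρ => hρ.1

lemma nthNearestDist_lt_iff' {q : ℕ}
    (hne : ∃ n : ℕ, (q : ℝ≥0∞) ≤ pointMeasure X ω (Metric.closedBall 0 n)) (a : ℝ) :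
    nthNearestDist X 0 q ω < a ↔
      ∃ ρ : ℝ, (0 ≤ ρ ∧ (q : ℝ≥0∞) ≤ pointMeasure X ω (Metric.closedBall 0 ρ)) ∧ ρ < a := by
  obtain ⟨n, hn⟩ := hne
  exact csInf_lt_iff ⟨0, fun _ hρ => hρ.1⟩ ⟨n, n.cast_nonneg, hn⟩

/-- For the reverse direction, the farthest of q points in the open ball supplies a closed ball of
radius below a. The hypothesis `hne` excludes the infimum of the empty set. -/
lemma nthNearestDist_lt_iff {q : ℕ} (hq : 0 < q)
    (hne : ∃ n : ℕ, (q : ℝ≥0∞) ≤ pointMeasure X ω (Metric.closedBall 0 n)) (a : ℝ) :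
    nthNearestDist X 0 q ω < a ↔ (q : ℝ≥0∞) ≤ pointMeasure X ω (Metric.ball 0 a) := by
  rw [nthNearestDist_lt_iff' hne]
  constructor
  · rintro ⟨ρ, ⟨-, h⟩, hρ⟩
    exact h.trans (measure_mono (Metric.closedBall_subset_ball hρ))
  · intro h
    obtain ⟨t, rfl, ht⟩ := (natCast_le_pointMeasure_iff X ω Metric.isOpen_ball.measurableSet q).1 h
    have htne : t.Nonempty := Finset.card_pos.1 hq
    obtain ⟨i, hi, hmax⟩ := t.exists_max_image (fun i => ‖X i ω‖) htne
    refine ⟨‖X i ω‖, ⟨norm_nonneg _, ?_⟩, by simpa using ht i hi⟩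
    refine (natCast_le_pointMeasure_iff X ω Metric.isClosed_closedBall.measurableSet _).2
      ⟨t, rfl, fun i' hi' => ?_⟩
    simpa using hmax i' hi'

lemma nthNearestDist_of_forall_lt {q : ℕ}
    (hne : ∀ n : ℕ, pointMeasure X ω (Metric.closedBall 0 n) < q) :
    nthNearestDist X 0 q ω = 0 := by
  rw [nthNearestDist]
  convert Real.sInf_empty
  refine eq_empty_of_forall_notMem fun ρ hρ => ?_
  obtain ⟨n, hn⟩ := exists_nat_ge ρ
  exact absurd (hρ.2.trans (measure_mono (Metric.closedBall_subset_closedBall hn))) (hne n).not_ge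

lemma measurable_nthNearestDist [MeasurableSpace Ω] (hX : ∀ i, Measurable (X i)) (q : ℕ) :
    Measurable (nthNearestDist X 0 q) := by
  have hN {A : Set Plane} (hA : MeasurableSet A) : Measurable fun ω => pointMeasure X ω A := by
    simp only [pointMeasure_apply X _ hA]
    exact Measurable.tsum fun i => (measurable_one.indicator hA).comp (hX i)
  have hcb (ρ : ℝ) : MeasurableSet (Metric.closedBall (0 : Plane) ρ) :=
    Metric.isClosed_closedBall.measurableSet
  refine measurable_of_Iio fun a => ?_
  rcases le_or_gt a 0 with ha | ha
  · convert MeasurableSet.empty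
    exact eq_empty_of_forall_notMem fun ω (hω : _ < a) =>
      absurd (nthNearestDist_nonneg X q ω) (by linarith)
  -- With fewer than q points in the plane the distance has the default value 0 < a, which accounts
  -- for the first set. Rational radii make the union countable.
  have hset : nthNearestDist X 0 q ⁻¹' Iio a =
      {ω | ∀ n : ℕ, pointMeasure X ω (Metric.closedBall 0 n) < q} ∪
      ⋃ ρ : {ρ : ℚ // (0 : ℝ) ≤ ρ ∧ (ρ : ℝ) < a},
        {ω | (q : ℝ≥0∞) ≤ pointMeasure X ω (Metric.closedBall 0 ((ρ : ℚ) : ℝ))} := by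
    ext ω
    simp only [mem_preimage, mem_Iio, mem_union, mem_ofPred_eq, mem_iUnion]
    by_cases hne : ∃ n : ℕ, (q : ℝ≥0∞) ≤ pointMeasure X ω (Metric.closedBall 0 n)
    · rw [nthNearestDist_lt_iff' hne]
      constructor
      · rintro ⟨ρ, ⟨h0, h⟩, hρ⟩
        obtain ⟨ρ', h1, h2⟩ := exists_rat_btwn hρ
        exact Or.inr ⟨⟨ρ', h0.trans h1.le, h2⟩,
          h.trans (measure_mono (Metric.closedBall_subset_closedBall h1.le))⟩
      · rintro (h | ⟨ρ, hρ⟩)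
        · obtain ⟨n, hn⟩ := hne
          exact absurd hn (h n).not_ge
        · exact ⟨_, ⟨ρ.2.1, hρ⟩, ρ.2.2⟩
    · push Not at hne
      simp [nthNearestDist_of_forall_lt hne, ha, hne]
  rw [hset]
  refine MeasurableSet.union ?_ (MeasurableSet.iUnion fun ρ => ?_)
  · simp only [ofPred_forall]
    exact MeasurableSet.iInter fun n => measurableSet_lt (hN (hcb n)) measurable_const
  · exact measurableSet_le measurable_const (hN (hcb _))

end NearestDist

/-! ### Tail probabilities of the first two distances. -/

section PoissonDist

variable {Ω : Type*} [MeasurableSpace Ω] {X : ℕ → Ω → Plane} {P : Measure Ω} {l : ℝ}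

lemma IsPoissonPointProcess.measure_count_lt {ν : Measure Plane}
    (hX : IsPoissonPointProcess X ν P) {A : Set Plane} (hA : MeasurableSet A) (hν : ν A ≠ ∞)
    (q : ℕ) : P {ω | pointMeasure X ω A < q} = poissonMeasure (ν A).toNNReal (Iio q) := by
  have h1 : MeasurableSet {z : ℝ≥0∞ | z < q} := measurableSet_Iio
  rw [(hX.poisson A hA hν).measure_eq (p := fun z => z < q) h1, Measure.map_apply .of_discrete h1]
  congr 1
  ext m
  exact Nat.cast_lt (α := ℝ≥0∞)

lemma IsPoissonPointProcess.measure_count_lt_one {ν : Measure Plane}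
    (hX : IsPoissonPointProcess X ν P) {A : Set Plane} (hA : MeasurableSet A) (hν : ν A ≠ ∞) :
    P {ω | pointMeasure X ω A < 1} = ENNReal.ofReal (Real.exp (-(ν A).toReal)) := by
  have h := hX.measure_count_lt hA hν 1
  have hI : Iio 1 = ({0} : Set ℕ) := by ext m; simp
  rw [hI, poissonMeasure_singleton, Nat.cast_one] at h
  rw [h]
  congr 1
  simp only [pow_zero, Nat.factorial_zero, Nat.cast_one, div_one, mul_one]
  rfl

lemma IsPoissonPointProcess.measure_count_lt_two {ν : Measure Plane}
    (hX : IsPoissonPointProcess X ν P) {A : Set Plane} (hA : MeasurableSet A) (hν : ν A ≠ ∞) :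
    P {ω | pointMeasure X ω A < 2} =
      ENNReal.ofReal (Real.exp (-(ν A).toReal) * (1 + (ν A).toReal)) := by
  have h := hX.measure_count_lt hA hν 2
  have hI : Iio 2 = ({0} ∪ {1} : Set ℕ) := by ext m; simp; omega
  rw [hI, measure_union (by simp) (measurableSet_singleton _), poissonMeasure_singleton,
    poissonMeasure_singleton, ← ENNReal.ofReal_add (by positivity) (by positivity),
    Nat.cast_two] at h
  rw [h]
  congr 1
  simp only [pow_zero, Nat.factorial_zero, pow_one, Nat.factorial_one, Nat.cast_one, div_one]
  rw [mul_add]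
  rfl

end PoissonDist

section PoissonDist

variable {Ω : Type*} [MeasurableSpace Ω] {X : ℕ → Ω → Plane} {P : Measure Ω} {l : ℝ}

lemma intensity_ball (hl : 0 ≤ l) (a : ℝ) :
    (ENNReal.ofReal l • (volume : Measure Plane)) (Metric.ball 0 a) =
      ENNReal.ofReal (Real.pi * l * (max a 0) ^ 2) := by
  -- A ball of negative radius is empty; `max a 0` lets the tail formulas hold for all real a.
  have h : ENNReal.ofReal a = ENNReal.ofReal (max a 0) := by
    simp
  rw [Measure.smul_apply, EuclideanSpace.volume_ball_fin_two, smul_eq_mul, h,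
    ← ENNReal.ofReal_pow (le_max_right _ _)]
  rw [← ENNReal.ofReal_mul (by positivity), ← ENNReal.ofReal_mul hl]
  congr 1
  ring

lemma intensity_ball_toReal (hl : 0 ≤ l) (a : ℝ) :
    ((ENNReal.ofReal l • (volume : Measure Plane)) (Metric.ball 0 a)).toReal =
      Real.pi * l * (max a 0) ^ 2 := by
  rw [intensity_ball hl, ENNReal.toReal_ofReal (by positivity)]

lemma intensity_ball_ne_top (hl : 0 ≤ l) (a : ℝ) :
    (ENNReal.ofReal l • (volume : Measure Plane)) (Metric.ball 0 a) ≠ ∞ := by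
  rw [intensity_ball hl]
  exact ENNReal.ofReal_ne_top

variable (hl : 0 < l) (hX : IsPoissonPointProcess X (ENNReal.ofReal l • volume) P)

include hl hX

/-- The probability of at most one point in the ball of radius n is e^(-x)(1+x) with x = πln², and
it tends to 0. Almost surely, then, neither of the first two distances is a default value. -/
lemma ae_exists_two_le_count :
    ∀ᵐ ω ∂P, ∃ n : ℕ, (2 : ℝ≥0∞) ≤ pointMeasure X ω (Metric.closedBall 0 n) := by
  have hm (a : ℝ) : MeasurableSet (Metric.ball (0 : Plane) a) := Metric.isOpen_ball.measurableSet
  have hlim : Tendsto (fun n : ℕ => P {ω | pointMeasure X ω (Metric.ball 0 n) < 2}) atTop (𝓝 0) := by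
    simp only [hX.measure_count_lt_two (hm _) (intensity_ball_ne_top hl.le _),
      intensity_ball_toReal hl.le]
    rw [← ENNReal.ofReal_zero]
    refine ENNReal.tendsto_ofReal ?_
    have h1 : Tendsto (fun x : ℝ => Real.exp (-x) * (1 + x)) atTop (𝓝 0) := by
      have h := (Real.tendsto_pow_mul_exp_neg_atTop_nhds_zero 0).add
        (Real.tendsto_pow_mul_exp_neg_atTop_nhds_zero 1)
      simp only [pow_zero, one_mul, pow_one, add_zero] at h
      refine h.congr fun x => by ring
    refine h1.comp ?_
    have h2 (n : ℕ) : max (n : ℝ) 0 = n := max_eq_left n.cast_nonneg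
    simp only [h2]
    exact ((tendsto_pow_atTop two_ne_zero).comp tendsto_natCast_atTop_atTop).const_mul_atTop
      (mul_pos Real.pi_pos hl)
  rw [ae_iff]
  refine le_antisymm (ge_of_tendsto' hlim fun n => measure_mono fun ω hω => ?_) zero_le
  have hω : ¬ ∃ n : ℕ, (2 : ℝ≥0∞) ≤ pointMeasure X ω (Metric.closedBall 0 n) := hω
  push Not at hω
  exact (measure_mono Metric.ball_subset_closedBall).trans_lt (hω n)

lemma ae_le_nthNearestDist_iff :
    ∀ᵐ ω ∂P, (∀ a, a ≤ nthNearestDist X 0 1 ω ↔ pointMeasure X ω (Metric.ball 0 a) < 1) ∧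
      ∀ a, a ≤ nthNearestDist X 0 2 ω ↔ pointMeasure X ω (Metric.ball 0 a) < 2 := by
  filter_upwards [ae_exists_two_le_count hl hX] with ω ⟨n, hn⟩
  have h1 := nthNearestDist_lt_iff (X := X) (ω := ω) (q := 1) one_pos
    ⟨n, le_trans (by simp) hn⟩
  have h2 := nthNearestDist_lt_iff (X := X) (ω := ω) (q := 2) two_pos ⟨n, hn⟩
  refine ⟨fun a => ?_, fun a => ?_⟩
  · rw [← not_lt, h1, not_le, Nat.cast_one]
  · rw [← not_lt, h2, not_le, Nat.cast_two]

lemma measure_le_nearestDist (a : ℝ) :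
    P {ω | a ≤ nthNearestDist X 0 1 ω} =
      ENNReal.ofReal (Real.exp (-(Real.pi * l * (max a 0) ^ 2))) := by
  rw [← intensity_ball_toReal hl.le, ← hX.measure_count_lt_one Metric.isOpen_ball.measurableSet
    (intensity_ball_ne_top hl.le a)]
  refine measure_congr ?_
  filter_upwards [ae_le_nthNearestDist_iff hl hX] with ω hω
  exact propext (hω.1 a)

/-- When b exceeds a ≥ 0, the event says that the disc of radius a is empty and the annulus between
a and b holds at most one point. These two counts are independent. -/
lemma measure_le_nearestDists (a b : ℝ) :
    P {ω | a ≤ nthNearestDist X 0 1 ω ∧ b ≤ nthNearestDist X 0 2 ω} =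
      ENNReal.ofReal (Real.exp (-(Real.pi * l * (max (max a 0) b) ^ 2)) *
        (1 + Real.pi * l * ((max (max a 0) b) ^ 2 - (max a 0) ^ 2))) := by
  have hae := ae_le_nthNearestDist_iff hl hX
  -- If b ≤ max a 0, the condition on the second distance follows from the one on the first.
  rcases le_or_gt b (max a 0) with hab | hab
  · rw [max_eq_left hab, sub_self, mul_zero, add_zero, mul_one, ← measure_le_nearestDist hl hX]
    refine measure_congr ?_
    filter_upwards [hae] with ω hω
    refine propext (and_iff_left_of_imp fun (h : a ≤ _) => ?_)
    rw [hω.2]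
    refine lt_of_le_of_lt (measure_mono (Metric.ball_subset_ball hab)) ?_
    have h0 : max a 0 ≤ nthNearestDist X 0 1 ω := max_le h (nthNearestDist_nonneg X 1 ω)
    exact ((hω.1 _).1 h0).trans (by simp)
  · set a' := max a 0 with ha'
    have ha0 : 0 ≤ a' := le_max_right _ _
    have hb0 : 0 < b := ha0.trans_lt hab
    set B := Metric.ball (0 : Plane) a'
    set C := Metric.ball (0 : Plane) b \ B
    have hB : MeasurableSet B := Metric.isOpen_ball.measurableSet
    have hC : MeasurableSet C := measurableSet_ball.diff hB
    have hsub : B ⊆ Metric.ball (0 : Plane) b := Metric.ball_subset_ball hab.le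
    have hBt := intensity_ball_ne_top hl.le a'
    have hCt : (ENNReal.ofReal l • (volume : Measure Plane)) C ≠ ∞ :=
      ne_top_of_le_ne_top (intensity_ball_ne_top hl.le b) (measure_mono sdiff_subset)
    have hCv : ((ENNReal.ofReal l • (volume : Measure Plane)) C).toReal =
        Real.pi * l * (b ^ 2 - a' ^ 2) := by
      rw [measure_sdiff hsub hB.nullMeasurableSet hBt, ENNReal.toReal_sub_of_le (measure_mono hsub)
        (intensity_ball_ne_top hl.le b), intensity_ball_toReal hl.le, intensity_ball_toReal hl.le,
        max_eq_left hb0.le, max_eq_left ha0]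
      ring
    have hind : IndepFun (fun ω => pointMeasure X ω B) (fun ω => pointMeasure X ω C) P := by
      have h := hX.indep 2 ![B, C] (fun i => by fin_cases i <;> simp [hB, hC]) (fun i i' hi => by
        fin_cases i <;> fin_cases i' <;> first | exact absurd rfl hi | skip
        · exact disjoint_sdiff_right
        · exact disjoint_sdiff_left)
      exact h.indepFun (i := 0) (j := 1) (by simp)
    have hmul := hind.measure_inter_preimage_eq_mul (Iio 1) (Iio 2) measurableSet_Iio
      measurableSet_Iio
    have h1 := hX.measure_count_lt_one hB hBt
    have h2 := hX.measure_count_lt_two hC hCt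
    rw [intensity_ball_toReal hl.le, max_eq_left ha0] at h1
    rw [hCv] at h2
    have hset : P {ω | a ≤ nthNearestDist X 0 1 ω ∧ b ≤ nthNearestDist X 0 2 ω} =
        P ((fun ω => pointMeasure X ω B) ⁻¹' Iio 1 ∩ (fun ω => pointMeasure X ω C) ⁻¹' Iio 2) := by
      refine measure_congr ?_
      filter_upwards [hae] with ω hω
      refine propext ?_
      change (a ≤ _ ∧ b ≤ _) ↔ (pointMeasure X ω B < 1 ∧ pointMeasure X ω C < 2)
      have hsplit : pointMeasure X ω (Metric.ball 0 b) = pointMeasure X ω B + pointMeasure X ω C := by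
        rw [← measure_union disjoint_sdiff_right hC, union_sdiff_cancel hsub]
      have haa : a ≤ nthNearestDist X 0 1 ω ↔ a' ≤ nthNearestDist X 0 1 ω := by
        rw [ha', max_le_iff, and_iff_left (nthNearestDist_nonneg X 1 ω)]
      rw [haa, hω.1, hω.2, hsplit]
      refine and_congr_right fun h => ?_
      have hzero : pointMeasure X ω B = 0 := by
        by_contra hne
        refine absurd h (not_lt.2 ?_)
        rw [← Nat.cast_one, natCast_le_pointMeasure_iff X ω hB]
        rw [pointMeasure_apply X ω hB, ENNReal.tsum_eq_zero] at hne
        push Not at hne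
        obtain ⟨i, hi⟩ := hne
        exact ⟨{i}, by simp, by simpa using hi⟩
      rw [hzero, zero_add]
    rw [hset, hmul]
    change P {ω | pointMeasure X ω B < 1} * P {ω | pointMeasure X ω C < 2} = _
    rw [h1, h2, ← ENNReal.ofReal_mul (Real.exp_nonneg _), ← mul_assoc, ← Real.exp_add,
      max_eq_right hab.le]
    congr 3
    ring

end PoissonDist

/-! ### Densities of the nearest distance and of the first two distances. -/

section Laws

lemma lintegral_Ioi_of_hasDerivAt {g g' : ℝ → ℝ} {a m : ℝ}
    (hderiv : ∀ x ∈ Ici a, HasDerivAt g (g' x) x) (hpos : ∀ x ∈ Ioi a, 0 ≤ g' x)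
    (hg : Tendsto g atTop (𝓝 m)) :
    ∫⁻ x in Ioi a, ENNReal.ofReal (g' x) = ENNReal.ofReal (m - g a) := by
  rw [← integral_Ioi_of_hasDerivAt_of_nonneg' hderiv hpos hg,
    ofReal_integral_eq_lintegral_ofReal (integrableOn_Ioi_deriv_of_nonneg' hderiv hpos hg)
      ((ae_restrict_mem measurableSet_Ioi).mono hpos)]

variable {l : ℝ}

lemma tendsto_mul_sq_atTop (hl : 0 < l) :
    Tendsto (fun x : ℝ => Real.pi * l * x ^ 2) atTop atTop :=
  (tendsto_pow_atTop two_ne_zero).const_mul_atTop (mul_pos Real.pi_pos hl)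

lemma hasDerivAt_exp_neg_sq (l x : ℝ) :
    HasDerivAt (fun x => Real.exp (-(Real.pi * l * x ^ 2))) (-nearestPDF l x) x := by
  have h := (((hasDerivAt_pow 2 x).const_mul (Real.pi * l)).fun_neg).exp
  refine h.congr_deriv ?_
  simp only [nearestPDF]
  push_cast
  ring

lemma nearestPDF_nonneg (hl : 0 < l) {x : ℝ} (hx : 0 ≤ x) : 0 ≤ nearestPDF l x := by
  unfold nearestPDF
  have := Real.pi_pos
  positivity

lemma lintegral_nearestPDF (hl : 0 < l) {a : ℝ} (ha : 0 ≤ a) :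
    ∫⁻ x in Ioi a, ENNReal.ofReal (nearestPDF l x) = ENNReal.ofReal (nearestCCDF l a) := by
  have h := lintegral_Ioi_of_hasDerivAt (a := a) (m := -0)
    (fun x _ => (hasDerivAt_exp_neg_sq l x).fun_neg)
    (fun x (hx : a < x) => by simpa using nearestPDF_nonneg hl (ha.trans hx.le))
    (Real.tendsto_exp_neg_atTop_nhds_zero.comp (tendsto_mul_sq_atTop hl)).neg
  simpa [nearestCCDF] using h

lemma nearestTwoPDF_eq (l r v : ℝ) :
    nearestTwoPDF l r v = 2 * Real.pi * l * r * nearestPDF l v := by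
  unfold nearestTwoPDF nearestPDF
  ring

lemma lintegral_nearestTwoPDF_right (hl : 0 < l) {r m : ℝ} (hr : 0 ≤ r) (hm : 0 ≤ m) :
    ∫⁻ v in Ioi m, ENNReal.ofReal (nearestTwoPDF l r v) =
      ENNReal.ofReal (2 * Real.pi * l * r * Real.exp (-(Real.pi * l * m ^ 2))) := by
  have := Real.pi_pos
  have hc : 0 ≤ 2 * Real.pi * l * r := by positivity
  have hm' : Measurable fun v => ENNReal.ofReal (nearestPDF l v) := by
    unfold nearestPDF
    fun_prop
  simp only [nearestTwoPDF_eq, ENNReal.ofReal_mul hc]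
  rw [lintegral_const_mul _ hm', lintegral_nearestPDF hl hm]
  rfl

lemma lintegral_nearestTwoPDF_left (hl : 0 < l) {a v : ℝ} (ha : 0 ≤ a) (hv : a < v) :
    ∫⁻ r in Ioo a v, ENNReal.ofReal (nearestTwoPDF l r v) =
      ENNReal.ofReal (Real.pi * l * (v ^ 2 - a ^ 2) * nearestPDF l v) := by
  have := Real.pi_pos
  have hint : ∫ r in a..v, nearestTwoPDF l r v =
      Real.pi * l * (v ^ 2 - a ^ 2) * nearestPDF l v := by
    have h (r : ℝ) : nearestTwoPDF l r v = 2 * Real.pi * l * nearestPDF l v * r := by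
      rw [nearestTwoPDF_eq]; ring
    simp only [h]
    rw [intervalIntegral.integral_const_mul, integral_id]
    ring
  have hcont : Continuous fun r => nearestTwoPDF l r v := by
    unfold nearestTwoPDF
    fun_prop
  rw [← hint, intervalIntegral.integral_of_le hv.le, integral_Ioc_eq_integral_Ioo,
    ofReal_integral_eq_lintegral_ofReal]
  · exact (hcont.integrableOn_Icc (a := a) (b := v)).mono_set Ioo_subset_Icc_self
  · refine (ae_restrict_mem measurableSet_Ioo).mono fun r hr => ?_
    have h0 : 0 ≤ r := ha.trans hr.1.le
    change 0 ≤ nearestTwoPDF l r v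
    rw [nearestTwoPDF_eq]
    have := nearestPDF_nonneg hl (ha.trans hv.le)
    positivity

/-- The law of the distance to the nearest point. -/
noncomputable def nearestLaw (l : ℝ) : Measure ℝ :=
  volume.withDensity ((Ioi 0).indicator fun x => ENNReal.ofReal (nearestPDF l x))

/-- The joint law of the distances to the nearest and the second nearest point. -/
noncomputable def nearestTwoLaw (l : ℝ) : Measure (ℝ × ℝ) :=
  volume.withDensity
    ({x | 0 < x.1 ∧ x.1 < x.2}.indicator fun x => ENNReal.ofReal (nearestTwoPDF l x.1 x.2))

lemma nearestLaw_Ici (hl : 0 < l) (a : ℝ) : nearestLaw l (Ici a) =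
    ENNReal.ofReal (Real.exp (-(Real.pi * l * (max a 0) ^ 2))) := by
  rw [nearestLaw, withDensity_apply _ measurableSet_Ici, setLIntegral_congr Ioi_ae_eq_Ici.symm,
    setLIntegral_indicator measurableSet_Ioi, inter_comm, Ioi_inter_Ioi,
    lintegral_nearestPDF hl (le_max_right _ _)]
  rfl

lemma measurableSet_pos_lt : MeasurableSet {x : ℝ × ℝ | 0 < x.1 ∧ x.1 < x.2} :=
  (measurableSet_lt measurable_const measurable_fst).inter
    (measurableSet_lt measurable_fst measurable_snd)

lemma measurable_ofReal_nearestTwoPDF (l : ℝ) :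
    Measurable fun x : ℝ × ℝ => ENNReal.ofReal (nearestTwoPDF l x.1 x.2) := by
  unfold nearestTwoPDF
  fun_prop

lemma nearestTwoLaw_Ici (hl : 0 < l) (a b : ℝ) : nearestTwoLaw l (Ici a ×ˢ Ici b) =
    ENNReal.ofReal (Real.exp (-(Real.pi * l * (max (max a 0) b) ^ 2)) *
      (1 + Real.pi * l * ((max (max a 0) b) ^ 2 - (max a 0) ^ 2))) := by
  have hae : (Ici a ×ˢ Ici b : Set (ℝ × ℝ)) =ᵐ[volume] Ioi a ×ˢ Ioi b :=
    Measure.set_prod_ae_eq Ioi_ae_eq_Ici.symm Ioi_ae_eq_Ici.symm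
  have hg := measurable_ofReal_nearestTwoPDF l
  have hset : {x : ℝ × ℝ | 0 < x.1 ∧ x.1 < x.2} ∩ Ioi a ×ˢ Ioi b =
      {x | max a 0 < x.1 ∧ x.1 < x.2 ∧ max (max a 0) b < x.2} := by
    ext ⟨r, v⟩
    simp only [mem_inter_iff, mem_ofPred_eq, mem_prod, mem_Ioi, max_lt_iff]
    constructor
    · rintro ⟨⟨h1, h2⟩, h3, h4⟩
      exact ⟨⟨h3, h1⟩, h2, ⟨h3.trans h2, h1.trans h2⟩, h4⟩
    · rintro ⟨⟨h1, h2⟩, h3, -, h4⟩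
      exact ⟨⟨h2, h3⟩, h1, h4⟩
  have hS : MeasurableSet {x : ℝ × ℝ | max a 0 < x.1 ∧ x.1 < x.2 ∧ max (max a 0) b < x.2} := by
    rw [← hset]
    exact measurableSet_pos_lt.inter (measurableSet_Ioi.prod measurableSet_Ioi)
  rw [nearestTwoLaw, withDensity_apply _ (measurableSet_Ici.prod measurableSet_Ici),
    setLIntegral_congr hae, setLIntegral_indicator measurableSet_pos_lt, hset,
    ← lintegral_indicator hS, Measure.volume_eq_prod,
    lintegral_prod_symm _ (hg.indicator hS).aemeasurable]
  set a' := max a 0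
  set b' := max a' b
  have ha' : 0 ≤ a' := le_max_right _ _
  have hb' : a' ≤ b' := le_max_left _ _
  have hinner (v : ℝ) : ∫⁻ r, {x : ℝ × ℝ | a' < x.1 ∧ x.1 < x.2 ∧ b' < x.2}.indicator
      (fun x => ENNReal.ofReal (nearestTwoPDF l x.1 x.2)) (r, v) =
      (Ioi b').indicator (fun v =>
        ENNReal.ofReal (Real.pi * l * (v ^ 2 - a' ^ 2) * nearestPDF l v)) v := by
    by_cases hv : v ∈ Ioi b'
    · rw [indicator_of_mem hv, ← lintegral_nearestTwoPDF_left hl ha' (hb'.trans_lt hv),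
        ← lintegral_indicator measurableSet_Ioo]
      refine lintegral_congr fun r => ?_
      by_cases hr : r ∈ Ioo a' v
      · rw [indicator_of_mem hr, indicator_of_mem]
        exact ⟨hr.1, hr.2, hv⟩
      · rw [indicator_of_notMem hr, indicator_of_notMem]
        exact fun h => hr ⟨h.1, h.2.1⟩
    · rw [indicator_of_notMem hv, ← lintegral_zero]
      refine lintegral_congr fun r => indicator_of_notMem (fun h => hv h.2.2) _
  simp only [hinner]
  rw [lintegral_indicator measurableSet_Ioi]
  -- This is the antiderivative of πl(v² - a'²) times the nearest-point density, with the constant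
  -- chosen so that it vanishes at infinity.
  have hlim : Tendsto (fun v => -(Real.exp (-(Real.pi * l * v ^ 2)) *
      (1 + Real.pi * l * (v ^ 2 - a' ^ 2)))) atTop (𝓝 (-0)) := by
    have h1 : Tendsto (fun x : ℝ => Real.exp (-x) * (1 + x - Real.pi * l * a' ^ 2)) atTop (𝓝 0) := by
      have h := ((Real.tendsto_pow_mul_exp_neg_atTop_nhds_zero 0).const_mul
        (1 - Real.pi * l * a' ^ 2)).add (Real.tendsto_pow_mul_exp_neg_atTop_nhds_zero 1)
      simp only [pow_zero, one_mul, pow_one, add_zero, mul_zero] at h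
      refine h.congr fun x => by ring
    refine (h1.comp (tendsto_mul_sq_atTop hl)).neg.congr fun v => ?_
    simp only [Function.comp_apply]
    ring
  have hpi := Real.pi_pos
  rw [lintegral_Ioi_of_hasDerivAt (fun v _ => ?_) (fun v (hv : b' < v) => ?_) hlim]
  · congr 1
    ring
  · refine ((hasDerivAt_exp_neg_sq l v).fun_mul ((((hasDerivAt_pow 2 v).sub_const
      (a' ^ 2)).const_mul (Real.pi * l)).const_add 1)).fun_neg.congr_deriv ?_
    simp only [nearestPDF]
    push_cast
    ring
  · have h0 : 0 ≤ v := (ha'.trans hb').trans hv.le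
    have := nearestPDF_nonneg hl h0
    have : 0 ≤ v ^ 2 - a' ^ 2 := by nlinarith
    positivity

variable {Ω : Type*} [MeasurableSpace Ω] {X : ℕ → Ω → Plane} {P : Measure Ω}

theorem map_nearestDist [IsProbabilityMeasure P] (hl : 0 < l)
    (hX : IsPoissonPointProcess X (ENNReal.ofReal l • volume) P) :
    P.map (nthNearestDist X 0 1) = nearestLaw l := by
  have hm := measurable_nthNearestDist hX.measurable 1
  have := Measure.isProbabilityMeasure_map (μ := P) hm.aemeasurable
  refine Measure.ext_of_Ici _ _ fun a => ?_
  rw [Measure.map_apply hm measurableSet_Ici, nearestLaw_Ici hl]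
  exact measure_le_nearestDist hl hX a

/-- Closed quadrants form a π-system that generates the Borel sets and countably covers the plane,
so the joint tail determines the law. -/
theorem map_nearestDists [IsProbabilityMeasure P] (hl : 0 < l)
    (hX : IsPoissonPointProcess X (ENNReal.ofReal l • volume) P) :
    P.map (fun ω => (nthNearestDist X 0 1 ω, nthNearestDist X 0 2 ω)) = nearestTwoLaw l := by
  have hm : Measurable fun ω => (nthNearestDist X 0 1 ω, nthNearestDist X 0 2 ω) :=
    (measurable_nthNearestDist hX.measurable 1).prodMk (measurable_nthNearestDist hX.measurable 2)
  have := Measure.isProbabilityMeasure_map (μ := P) hm.aemeasurable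
  have hunion : ⋃ n : ℕ, Ici (-(n : ℝ)) = univ := by
    refine iUnion_eq_univ_iff.2 fun x => ?_
    obtain ⟨n, hn⟩ := exists_nat_ge (-x)
    exact ⟨n, neg_le.1 hn⟩
  have hspan : IsCountablySpanning (range (Ici : ℝ → Set ℝ)) :=
    ⟨fun n : ℕ => Ici (-(n : ℝ)), fun n => mem_range_self _, hunion⟩
  have hgen : MeasurableSpace.generateFrom (range (Ici : ℝ → Set ℝ)) =
      (inferInstance : MeasurableSpace ℝ) :=
    (borel_eq_generateFrom_Ici ℝ).symm.trans BorelSpace.measurable_eq.symm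
  have hpi : IsPiSystem (range (Ici : ℝ → Set ℝ)) := by
    rintro _ ⟨a, rfl⟩ _ ⟨b, rfl⟩ -
    exact ⟨max a b, Ici_inter_Ici.symm⟩
  obtain ⟨B, hB, hBu⟩ := hspan.prod hspan
  refine Measure.ext_of_generateFrom_of_iUnion _ B
    (generateFrom_eq_prod hgen hgen hspan hspan).symm (hpi.prod hpi) hBu hB
    (fun n => measure_ne_top _ _) ?_
  rintro _ ⟨_, ⟨a, rfl⟩, _, ⟨b, rfl⟩, rfl⟩
  rw [Measure.map_apply hm (measurableSet_Ici.prod measurableSet_Ici), nearestTwoLaw_Ici hl]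
  exact measure_le_nearestDists hl hX a b

end Laws

/-! ### The joint law of the distances to the serving and the most interfered base stations -/

section Tiers

lemma otherTier_ne (k : Fin 2) : otherTier k ≠ k := by
  fin_cases k <;> simp [otherTier]

lemma eq_otherTier_of_ne {k n : Fin 2} (h : k ≠ n) : n = otherTier k := by
  fin_cases k <;> fin_cases n <;> simp_all [otherTier]

lemma sum_tiers {M : Type*} [AddCommMonoid M] (k : Fin 2) (f : Fin 2 → M) :
    ∑ n, f n = f k + f (otherTier k) := by
  fin_cases k
  · exact Fin.sum_univ_two f
  · exact (Fin.sum_univ_two f).trans (add_comm _ _)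

end Tiers

/-! ### Integrating out one distance from the product law of two tiers. -/

section ProductLaw

variable {l : ℝ}

instance : SFinite (nearestLaw l) := by unfold nearestLaw; infer_instance

instance : SFinite (nearestTwoLaw l) := by unfold nearestTwoLaw; infer_instance

lemma nearestLaw_Ioi (hl : 0 < l) {a : ℝ} (ha : 0 ≤ a) :
    nearestLaw l (Ioi a) = ENNReal.ofReal (nearestCCDF l a) := by
  rw [nearestLaw, withDensity_apply _ measurableSet_Ioi, setLIntegral_indicator measurableSet_Ioi,
    Ioi_inter_Ioi, max_eq_right ha, lintegral_nearestPDF hl ha]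

/-- Integrating the second distance over v > max r w produces `zeta`; this is the origin of the
maximum in its exponent. -/
lemma nearestTwoLaw_prod_Ioi (hl : 0 < l) {D : Set ℝ} (hD : MeasurableSet D) {w : ℝ} (hw : 0 ≤ w) :
    nearestTwoLaw l (D ×ˢ Ioi w) = ∫⁻ r in D ∩ Ioi 0, ENNReal.ofReal (zeta l r w) := by
  have hg := measurable_ofReal_nearestTwoPDF l
  have hS := measurableSet_pos_lt.inter (hD.prod (measurableSet_Ioi (a := w)))
  rw [nearestTwoLaw, withDensity_apply _ (hD.prod measurableSet_Ioi),
    setLIntegral_indicator measurableSet_pos_lt, ← lintegral_indicator hS,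
    Measure.volume_eq_prod, lintegral_prod _ (hg.indicator hS).aemeasurable,
    ← lintegral_indicator (hD.inter measurableSet_Ioi)]
  refine lintegral_congr fun r => ?_
  by_cases hr : r ∈ D ∩ Ioi 0
  · have hr0 : 0 < r := hr.2
    rw [indicator_of_mem hr, zeta, ← lintegral_nearestTwoPDF_right hl hr0.le
      (le_max_of_le_right hw), ← lintegral_indicator measurableSet_Ioi]
    refine lintegral_congr fun v => ?_
    by_cases hv : v ∈ Ioi (max r w)
    · rw [indicator_of_mem hv, indicator_of_mem]
      rw [mem_Ioi, max_lt_iff] at hv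
      exact ⟨⟨hr0, hv.1⟩, hr.1, hv.2⟩
    · rw [indicator_of_notMem hv, indicator_of_notMem]
      exact fun h => hv (max_lt h.1.2 h.2.2)
  · rw [indicator_of_notMem hr, ← lintegral_zero]
    exact lintegral_congr fun v => indicator_of_notMem (fun h => hr ⟨h.2.1, h.1.1⟩) _

lemma measurable_ofReal_nearestPDF (l : ℝ) : Measurable fun w => ENNReal.ofReal (nearestPDF l w) := by
  unfold nearestPDF
  fun_prop

lemma measurable_zeta (l : ℝ) : Measurable fun x : ℝ × ℝ => zeta l x.1 x.2 := by
  unfold zeta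
  fun_prop

/-- The mass of the configurations in which the other tier is beyond `c` times the nearest distance
and nearer than the second nearest point. -/
lemma prod_law_other_nearer {l' c : ℝ} (hl : 0 < l) (hc : 0 ≤ c) {B : Set (ℝ × ℝ)}
    (hB : MeasurableSet B) :
    ((nearestTwoLaw l).prod (nearestLaw l'))
        {z | c * z.1.1 < z.2 ∧ z.2 < z.1.2 ∧ (z.1.1, z.2) ∈ B} =
      ∫⁻ x in B ∩ {x | 0 < x.1 ∧ c * x.1 < x.2},
        ENNReal.ofReal (nearestPDF l' x.2) * ENNReal.ofReal (zeta l x.1 x.2) := by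
  have hS : MeasurableSet {z : (ℝ × ℝ) × ℝ | c * z.1.1 < z.2 ∧ z.2 < z.1.2 ∧ (z.1.1, z.2) ∈ B} := by
    have h1 : Measurable fun z : (ℝ × ℝ) × ℝ => c * z.1.1 := by fun_prop
    have h2 : Measurable fun z : (ℝ × ℝ) × ℝ => z.1.2 := by fun_prop
    have h3 : Measurable fun z : (ℝ × ℝ) × ℝ => (z.1.1, z.2) := by fun_prop
    exact (measurableSet_lt h1 measurable_snd).inter
      ((measurableSet_lt measurable_snd h2).inter (hB.preimage h3))
  have hA : MeasurableSet (B ∩ {x : ℝ × ℝ | 0 < x.1 ∧ c * x.1 < x.2}) :=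
    hB.inter ((measurableSet_lt measurable_const measurable_fst).inter
      (measurableSet_lt (measurable_fst.const_mul c) measurable_snd))
  have hf : Measurable fun x : ℝ × ℝ =>
      ENNReal.ofReal (nearestPDF l' x.2) * ENNReal.ofReal (zeta l x.1 x.2) :=
    ((measurable_ofReal_nearestPDF l').comp measurable_snd).mul (measurable_zeta l).ennreal_ofReal
  have hD (w : ℝ) : MeasurableSet {r : ℝ | c * r < w ∧ (r, w) ∈ B} :=
    (measurableSet_lt (measurable_id.const_mul c) measurable_const).inter
      (hB.preimage (by fun_prop : Measurable fun r : ℝ => (r, w)))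
  have hz (w : ℝ) : Measurable fun r => ENNReal.ofReal (zeta l r w) :=
    ((measurable_zeta l).comp measurable_prodMk_right).ennreal_ofReal
  rw [Measure.prod_apply_symm hS, nearestLaw, lintegral_withDensity_eq_lintegral_mul _
    ((measurable_ofReal_nearestPDF l').indicator measurableSet_Ioi)
    (measurable_measure_prodMk_right hS), ← lintegral_indicator hA, Measure.volume_eq_prod,
    lintegral_prod_symm _ (hf.indicator hA).aemeasurable]
  refine lintegral_congr fun w => ?_
  rw [Pi.mul_apply]
  by_cases hw : w ∈ Ioi (0 : ℝ)
  · have hw0 : 0 < w := hw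
    have hpre : (fun x => (x, w)) ⁻¹'
        {z : (ℝ × ℝ) × ℝ | c * z.1.1 < z.2 ∧ z.2 < z.1.2 ∧ (z.1.1, z.2) ∈ B} =
        {r : ℝ | c * r < w ∧ (r, w) ∈ B} ×ˢ Ioi w := by
      ext ⟨r, v⟩
      simp only [mem_preimage, mem_ofPred_eq, mem_prod, mem_Ioi]
      tauto
    rw [indicator_of_mem hw, hpre, nearestTwoLaw_prod_Ioi hl (hD w) hw0.le,
      ← lintegral_const_mul _ (hz w),
      ← lintegral_indicator ((hD w).inter measurableSet_Ioi)]
    refine lintegral_congr fun r => ?_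
    by_cases hr : r ∈ {r : ℝ | c * r < w ∧ (r, w) ∈ B} ∩ Ioi 0
    · rw [indicator_of_mem hr, indicator_of_mem]
      exact ⟨hr.1.2, hr.2, hr.1.1⟩
    · rw [indicator_of_notMem hr, indicator_of_notMem]
      exact fun h => hr ⟨⟨h.2.2, h.1⟩, h.2.1⟩
  · rw [indicator_of_notMem hw, zero_mul, ← lintegral_zero]
    refine lintegral_congr fun r => (indicator_of_notMem (fun h => hw ?_) _).symm
    exact (mul_nonneg hc (le_of_lt h.2.1)).trans_lt h.2.2

/-- The mass of the configurations in which the other tier is beyond `c` times the nearest distance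
and beyond the second nearest point. -/
lemma prod_law_other_farther {l' c : ℝ} (hl' : 0 < l') (hc : 0 ≤ c) {B : Set (ℝ × ℝ)}
    (hB : MeasurableSet B) :
    ((nearestTwoLaw l).prod (nearestLaw l'))
        {z | c * z.1.1 < z.2 ∧ z.1.2 < z.2 ∧ z.1 ∈ B} =
      ∫⁻ x in B ∩ {x | 0 < x.1 ∧ x.1 < x.2},
        ENNReal.ofReal (nearestCCDF l' (max (c * x.1) x.2)) *
          ENNReal.ofReal (nearestTwoPDF l x.1 x.2) := by
  have hS : MeasurableSet {z : (ℝ × ℝ) × ℝ | c * z.1.1 < z.2 ∧ z.1.2 < z.2 ∧ z.1 ∈ B} := by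
    have h1 : Measurable fun z : (ℝ × ℝ) × ℝ => c * z.1.1 := by fun_prop
    have h2 : Measurable fun z : (ℝ × ℝ) × ℝ => z.1.2 := by fun_prop
    exact (measurableSet_lt h1 measurable_snd).inter
      ((measurableSet_lt h2 measurable_snd).inter (hB.preimage measurable_fst))
  rw [Measure.prod_apply hS]
  rw [nearestTwoLaw, lintegral_withDensity_eq_lintegral_mul _
    ((measurable_ofReal_nearestTwoPDF l).indicator measurableSet_pos_lt)
    (measurable_measure_prodMk_left hS), ← lintegral_indicator (hB.inter measurableSet_pos_lt)]
  refine lintegral_congr fun x => ?_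
  rw [Pi.mul_apply]
  by_cases hx : x ∈ B ∩ {x | 0 < x.1 ∧ x.1 < x.2}
  · have hm : 0 ≤ max (c * x.1) x.2 := le_max_of_le_left (mul_nonneg hc hx.2.1.le)
    have hpre : Prod.mk x ⁻¹' {z : (ℝ × ℝ) × ℝ | c * z.1.1 < z.2 ∧ z.1.2 < z.2 ∧ z.1 ∈ B} =
        Ioi (max (c * x.1) x.2) := by
      ext w
      simp only [mem_preimage, mem_ofPred_eq, mem_Ioi, max_lt_iff, hx.1, and_true]
    rw [indicator_of_mem hx, indicator_of_mem hx.2, hpre, nearestLaw_Ioi hl' hm, mul_comm]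
  · rw [indicator_of_notMem hx]
    by_cases h2 : x ∈ {x : ℝ × ℝ | 0 < x.1 ∧ x.1 < x.2}
    · have hpre : Prod.mk x ⁻¹' {z : (ℝ × ℝ) × ℝ | c * z.1.1 < z.2 ∧ z.1.2 < z.2 ∧ z.1 ∈ B} = ∅ :=
        eq_empty_of_forall_notMem fun w h => hx ⟨h.2.2, h2⟩
      rw [hpre, measure_empty, mul_zero]
    · rw [indicator_of_notMem h2, zero_mul]

end ProductLaw

/-! ### Association in terms of distances, and almost sure properties of the distances. -/

section Association

variable {Ω : Type*} [MeasurableSpace Ω] {p : Params} {P : Measure Ω} {bs : Fin 2 → ℕ → Ω → Plane}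

/-- The base stations of the two tiers form independent Poisson point processes. -/
structure IsTwoTierPoisson (p : Params) (P : Measure Ω) (bs : Fin 2 → ℕ → Ω → Plane) : Prop where
  poisson : ∀ k, IsPoissonPointProcess (bs k) (ENNReal.ofReal (p.lam k) • volume) P
  indep : ∀ k, IndepFun (fun ω i => bs k i ω) (fun ω i => bs (otherTier k) i ω) P

/-- The ratio `(t^{(m)} / t^{(k)})^{1/α}`. -/
noncomputable def tierRatio (p : Params) (m k : Fin 2) : ℝ := (p.t m / p.t k) ^ (1 / p.α)

lemma tierRatio_pos (p : Params) (m k : Fin 2) : 0 < tierRatio p m k :=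
  Real.rpow_pos_of_pos (div_pos (p.t_pos m) (p.t_pos k)) _

lemma tierRatio_self (p : Params) (k : Fin 2) : tierRatio p k k = 1 := by
  rw [tierRatio, div_self (p.t_pos k).ne', Real.one_rpow]

/-- Raising to the power α turns the comparison of weighted powers into one of distances. It serves
both the association event and the first indicator in the interference. -/
lemma weighted_power_lt_iff (p : Params) (m k : Fin 2) {r d : ℝ} (hr : 0 < r) (hd : 0 < d) :
    p.t m * (p.τ * d) ^ (-p.α) < p.t k * (p.τ * r) ^ (-p.α) ↔ tierRatio p m k * r < d := by
  have hα : 0 < p.α := by linarith [p.two_lt_α]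
  have hτ := p.τ_pos
  have hk := p.t_pos k
  have hm := p.t_pos m
  have hra : 0 < r ^ p.α := Real.rpow_pos_of_pos hr _
  have hda : 0 < d ^ p.α := Real.rpow_pos_of_pos hd _
  have hτa : 0 < p.τ ^ p.α := Real.rpow_pos_of_pos hτ _
  have h1 : tierRatio p m k * r < d ↔ p.t m / p.t k * r ^ p.α < d ^ p.α := by
    rw [← Real.rpow_lt_rpow_iff (mul_pos (tierRatio_pos p m k) hr).le hd.le hα,
      Real.mul_rpow (tierRatio_pos p m k).le hr.le, tierRatio,
      ← Real.rpow_mul (div_pos hm hk).le, one_div_mul_cancel hα.ne', Real.rpow_one]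
  rw [h1, Real.rpow_neg (mul_pos hτ hd).le, Real.rpow_neg (mul_pos hτ hr).le,
    Real.mul_rpow hτ.le hd.le, Real.mul_rpow hτ.le hr.le, ← div_eq_mul_inv, ← div_eq_mul_inv,
    div_lt_div_iff₀ (mul_pos hτa hda) (mul_pos hτa hra), div_mul_eq_mul_div, div_lt_iff₀ hk]
  rw [show p.t m * (p.τ ^ p.α * r ^ p.α) = p.τ ^ p.α * (p.t m * r ^ p.α) by ring,
    show p.t k * (p.τ ^ p.α * d ^ p.α) = p.τ ^ p.α * (d ^ p.α * p.t k) by ring,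
    mul_lt_mul_iff_right₀ hτa]

variable (hbs : IsTwoTierPoisson p P bs)

include hbs

lemma IsTwoTierPoisson.measurable_dist (k : Fin 2) (q : ℕ) : Measurable (nthNearestDist (bs k) 0 q) :=
  measurable_nthNearestDist (hbs.poisson k).measurable q

lemma IsTwoTierPoisson.measurable_dists (k : Fin 2) : Measurable fun ω =>
    ((nthNearestDist (bs k) 0 1 ω, nthNearestDist (bs k) 0 2 ω),
      nthNearestDist (bs (otherTier k)) 0 1 ω) :=
  ((hbs.measurable_dist k 1).prodMk (hbs.measurable_dist k 2)).prodMk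
    (hbs.measurable_dist (otherTier k) 1)

lemma IsTwoTierPoisson.measurableSet_assocEvent (k : Fin 2) :
    MeasurableSet (assocEvent p bs k) := by
  have h1 := hbs.measurable_dist k 1
  have h2 := hbs.measurable_dist (otherTier k) 1
  exact measurableSet_lt (by fun_prop) (by fun_prop)

lemma IsTwoTierPoisson.measurableSet_mostInterferedEvent (k n : Fin 2) :
    MeasurableSet (mostInterferedEvent bs k n) := by
  have h1 := hbs.measurable_dist k 2
  have h2 := hbs.measurable_dist (otherTier k) 1
  have h3 := hbs.measurable_dist n 1
  unfold mostInterferedEvent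
  split_ifs
  · exact measurableSet_lt h1 h2
  · exact measurableSet_lt h3 h1

lemma IsTwoTierPoisson.measurable_typicalDistances (k : Fin 2) :
    Measurable (typicalDistances bs k) :=
  (hbs.measurable_dist k 1).prodMk
    ((hbs.measurable_dist k 2).min (hbs.measurable_dist (otherTier k) 1))

variable [IsProbabilityMeasure P]

theorem IsTwoTierPoisson.map_dists (k : Fin 2) :
    P.map (fun ω => ((nthNearestDist (bs k) 0 1 ω, nthNearestDist (bs k) 0 2 ω),
      nthNearestDist (bs (otherTier k)) 0 1 ω)) =
      (nearestTwoLaw (p.lam k)).prod (nearestLaw (p.lam (otherTier k))) := by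
  -- The distances are viewed as measurable functionals of the whole point sequence, so that
  -- independence of the two sequences passes to them.
  have hc (q : ℕ) : Measurable (nthNearestDist (fun i (b : ℕ → Plane) => b i) 0 q) :=
    measurable_nthNearestDist (fun i => measurable_pi_apply i) q
  have hind := (hbs.indep k).comp ((hc 1).prodMk (hc 2)) (hc 1)
  have h := (indepFun_iff_map_prod_eq_prod_map_map (μ := P)
    ((hbs.measurable_dist k 1).prodMk (hbs.measurable_dist k 2)).aemeasurable
    (hbs.measurable_dist (otherTier k) 1).aemeasurable).1 hind
  rw [h, map_nearestDists (p.lam_pos k) (hbs.poisson k),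
    map_nearestDist (p.lam_pos (otherTier k)) (hbs.poisson (otherTier k))]

lemma IsTwoTierPoisson.ae_dists_pos (k : Fin 2) :
    ∀ᵐ ω ∂P, 0 < nthNearestDist (bs k) 0 1 ω ∧
      nthNearestDist (bs k) 0 1 ω < nthNearestDist (bs k) 0 2 ω := by
  have h : ∀ᵐ x ∂(nearestTwoLaw (p.lam k)), x ∈ {x : ℝ × ℝ | 0 < x.1 ∧ x.1 < x.2} := by
    rw [nearestTwoLaw, ae_withDensity_iff
      ((measurable_ofReal_nearestTwoPDF _).indicator measurableSet_pos_lt)]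
    refine ae_of_all _ fun x hx => ?_
    by_contra hne
    exact hx (indicator_of_notMem hne _)
  rw [← map_nearestDists (p.lam_pos k) (hbs.poisson k)] at h
  exact ae_of_ae_map ((hbs.measurable_dist k 1).prodMk (hbs.measurable_dist k 2)).aemeasurable h

lemma IsTwoTierPoisson.ae_mem_assocEvent_iff (k : Fin 2) :
    ∀ᵐ ω ∂P, ω ∈ assocEvent p bs k ↔ tierRatio p (otherTier k) k * nthNearestDist (bs k) 0 1 ω <
      nthNearestDist (bs (otherTier k)) 0 1 ω := by
  filter_upwards [hbs.ae_dists_pos k, hbs.ae_dists_pos (otherTier k)] with ω h1 h2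
  exact weighted_power_lt_iff p (otherTier k) k h1.1 h2.1

/-- The nearest distance of the other tier is independent of this tier and has no atoms. Without
ties, the two events `mostInterferedEvent` exhaust the sample space up to a null set. -/
lemma IsTwoTierPoisson.ae_dist_ne (k : Fin 2) :
    ∀ᵐ ω ∂P, nthNearestDist (bs k) 0 2 ω ≠ nthNearestDist (bs (otherTier k)) 0 1 ω := by
  have hm := hbs.measurable_dists k
  have hS : MeasurableSet {z : (ℝ × ℝ) × ℝ | z.1.2 = z.2} :=
    measurableSet_eq_fun (by fun_prop) (by fun_prop)
  have h := Measure.map_apply (μ := P) hm hS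
  rw [hbs.map_dists, Measure.prod_apply hS] at h
  have h0 (x : ℝ × ℝ) : nearestLaw (p.lam (otherTier k))
      (Prod.mk x ⁻¹' {z : (ℝ × ℝ) × ℝ | z.1.2 = z.2}) = 0 := by
    refine withDensity_absolutelyContinuous _ _ ?_
    have : Prod.mk x ⁻¹' {z : (ℝ × ℝ) × ℝ | z.1.2 = z.2} = {x.2} := by
      ext w
      exact eq_comm
    rw [this, Real.volume_singleton]
  simp only [h0, lintegral_zero] at h
  rw [ae_iff]
  simpa using h.symm

end Association

/-! ### The conditional joint density and the mixture over the most interfered tier. -/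

section JointDensity

variable {Ω : Type*} [MeasurableSpace Ω] {p : Params} {P : Measure Ω} {bs : Fin 2 → ℕ → Ω → Plane}

/-- The joint density of the two distances on `X^{(k,n)}`, before normalization. -/
noncomputable def subPDF (p : Params) (k n : Fin 2) (x : ℝ × ℝ) : ℝ :=
  {x : ℝ × ℝ | 0 < x.1 ∧ tierRatio p n k * x.1 < x.2}.indicator
    (fun x => if k = n then
      nearestCCDF (p.lam (otherTier k)) (max (tierRatio p (otherTier k) k * x.1) x.2) *
        nearestTwoPDF (p.lam k) x.1 x.2
    else nearestPDF (p.lam n) x.2 * zeta (p.lam k) x.1 x.2) x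

lemma jointPDF_eq (p : Params) (P : Measure Ω) (bs : Fin 2 → ℕ → Ω → Plane) (k n : Fin 2)
    (x : ℝ × ℝ) : jointPDF p P bs k n x.1 x.2 =
      subPDF p k n x / P.real (assocEvent p bs k ∩ mostInterferedEvent bs k n) := by
  unfold jointPDF subPDF tierRatio
  by_cases h : 0 < x.1 ∧ (p.t n / p.t k) ^ (1 / p.α) * x.1 < x.2
  · rw [if_pos h, indicator_of_mem (by exact h)]
  · rw [if_neg h, indicator_of_notMem (by exact h), zero_div]

lemma measurableSet_support_subPDF (c : ℝ) :
    MeasurableSet {x : ℝ × ℝ | 0 < x.1 ∧ c * x.1 < x.2} :=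
  (measurableSet_lt measurable_const measurable_fst).inter
    (measurableSet_lt (measurable_fst.const_mul c) measurable_snd)

lemma measurable_subPDF (p : Params) (k n : Fin 2) : Measurable (subPDF p k n) := by
  refine Measurable.indicator ?_ (measurableSet_support_subPDF _)
  split_ifs
  · unfold nearestCCDF nearestTwoPDF
    fun_prop
  · unfold nearestPDF zeta
    fun_prop

lemma zeta_pos {l v w : ℝ} (hl : 0 < l) (hv : 0 < v) : 0 < zeta l v w := by
  unfold zeta
  have := Real.pi_pos
  positivity

lemma nearestPDF_pos {l v : ℝ} (hl : 0 < l) (hv : 0 < v) : 0 < nearestPDF l v := by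
  unfold nearestPDF
  have := Real.pi_pos
  positivity

lemma nearestTwoPDF_pos {l v w : ℝ} (hl : 0 < l) (hv : 0 < v) (hw : 0 < w) :
    0 < nearestTwoPDF l v w := by
  unfold nearestTwoPDF
  have := Real.pi_pos
  positivity

lemma subPDF_pos (p : Params) (k n : Fin 2) {x : ℝ × ℝ} (h1 : 0 < x.1)
    (h2 : tierRatio p n k * x.1 < x.2) : 0 < subPDF p k n x := by
  have hx2 : 0 < x.2 := (mul_pos (tierRatio_pos p n k) h1).trans h2
  rw [subPDF, indicator_of_mem (by exact ⟨h1, h2⟩)]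
  split_ifs
  · exact mul_pos (Real.exp_pos _) (nearestTwoPDF_pos (p.lam_pos k) h1 hx2)
  · exact mul_pos (nearestPDF_pos (p.lam_pos n) hx2) (zeta_pos (p.lam_pos k) h1)

lemma subPDF_nonneg (p : Params) (k n : Fin 2) (x : ℝ × ℝ) : 0 ≤ subPDF p k n x := by
  by_cases h : 0 < x.1 ∧ tierRatio p n k * x.1 < x.2
  · exact (subPDF_pos p k n h.1 h.2).le
  · rw [subPDF, indicator_of_notMem (by exact h)]

variable (hbs : IsTwoTierPoisson p P bs) [IsProbabilityMeasure P]

include hbs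

/-- Up to a null set the event is a region in the space of the three distances. If n = k, then U is
the second distance in tier k and the other tier is integrated out. Otherwise U is the nearest
distance of the other tier and the second distance is integrated out. -/
theorem IsTwoTierPoisson.measure_inter_typicalDistances (k n : Fin 2) {B : Set (ℝ × ℝ)}
    (hB : MeasurableSet B) :
    P (assocEvent p bs k ∩ mostInterferedEvent bs k n ∩ typicalDistances bs k ⁻¹' B) =
      ∫⁻ x in B, ENNReal.ofReal (subPDF p k n x) := by
  have hm := hbs.measurable_dists k
  have hmap := hbs.map_dists k
  have hc := (tierRatio_pos p (otherTier k) k).le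
  have hcm : Measurable fun z : (ℝ × ℝ) × ℝ => tierRatio p (otherTier k) k * z.1.1 := by fun_prop
  have h12 : Measurable fun z : (ℝ × ℝ) × ℝ => z.1.2 := by fun_prop
  have h13 : Measurable fun z : (ℝ × ℝ) × ℝ => (z.1.1, z.2) := by fun_prop
  have hofReal (f : ℝ × ℝ → ℝ) (S : Set (ℝ × ℝ)) (x : ℝ × ℝ) :
      ENNReal.ofReal (S.indicator f x) = S.indicator (fun x => ENNReal.ofReal (f x)) x :=
    (congrFun (indicator_comp_of_zero ENNReal.ofReal_zero) x).symm
  by_cases hkn : k = n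
  · subst hkn
    have hS : MeasurableSet {z : (ℝ × ℝ) × ℝ | tierRatio p (otherTier k) k * z.1.1 < z.2 ∧
        z.1.2 < z.2 ∧ z.1 ∈ B} :=
      (measurableSet_lt hcm measurable_snd).inter
        ((measurableSet_lt h12 measurable_snd).inter (hB.preimage measurable_fst))
    have h := Measure.map_apply (μ := P) hm hS
    rw [hmap, prod_law_other_farther (p.lam_pos _) hc hB] at h
    have hset : (assocEvent p bs k ∩ mostInterferedEvent bs k k ∩ typicalDistances bs k ⁻¹' B :
        Set Ω) =ᵐ[P] (fun ω => ((nthNearestDist (bs k) 0 1 ω, nthNearestDist (bs k) 0 2 ω),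
          nthNearestDist (bs (otherTier k)) 0 1 ω)) ⁻¹'
        {z : (ℝ × ℝ) × ℝ | tierRatio p (otherTier k) k * z.1.1 < z.2 ∧ z.1.2 < z.2 ∧ z.1 ∈ B} := by
      filter_upwards [hbs.ae_mem_assocEvent_iff k] with ω hω
      refine propext ?_
      change (ω ∈ assocEvent p bs k ∧ ω ∈ mostInterferedEvent bs k k) ∧
        typicalDistances bs k ω ∈ B ↔ _ < _ ∧ _ < _ ∧ (_, _) ∈ B
      rw [hω, mostInterferedEvent, if_pos rfl, and_assoc]
      refine and_congr_right fun _ => and_congr_right fun h2 => ?_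
      rw [typicalDistances, min_eq_left (le_of_lt h2)]
    rw [measure_congr hset, ← h]
    simp only [subPDF, tierRatio_self, one_mul, hofReal, if_true]
    rw [setLIntegral_indicator measurableSet_pos_lt, inter_comm]
    refine lintegral_congr fun x => (ENNReal.ofReal_mul (Real.exp_nonneg _)).symm
  · obtain rfl := eq_otherTier_of_ne hkn
    have hS : MeasurableSet {z : (ℝ × ℝ) × ℝ | tierRatio p (otherTier k) k * z.1.1 < z.2 ∧
        z.2 < z.1.2 ∧ (z.1.1, z.2) ∈ B} :=
      (measurableSet_lt hcm measurable_snd).inter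
        ((measurableSet_lt measurable_snd h12).inter (hB.preimage h13))
    have h := Measure.map_apply (μ := P) hm hS
    rw [hmap, prod_law_other_nearer (p.lam_pos _) hc hB] at h
    have hset : (assocEvent p bs k ∩ mostInterferedEvent bs k (otherTier k) ∩
        typicalDistances bs k ⁻¹' B : Set Ω) =ᵐ[P]
        (fun ω => ((nthNearestDist (bs k) 0 1 ω, nthNearestDist (bs k) 0 2 ω),
          nthNearestDist (bs (otherTier k)) 0 1 ω)) ⁻¹'
        {z : (ℝ × ℝ) × ℝ | tierRatio p (otherTier k) k * z.1.1 < z.2 ∧ z.2 < z.1.2 ∧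
          (z.1.1, z.2) ∈ B} := by
      filter_upwards [hbs.ae_mem_assocEvent_iff k] with ω hω
      refine propext ?_
      change (ω ∈ assocEvent p bs k ∧ ω ∈ mostInterferedEvent bs k (otherTier k)) ∧
        typicalDistances bs k ω ∈ B ↔ _ < _ ∧ _ < _ ∧ (_, _) ∈ B
      rw [hω, mostInterferedEvent, if_neg hkn, and_assoc]
      refine and_congr_right fun _ => and_congr_right fun h2 => ?_
      rw [typicalDistances, min_eq_right (le_of_lt h2)]
    rw [measure_congr hset, ← h]
    simp only [subPDF, hofReal, if_neg hkn]
    rw [setLIntegral_indicator (measurableSet_support_subPDF _), inter_comm]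
    refine setLIntegral_congr_fun ((measurableSet_support_subPDF _).inter hB) fun x hx => ?_
    have h0 : 0 ≤ x.2 := ((mul_nonneg hc (le_of_lt hx.1.1)).trans_lt hx.1.2).le
    exact (ENNReal.ofReal_mul (nearestPDF_nonneg (p.lam_pos _) h0)).symm

/-- The unnormalized density is positive on a nonempty open cone. -/
lemma IsTwoTierPoisson.measure_assoc_inter_pos (k n : Fin 2) :
    0 < P (assocEvent p bs k ∩ mostInterferedEvent bs k n) := by
  have h := hbs.measure_inter_typicalDistances k n MeasurableSet.univ
  rw [preimage_univ, inter_univ, Measure.restrict_univ] at h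
  rw [h, lintegral_pos_iff_support (measurable_subPDF p k n).ennreal_ofReal]
  have hopen : IsOpen {x : ℝ × ℝ | 0 < x.1 ∧ tierRatio p n k * x.1 < x.2} :=
    (isOpen_lt continuous_const continuous_fst).inter
      (isOpen_lt (continuous_fst.const_mul _) continuous_snd)
  refine (hopen.measure_pos volume ⟨(1, tierRatio p n k * 1 + 1), ?_⟩).trans_le
    (measure_mono fun x hx => ?_)
  · exact ⟨one_pos, lt_add_one _⟩
  · exact (ENNReal.ofReal_pos.2 (subPDF_pos p k n hx.1 hx.2)).ne'

lemma IsTwoTierPoisson.ofReal_jointPDF (k n : Fin 2) (x : ℝ × ℝ) :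
    ENNReal.ofReal (jointPDF p P bs k n x.1 x.2) =
      (P (assocEvent p bs k ∩ mostInterferedEvent bs k n))⁻¹ * ENNReal.ofReal (subPDF p k n x) := by
  have hpos := ENNReal.toReal_pos (hbs.measure_assoc_inter_pos k n).ne' (measure_ne_top _ _)
  rw [jointPDF_eq, Measure.real, ENNReal.ofReal_div_of_pos hpos,
    ENNReal.ofReal_toReal (measure_ne_top _ _), ENNReal.div_eq_inv_mul]

lemma IsTwoTierPoisson.withDensity_jointPDF_apply (k n : Fin 2) {B : Set (ℝ × ℝ)}
    (hB : MeasurableSet B) :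
    volume.withDensity (fun x => ENNReal.ofReal (jointPDF p P bs k n x.1 x.2)) B =
      (P (assocEvent p bs k ∩ mostInterferedEvent bs k n))⁻¹ *
      P (assocEvent p bs k ∩ mostInterferedEvent bs k n ∩ typicalDistances bs k ⁻¹' B) := by
  rw [withDensity_apply _ hB, hbs.measure_inter_typicalDistances k n hB]
  simp only [hbs.ofReal_jointPDF]
  exact lintegral_const_mul _ (measurable_subPDF p k n).ennreal_ofReal

theorem IsTwoTierPoisson.hasLaw_typicalDistances (k n : Fin 2) :
    HasLaw (typicalDistances bs k)
      ((volume : Measure (ℝ × ℝ)).withDensity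
        (fun x => ENNReal.ofReal (jointPDF p P bs k n x.1 x.2)))
      (ProbabilityTheory.cond P (assocEvent p bs k ∩ mostInterferedEvent bs k n)) where
  aemeasurable := (hbs.measurable_typicalDistances k).aemeasurable
  map_eq := by
    ext B hB
    rw [Measure.map_apply (hbs.measurable_typicalDistances k) hB, cond_apply
      ((hbs.measurableSet_assocEvent k).inter (hbs.measurableSet_mostInterferedEvent k n)),
      hbs.withDensity_jointPDF_apply k n hB]

lemma IsTwoTierPoisson.measure_assocEvent_pos (k : Fin 2) : 0 < P (assocEvent p bs k) :=
  (hbs.measure_assoc_inter_pos k k).trans_le (measure_mono inter_subset_left)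

/-- The law of total probability: the normalizing constant of each density cancels against its
weight. -/
theorem IsTwoTierPoisson.map_cond_assocEvent (k : Fin 2) :
    (ProbabilityTheory.cond P (assocEvent p bs k)).map (typicalDistances bs k) =
      ∑ n, (ProbabilityTheory.cond P (assocEvent p bs k)) (mostInterferedEvent bs k n) •
        volume.withDensity (fun x => ENNReal.ofReal (jointPDF p P bs k n x.1 x.2)) := by
  ext B hB
  have hA := hbs.measurableSet_assocEvent k
  have hT := (hbs.measurable_typicalDistances k) hB
  rw [Measure.map_apply (hbs.measurable_typicalDistances k) hB, cond_apply hA,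
    Measure.finsetSum_apply]
  have hterm (n : Fin 2) : ((ProbabilityTheory.cond P (assocEvent p bs k))
      (mostInterferedEvent bs k n) •
        volume.withDensity (fun x => ENNReal.ofReal (jointPDF p P bs k n x.1 x.2))) B =
      (P (assocEvent p bs k))⁻¹ *
        P (assocEvent p bs k ∩ mostInterferedEvent bs k n ∩ typicalDistances bs k ⁻¹' B) := by
    rw [Measure.smul_apply, hbs.withDensity_jointPDF_apply k n hB, cond_apply hA, smul_eq_mul,
      mul_assoc, ← mul_assoc (P _) (P _)⁻¹, ENNReal.mul_inv_cancel
        (hbs.measure_assoc_inter_pos k n).ne' (measure_ne_top _ _), one_mul]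
  simp only [hterm]
  rw [← Finset.mul_sum, sum_tiers k, ← measure_union]
  · congr 1
    refine measure_congr ?_
    filter_upwards [hbs.ae_dist_ne k] with ω hω
    refine propext ?_
    change ω ∈ assocEvent p bs k ∧ typicalDistances bs k ω ∈ B ↔
      ((ω ∈ assocEvent p bs k ∧ ω ∈ mostInterferedEvent bs k k) ∧ typicalDistances bs k ω ∈ B) ∨
      ((ω ∈ assocEvent p bs k ∧ ω ∈ mostInterferedEvent bs k (otherTier k)) ∧
        typicalDistances bs k ω ∈ B)
    rw [mostInterferedEvent, mostInterferedEvent, if_pos rfl, if_neg (otherTier_ne k).symm]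
    have : ω ∈ {ω | nthNearestDist (bs k) 0 2 ω < nthNearestDist (bs (otherTier k)) 0 1 ω} ∨
        ω ∈ {ω | nthNearestDist (bs k) 0 2 ω > nthNearestDist (bs (otherTier k)) 0 1 ω} :=
      lt_or_gt_of_ne hω
    exact ⟨fun h => this.imp (fun h' => ⟨⟨h.1, h'⟩, h.2⟩) (fun h' => ⟨⟨h.1, h'⟩, h.2⟩),
      fun h => h.elim (fun h => ⟨h.1.1, h.2⟩) (fun h => ⟨h.1.1, h.2⟩)⟩
  · refine disjoint_left.2 fun ω h1 h2 => ?_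
    have h1' := h1.1.2
    have h2' := h2.1.2
    rw [mostInterferedEvent, if_pos rfl] at h1'
    rw [mostInterferedEvent, if_neg (otherTier_ne k).symm] at h2'
    exact lt_asymm (a := nthNearestDist (bs k) 0 2 ω) h1' h2'
  · exact (hA.inter (hbs.measurableSet_mostInterferedEvent k _)).inter hT

end JointDensity

/-! ### Independence of the sources of randomness -/

section Independence

variable {Ω : Type*} [mΩ : MeasurableSpace Ω] {P : Measure Ω}

/-- Grouping independent sources into disjoint blocks keeps mutual independence. The induction
separates one block at a time from the union of the others. -/
lemma iIndep_iSup_of_pairwise_disjoint {ι κ : Type*} {m : ι → MeasurableSpace Ω}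
    (hle : ∀ i, m i ≤ mΩ) (hm : iIndep m P) {S : κ → Set ι}
    (hS : Pairwise fun a b => Disjoint (S a) (S b)) :
    iIndep (fun a => ⨆ i ∈ S a, m i) P := by
  classical
  have := hm.isProbabilityMeasure
  rw [iIndep_iff]
  intro s f hf
  induction s using Finset.induction_on with
  | empty => simp
  | insert a s ha ih =>
    have hmeas : MeasurableSet[⨆ i ∈ ⋃ b ∈ s, S b, m i] (⋂ b ∈ s, f b) := by
      refine MeasurableSet.biInter (m := ⨆ i ∈ ⋃ b ∈ s, S b, m i) s.countable_toSet fun b hb => ?_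
      have hsub : S b ⊆ ⋃ b ∈ s, S b := subset_biUnion_of_mem (u := S) hb
      have hle : (⨆ i ∈ S b, m i) ≤ ⨆ i ∈ ⋃ b ∈ s, S b, m i := biSup_mono fun i hi => hsub hi
      exact hle _ (hf b (Finset.mem_insert_of_mem hb))
    have hdisj : Disjoint (S a) (⋃ b ∈ s, S b) := by
      simp only [disjoint_iUnion_right]
      exact fun b hb => hS fun hab => ha (hab ▸ hb)
    have h := (indep_iSup_of_disjoint hle hm hdisj)
    rw [Indep_iff] at h
    rw [Finset.set_biInter_insert, Finset.prod_insert ha,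
      h _ _ (hf a (Finset.mem_insert_self a s)) hmeas,
      ih fun b hb => hf b (Finset.mem_insert_of_mem hb)]

/-- Fubini's theorem for independent variables: the first may be frozen while the second is averaged
over a fresh copy. -/
lemma IndepFun.lintegral_comp_eq {β γ : Type*} [MeasurableSpace β] [MeasurableSpace γ]
    [IsProbabilityMeasure P] {f : Ω → β} {g : Ω → γ} (hf : Measurable f) (hg : Measurable g)
    (h : IndepFun f g P) {F : β × γ → ℝ≥0∞} (hF : Measurable F) :
    ∫⁻ ω, F (f ω, g ω) ∂P = ∫⁻ ω, ∫⁻ ω', F (f ω, g ω') ∂P ∂P := by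
  have hmap := (indepFun_iff_map_prod_eq_prod_map_map hf.aemeasurable hg.aemeasurable).1 h
  have := Measure.isProbabilityMeasure_map (μ := P) hg.aemeasurable
  rw [← lintegral_map hF (hf.prodMk hg), hmap, lintegral_prod _ hF.aemeasurable,
    lintegral_map hF.lintegral_prod_right' hf]
  exact lintegral_congr fun ω => lintegral_map (hF.comp measurable_prodMk_left) hg

variable {p : Params} {bs mt : Fin 2 → ℕ → Ω → Plane} {ru : Fin 2 → ℕ → Ω → ℝ × ℝ}
  {h : Fin 2 → ℕ → Ω → ℝ} (hmodel : IsUplinkModel p P bs mt ru h)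

include hmodel

lemma IsUplinkModel.sourceSigma_le (i) : sourceSigma bs mt ru h i ≤ mΩ := by
  rcases i with k | k | ⟨k, i⟩ | ⟨k, i⟩
  · exact (measurable_pi_lambda _ (hmodel.bs_poisson k).measurable).comap_le
  · exact (measurable_pi_lambda _ (hmodel.mt_poisson k).measurable).comap_le
  · exact (hmodel.ru_measurable k i).comap_le
  · exact (hmodel.h_measurable k i).comap_le

lemma IsUplinkModel.indepFun_of_disjoint {β γ : Type*} [MeasurableSpace β] [MeasurableSpace γ]
    {f : Ω → β} {g : Ω → γ} {S T : Set (Fin 2 ⊕ Fin 2 ⊕ (Fin 2 × ℕ) ⊕ (Fin 2 × ℕ))}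
    (hST : Disjoint S T) (hf : Measurable[⨆ i ∈ S, sourceSigma bs mt ru h i] f)
    (hg : Measurable[⨆ i ∈ T, sourceSigma bs mt ru h i] g) : IndepFun f g P := by
  rw [IndepFun_iff_Indep]
  exact indep_of_indep_of_le (indep_iSup_of_disjoint hmodel.sourceSigma_le hmodel.indep hST)
    hf.comap_le hg.comap_le

end Independence

/-! ### Measurability of the model's variables with respect to blocks of sources. -/

section Sources

variable {Ω : Type*} {bs mt : Fin 2 → ℕ → Ω → Plane} {ru : Fin 2 → ℕ → Ω → ℝ × ℝ}
  {h : Fin 2 → ℕ → Ω → ℝ} {S : Set (Fin 2 ⊕ Fin 2 ⊕ (Fin 2 × ℕ) ⊕ (Fin 2 × ℕ))}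

lemma measurable_source_bs {k : Fin 2} (hk : .inl k ∈ S) :
    Measurable[⨆ i ∈ S, sourceSigma bs mt ru h i] fun ω i => bs k i ω :=
  Measurable.mono (comap_measurable _)
    (le_iSup₂_of_le (f := fun i (_ : i ∈ S) => sourceSigma bs mt ru h i) _ hk le_rfl) le_rfl

lemma measurable_source_mt {k : Fin 2} (hk : .inr (.inl k) ∈ S) :
    Measurable[⨆ i ∈ S, sourceSigma bs mt ru h i] fun ω i => mt k i ω :=
  Measurable.mono (comap_measurable _)
    (le_iSup₂_of_le (f := fun i (_ : i ∈ S) => sourceSigma bs mt ru h i) _ hk le_rfl) le_rfl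

lemma measurable_source_mark {k : Fin 2} {i : ℕ} (h1 : .inr (.inr (.inl (k, i))) ∈ S)
    (h2 : .inr (.inr (.inr (k, i))) ∈ S) :
    Measurable[⨆ i ∈ S, sourceSigma bs mt ru h i] fun ω => (ru k i ω, h k i ω) :=
  Measurable.prodMk (m := ⨆ i ∈ S, sourceSigma bs mt ru h i)
    (Measurable.mono (comap_measurable _)
      (le_iSup₂_of_le (f := fun i (_ : i ∈ S) => sourceSigma bs mt ru h i) _ h1 le_rfl) le_rfl)
    (Measurable.mono (comap_measurable _)
      (le_iSup₂_of_le (f := fun i (_ : i ∈ S) => sourceSigma bs mt ru h i) _ h2 le_rfl) le_rfl)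

/-- The locations and marks of the interfering terminals of tier `k`. -/
def terminals (mt : Fin 2 → ℕ → Ω → Plane) (ru : Fin 2 → ℕ → Ω → ℝ × ℝ)
    (h : Fin 2 → ℕ → Ω → ℝ) (k : Fin 2) (ω : Ω) : (ℕ → Plane) × (ℕ → (ℝ × ℝ) × ℝ) :=
  (fun i => mt k i ω, fun i => (ru k i ω, h k i ω))

lemma measurable_source_terminals {k : Fin 2}
    (h1 : .inr (.inl k) ∈ S) (h2 : ∀ i, .inr (.inr (.inl (k, i))) ∈ S)
    (h3 : ∀ i, .inr (.inr (.inr (k, i))) ∈ S) :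
    Measurable[⨆ i ∈ S, sourceSigma bs mt ru h i] (terminals mt ru h k) :=
  Measurable.prodMk (m := ⨆ i ∈ S, sourceSigma bs mt ru h i) (measurable_source_mt h1)
    (@measurable_pi_lambda _ _ _ (_) _ _ fun i => measurable_source_mark (h2 i) (h3 i))

end Sources

/-! ### Independence of tiers, of terminals and of base stations. -/

section ModelIndependence

variable {Ω : Type*} [mΩ : MeasurableSpace Ω] {P : Measure Ω}
  {p : Params} {bs mt : Fin 2 → ℕ → Ω → Plane} {ru : Fin 2 → ℕ → Ω → ℝ × ℝ}
  {h : Fin 2 → ℕ → Ω → ℝ} (hmodel : IsUplinkModel p P bs mt ru h)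

include hmodel

lemma IsUplinkModel.isTwoTierPoisson : IsTwoTierPoisson p P bs where
  poisson := hmodel.bs_poisson
  indep k := hmodel.indepFun_of_disjoint (S := {.inl k}) (T := {.inl (otherTier k)})
    (by simpa using (otherTier_ne k).symm) (measurable_source_bs rfl) (measurable_source_bs rfl)

lemma IsUplinkModel.measurable_terminals (k : Fin 2) : Measurable (terminals mt ru h k) :=
  (measurable_pi_lambda _ (hmodel.mt_poisson k).measurable).prodMk
    (measurable_pi_lambda _ fun i => (hmodel.ru_measurable k i).prodMk (hmodel.h_measurable k i))

lemma IsUplinkModel.indepFun_mt_marks (k : Fin 2) :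
    IndepFun (fun ω i => mt k i ω) (fun ω i => (ru k i ω, h k i ω)) P := by
  refine hmodel.indepFun_of_disjoint (S := {.inr (.inl k)})
    (T := range fun i => .inr (.inr i)) (by simp) (measurable_source_mt rfl) ?_
  exact @measurable_pi_lambda _ _ _ (_) _ _ fun i =>
    measurable_source_mark (mem_range_self _) (mem_range_self _)

lemma IsUplinkModel.iIndepFun_marks (k : Fin 2) :
    iIndepFun (fun i ω => (ru k i ω, h k i ω)) P := by
  rw [iIndepFun_iff_iIndep]
  refine iIndep_of_iIndep_of_le (iIndep_iSup_of_pairwise_disjoint hmodel.sourceSigma_le hmodel.indep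
    (S := fun i => {.inr (.inr (.inl (k, i))), .inr (.inr (.inr (k, i)))}) fun i i' hi => ?_)
    fun i => ?_
  · simp [hi.symm]
  · exact (measurable_source_mark (by simp) (by simp)).comap_le

lemma IsUplinkModel.indepFun_ru_h (k : Fin 2) (i : ℕ) : IndepFun (ru k i) (h k i) P := by
  have h1 := hmodel.indep.indep (i := .inr (.inr (.inl (k, i)))) (j := .inr (.inr (.inr (k, i))))
    (by simp)
  rwa [IndepFun_iff_Indep]

lemma IsUplinkModel.indepFun_terminals {k k' : Fin 2} (hk : k ≠ k') :
    IndepFun (terminals mt ru h k) (terminals mt ru h k') P := by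
  refine hmodel.indepFun_of_disjoint
    (S := {.inr (.inl k)} ∪ (range fun i => .inr (.inr (.inl (k, i)))) ∪
      range fun i => .inr (.inr (.inr (k, i))))
    (T := {.inr (.inl k')} ∪ (range fun i => .inr (.inr (.inl (k', i)))) ∪
      range fun i => .inr (.inr (.inr (k', i)))) ?_ ?_ ?_
  · rw [disjoint_left]
    rintro _ ((rfl | ⟨i, rfl⟩) | ⟨i, rfl⟩) <;> simp [hk, hk.symm]
  · exact measurable_source_terminals (by simp) (by simp) (by simp)
  · exact measurable_source_terminals (by simp) (by simp) (by simp)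

lemma IsUplinkModel.indepFun_bs_terminals :
    IndepFun (fun ω k i => bs k i ω) (fun ω k => terminals mt ru h k ω) P := by
  refine hmodel.indepFun_of_disjoint (S := range .inl) (T := range .inr)
    (by rw [disjoint_left]; rintro _ ⟨i, rfl⟩; simp) ?_ ?_
  · exact @measurable_pi_lambda _ _ _ (_) _ _ fun k => measurable_source_bs (mem_range_self k)
  · exact @measurable_pi_lambda _ _ _ (_) _ _ fun k =>
      measurable_source_terminals (by simp) (by simp) (by simp)

end ModelIndependence

/-! ### The interference as a functional of a marked point process -/

section Interference

/-- The interference caused by a terminal of tier `k`, with the mark `e`, at distance `d` from the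
probe base station of tier `j`. -/
@[irreducible]
noncomputable def interferenceTerm (p : Params) (j k : Fin 2) (d : ℝ) (e : (ℝ × ℝ) × ℝ) : ℝ≥0∞ :=
  ENNReal.ofReal (e.2 * (p.τ * d) ^ (-p.α) * pMT p e.1.1 e.1.2 *
    {x : ℝ × (ℝ × ℝ) × ℝ | p.t k * (p.τ * x.2.1.1) ^ (-p.α) >
      p.t j * (p.τ * x.1) ^ (-p.α)}.indicator 1 (d, e) *
    {x : ℝ × (ℝ × ℝ) × ℝ | pMT p x.2.1.1 x.2.1.2 * (p.τ * x.1) ^ (-p.α) < p.i0}.indicator 1 (d, e))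

/-- The value `∫ (1 - E exp (-s I₀(z))) dz`, where `I₀(z)` is the interference caused by a terminal
with the distances `x` whose position is `z` relative to the probe base station. -/
noncomputable def meanLoss (p : Params) (j k : Fin 2) (s : ℝ≥0∞) (x : ℝ × ℝ) : ℝ≥0∞ :=
  ∫⁻ z : Plane, ∫⁻ g, (1 - expNeg (s * interferenceTerm p j k ‖z‖ (x, g))) ∂(expMeasure 1)

lemma measurable_pMT (p : Params) : Measurable fun x : ℝ × ℝ => pMT p x.1 x.2 := by
  unfold pMT
  fun_prop

lemma measurable_interferenceTerm (p : Params) (j k : Fin 2) :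
    Measurable fun x : ℝ × (ℝ × ℝ) × ℝ => interferenceTerm p j k x.1 x.2 := by
  have h1 : Measurable fun x : ℝ × (ℝ × ℝ) × ℝ => pMT p x.2.1.1 x.2.1.2 :=
    (measurable_pMT p).comp (measurable_fst.comp measurable_snd)
  unfold interferenceTerm
  refine Measurable.ennreal_ofReal (Measurable.mul (Measurable.mul ?_ ?_) ?_)
  · fun_prop
  · exact measurable_one.indicator (measurableSet_lt (by fun_prop) (by fun_prop))
  · exact measurable_one.indicator (measurableSet_lt (by fun_prop) (by fun_prop))

lemma measurable_one_sub_expNeg_interferenceTerm (p : Params) (j k : Fin 2) (s : ℝ≥0∞) :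
    Measurable fun x : Plane × (ℝ × ℝ) × ℝ =>
      1 - expNeg (s * interferenceTerm p j k ‖x.1‖ x.2) := by
  have h1 : Measurable fun x : Plane × (ℝ × ℝ) × ℝ => (‖x.1‖, x.2) := by fun_prop
  exact measurable_const.sub
    (measurable_expNeg.comp (((measurable_interferenceTerm p j k).comp h1).const_mul s))

lemma measurable_uncurry_lintegral_of_measurable {A B C : Type*} [MeasurableSpace A]
    [MeasurableSpace B] [MeasurableSpace C] {ν : Measure C} [SFinite ν] {F : A × B × C → ℝ≥0∞}
    (hF : Measurable F) : Measurable (Function.uncurry fun a b => ∫⁻ c, F (a, b, c) ∂ν) := by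
  have h1 : Measurable fun x : (A × B) × C => F (x.1.1, x.1.2, x.2) := hF.comp (by fun_prop)
  exact h1.lintegral_prod_right'

/-- The interference caused by the terminals of tier `k`, with positions and marks `w`, at a probe
base station `y` of tier `j`. -/
noncomputable def tierInterference (p : Params) (j k : Fin 2)
    (w : (ℕ → Plane) × (ℕ → (ℝ × ℝ) × ℝ)) (y : Plane) : ℝ≥0∞ :=
  ∑' i, interferenceTerm p j k (dist (w.1 i) y) (w.2 i)

lemma measurable_tierInterference {β : Type*} [MeasurableSpace β] (p : Params) (j k : Fin 2)
    {w : β → (ℕ → Plane) × (ℕ → (ℝ × ℝ) × ℝ)} {y : β → Plane} (hw : Measurable w)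
    (hy : Measurable y) : Measurable fun b => tierInterference p j k (w b) (y b) := by
  refine Measurable.tsum fun i => ?_
  have h1 : Measurable fun b => (dist ((w b).1 i) (y b), (w b).2 i) :=
    (((measurable_pi_apply i).comp (measurable_fst.comp hw)).dist hy).prodMk
      ((measurable_pi_apply i).comp (measurable_snd.comp hw))
  exact (measurable_interferenceTerm p j k).comp h1

lemma interference_eq {Ω : Type*} (p : Params) (bs mt : Fin 2 → ℕ → Ω → Plane)
    (ru : Fin 2 → ℕ → Ω → ℝ × ℝ) (h : Fin 2 → ℕ → Ω → ℝ) (j : Fin 2) (ω : Ω) :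
    interference p bs mt ru h j ω = ∑ k, tierInterference p j k (terminals mt ru h k ω) (nearestPoint (bs j) ω) := by
  unfold tierInterference interferenceTerm
  rfl

lemma measurable_nearestPoint_eval :
    Measurable (nearestPoint fun i (b : ℕ → Plane) => b i) := by
  classical
  have hq (i : ℕ) : MeasurableSet {b : ℕ → Plane | ∀ i', ‖b i‖ ≤ ‖b i'‖} := by
    simp only [ofPred_forall]
    exact MeasurableSet.iInter fun i' => measurableSet_le (by fun_prop) (by fun_prop)
  have hE : MeasurableSet {b : ℕ → Plane | ∃ i, ∀ i', ‖b i‖ ≤ ‖b i'‖} := by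
    simp only [ofPred_exists]
    exact MeasurableSet.iUnion hq
  -- The added alternative makes the search for an index always succeed. When no minimizer exists,
  -- the indicator of `hE` afterwards restores the default value 0.
  have hex (b : ℕ → Plane) : ∃ i, (∀ i', ‖b i‖ ≤ ‖b i'‖) ∨ ¬ ∃ i, ∀ i', ‖b i‖ ≤ ‖b i'‖ := by
    by_cases hb : ∃ i, ∀ i', ‖b i‖ ≤ ‖b i'‖
    · exact hb.imp fun i hi => Or.inl hi
    · exact ⟨0, Or.inr hb⟩
  have hfind : Measurable fun b : ℕ → Plane => b (Nat.find (hex b)) :=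
    Measurable.find (f := fun i (b : ℕ → Plane) => b i)
      (p := fun i b => (∀ i', ‖b i‖ ≤ ‖b i'‖) ∨ ¬ ∃ i, ∀ i', ‖b i‖ ≤ ‖b i'‖)
      (fun i => measurable_pi_apply i)
      (fun i => (hq i).union hE.compl) hex
  convert! hfind.indicator hE using 1
  ext1 b
  symm
  by_cases hb : ∃ i, ∀ i', ‖b i‖ ≤ ‖b i'‖
  · rw [indicator_of_mem (by exact hb), nearestPoint, dif_pos hb]
    congr 1
    refine (Nat.find_congr' fun {i} => ?_)
    exact or_iff_left (not_not.2 hb)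
  · rw [indicator_of_notMem (by exact hb), nearestPoint, dif_neg hb]

variable {Ω : Type*} [MeasurableSpace Ω] {P : Measure Ω} [IsProbabilityMeasure P]
  {p : Params} {bs mt : Fin 2 → ℕ → Ω → Plane} {ru : Fin 2 → ℕ → Ω → ℝ × ℝ}
  {h : Fin 2 → ℕ → Ω → ℝ} (hmodel : IsUplinkModel p P bs mt ru h)

/-- The law of the distances of a terminal of tier `k` to its serving and most interfered base
stations. -/
noncomputable def distancesLaw (p : Params) (P : Measure Ω) (bs : Fin 2 → ℕ → Ω → Plane)
    (k : Fin 2) : Measure (ℝ × ℝ) :=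
  (ProbabilityTheory.cond P (assocEvent p bs k)).map (typicalDistances bs k)

instance : SFinite (distancesLaw p P bs k) := by
  unfold distancesLaw
  infer_instance

include hmodel

lemma IsUplinkModel.map_mark (k : Fin 2) (i : ℕ) :
    P.map (fun ω => (ru k i ω, h k i ω)) = (distancesLaw p P bs k).prod (expMeasure 1) := by
  rw [(indepFun_iff_map_prod_eq_prod_map_map (hmodel.ru_measurable k i).aemeasurable
    (hmodel.h_measurable k i).aemeasurable).1 (hmodel.indepFun_ru_h k i),
    (hmodel.ru_law k i).map_eq, (hmodel.h_law k i).map_eq]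
  rfl

/-- The right side is free of y: Lebesgue measure is translation invariant and a contribution
depends on the position only through its distance to y. -/
lemma IsUplinkModel.laplace_tier (j k : Fin 2) (s : ℝ≥0∞) (y : Plane) :
    ∫⁻ ω, expNeg (s * tierInterference p j k (terminals mt ru h k ω) y) ∂P =
      expNeg (ENNReal.ofReal (p.lam k) * ∫⁻ x, meanLoss p j k s x ∂(distancesLaw p P bs k)) := by
  have : IsProbabilityMeasure (expMeasure 1) := isProbabilityMeasure_expMeasure one_pos
  have hlaw := hmodel.map_mark k 0
  have : IsProbabilityMeasure ((distancesLaw p P bs k).prod (expMeasure 1)) := by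
    rw [← hlaw]
    exact Measure.isProbabilityMeasure_map
      ((hmodel.ru_measurable k 0).prodMk (hmodel.h_measurable k 0)).aemeasurable
  have : SigmaFinite (ENNReal.ofReal (p.lam k) • (volume : Measure Plane)) :=
    SMul.sigmaFinite (p.lam k).toNNReal
  have hterm := measurable_interferenceTerm p j k
  have hf : Measurable fun x : Plane × (ℝ × ℝ) × ℝ =>
      s * interferenceTerm p j k (dist x.1 y) x.2 := by
    have h1 : Measurable fun x : Plane × (ℝ × ℝ) × ℝ => (dist x.1 y, x.2) := by fun_prop
    exact (hterm.comp h1).const_mul s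
  have hmain := (hmodel.mt_poisson k).laplace_marked
    (fun i => (hmodel.ru_measurable k i).prodMk (hmodel.h_measurable k i))
    (hmodel.iIndepFun_marks k) (hmodel.map_mark k) (hmodel.indepFun_mt_marks k)
    (f := fun z e => s * interferenceTerm p j k (dist z y) e) hf
  simp only [tierInterference, ← ENNReal.tsum_mul_left]
  refine hmain.trans ?_
  rw [lintegral_smul_measure, smul_eq_mul]
  have hg := measurable_one_sub_expNeg_interferenceTerm p j k s
  congr 2
  calc ∫⁻ z : Plane, (1 - ∫⁻ e, expNeg (s * interferenceTerm p j k (dist z y) e)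
        ∂((distancesLaw p P bs k).prod (expMeasure 1)))
      = ∫⁻ z : Plane, (1 - ∫⁻ e, expNeg (s * interferenceTerm p j k ‖z‖ e)
        ∂((distancesLaw p P bs k).prod (expMeasure 1))) := by
        simp only [dist_eq_norm]
        exact lintegral_sub_right_eq_self (fun z : Plane => 1 - ∫⁻ e,
          expNeg (s * interferenceTerm p j k ‖z‖ e)
            ∂((distancesLaw p P bs k).prod (expMeasure 1))) y
    _ = ∫⁻ z : Plane, ∫⁻ e, (1 - expNeg (s * interferenceTerm p j k ‖z‖ e))
          ∂((distancesLaw p P bs k).prod (expMeasure 1)) := by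
        refine lintegral_congr fun z => ?_
        have hz : Measurable fun e => expNeg (s * interferenceTerm p j k ‖z‖ e) :=
          measurable_expNeg.comp ((hterm.comp measurable_prodMk_left).const_mul s)
        have hle := lintegral_mono (μ := (distancesLaw p P bs k).prod (expMeasure 1))
          fun e => expNeg_le_one (s * interferenceTerm p j k ‖z‖ e)
        rw [lintegral_one, measure_univ] at hle
        rw [lintegral_sub hz (ne_top_of_le_ne_top ENNReal.one_ne_top hle)
          (ae_of_all _ fun e => expNeg_le_one _), lintegral_one, measure_univ]
    _ = ∫⁻ z : Plane, ∫⁻ x, (∫⁻ g, (1 - expNeg (s * interferenceTerm p j k ‖z‖ (x, g)))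
          ∂(expMeasure 1)) ∂(distancesLaw p P bs k) := by
        refine lintegral_congr fun z => ?_
        rw [lintegral_prod]
        exact (hg.comp measurable_prodMk_left).aemeasurable
    _ = _ := by
        rw [lintegral_lintegral_swap]
        · rfl
        · exact (measurable_uncurry_lintegral_of_measurable hg).aemeasurable

lemma IsUplinkModel.laplace_interference_at (j : Fin 2) (s : ℝ≥0∞) (y : Plane) :
    ∫⁻ ω, expNeg (∑ k, s * tierInterference p j k (terminals mt ru h k ω) y) ∂P =
      expNeg (∑ k, ENNReal.ofReal (p.lam k) * ∫⁻ x, meanLoss p j k s x ∂(distancesLaw p P bs k)) := by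
  have hm (k : Fin 2) : Measurable fun w : (ℕ → Plane) × (ℕ → (ℝ × ℝ) × ℝ) =>
        expNeg (s * tierInterference p j k w y) :=
      measurable_expNeg.comp
        ((measurable_tierInterference p j k measurable_id measurable_const).const_mul s)
  simp only [Fin.sum_univ_two, expNeg_add]
  rw [← hmodel.laplace_tier j 0 s y, ← hmodel.laplace_tier j 1 s y]
  have hind := (hmodel.indepFun_terminals (by simp : (0 : Fin 2) ≠ 1)).comp (hm 0) (hm 1)
  have hm0 := (hm 0).comp (hmodel.measurable_terminals 0)
  have hm1 := (hm 1).comp (hmodel.measurable_terminals 1)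
  exact lintegral_mul_eq_lintegral_mul_lintegral_of_indepFun hm0 hm1 hind

/-- The Laplace transform of the interference on the event of association with tier `j`. -/
theorem IsUplinkModel.setLIntegral_expNeg_interference (j : Fin 2) (s : ℝ≥0∞) :
    ∫⁻ ω in assocEvent p bs j, expNeg (s * interference p bs mt ru h j ω) ∂P =
      P (assocEvent p bs j) * expNeg (∑ k, ENNReal.ofReal (p.lam k) * ∫⁻ x, meanLoss p j k s x ∂(distancesLaw p P bs k)) := by
  -- Association is expressed as a set of base station configurations, so that it stays frozen while
  -- the terminals are averaged.
  set A : Set (Fin 2 → ℕ → Plane) := assocEvent p (fun k i b => b k i) j with hA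
  have hAm : MeasurableSet A := by
    have hm (k : Fin 2) : Measurable
        (nthNearestDist (fun i (b : Fin 2 → ℕ → Plane) => b k i) 0 1) :=
      measurable_nthNearestDist (fun i => by fun_prop) 1
    have h1 := hm j
    have h2 := hm (otherTier j)
    exact measurableSet_lt (by fun_prop) (by fun_prop)
  have hbsm : Measurable fun ω k i => bs k i ω :=
    measurable_pi_lambda _ fun k => measurable_pi_lambda _ (hmodel.bs_poisson k).measurable
  have htm : Measurable fun ω k => terminals mt ru h k ω :=
    measurable_pi_lambda _ hmodel.measurable_terminals
  have hY : Measurable fun b : Fin 2 → ℕ → Plane =>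
      nearestPoint (fun i (b : ℕ → Plane) => b i) (b j) :=
    measurable_nearestPoint_eval.comp (measurable_pi_apply j)
  set F : (Fin 2 → ℕ → Plane) × (Fin 2 → (ℕ → Plane) × (ℕ → (ℝ × ℝ) × ℝ)) → ℝ≥0∞ := fun z =>
    A.indicator 1 z.1 * expNeg (∑ k, s * tierInterference p j k (z.2 k) (nearestPoint (fun i (b : ℕ → Plane) => b i) (z.1 j)))
    with hFdef
  have hF : Measurable F := by
    refine ((measurable_one.indicator hAm).comp measurable_fst).mul (measurable_expNeg.comp ?_)
    refine Finset.measurable_fun_sum _ fun k _ => Measurable.const_mul ?_ s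
    exact measurable_tierInterference p j k ((measurable_pi_apply k).comp measurable_snd)
      (hY.comp measurable_fst)
  have hAB := hmodel.isTwoTierPoisson.measurableSet_assocEvent j
  calc ∫⁻ ω in assocEvent p bs j, expNeg (s * interference p bs mt ru h j ω) ∂P
      = ∫⁻ ω, F ((fun k i => bs k i ω), fun k => terminals mt ru h k ω) ∂P := by
        rw [← lintegral_indicator hAB]
        refine lintegral_congr fun ω => ?_
        simp only [hFdef, interference_eq, Finset.mul_sum]
        by_cases hω : ω ∈ assocEvent p bs j
        · rw [indicator_of_mem hω, indicator_of_mem (by exact hω), Pi.one_apply, one_mul]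
          rfl
        · rw [indicator_of_notMem hω, indicator_of_notMem (by exact hω), zero_mul]
    _ = ∫⁻ ω, ∫⁻ ω', F ((fun k i => bs k i ω), fun k => terminals mt ru h k ω') ∂P ∂P :=
        IndepFun.lintegral_comp_eq hbsm htm hmodel.indepFun_bs_terminals hF
    _ = ∫⁻ ω, (assocEvent p bs j).indicator 1 ω * expNeg (∑ k, ENNReal.ofReal (p.lam k) *
          ∫⁻ x, meanLoss p j k s x ∂(distancesLaw p P bs k)) ∂P := by
        refine lintegral_congr fun ω => ?_
        have hne : A.indicator (1 : (Fin 2 → ℕ → Plane) → ℝ≥0∞) (fun k i => bs k i ω) ≠ ∞ := by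
          classical
          rw [indicator_apply]
          split_ifs <;> simp
        rw [← hmodel.laplace_interference_at j s (nearestPoint (fun i (b : ℕ → Plane) => b i) fun i => bs j i ω)]
        exact lintegral_const_mul' _ _ hne
    _ = _ := by
        rw [lintegral_mul_const _ (measurable_one.indicator hAB), lintegral_indicator_one hAB]

end Interference

/-! ### Evaluation of the exponent -/

section MeanLoss

/-- This is 1 minus the Laplace transform 1/(1+a) of a unit exponential. -/
lemma lintegral_one_sub_expNeg_expMeasure {a : ℝ} (ha : 0 ≤ a) :
    ∫⁻ g, (1 - expNeg (ENNReal.ofReal (g * a))) ∂(expMeasure 1) = ENNReal.ofReal (a / (1 + a)) := by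
  have hm : Measurable fun g : ℝ => 1 - expNeg (ENNReal.ofReal (g * a)) :=
    measurable_const.sub (measurable_expNeg.comp (by fun_prop))
  have hwd : expMeasure 1 = volume.withDensity (exponentialPDF 1) := rfl
  have hpdf : Measurable (exponentialPDF 1) := (measurable_exponentialPDFReal 1).ennreal_ofReal
  have h1 : IntegrableOn (fun g : ℝ => Real.exp (-1 * g)) (Ioi 0) :=
    integrableOn_exp_mul_Ioi (by norm_num) 0
  have h2 : IntegrableOn (fun g : ℝ => Real.exp (-(1 + a) * g)) (Ioi 0) :=
    integrableOn_exp_mul_Ioi (by linarith) 0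
  have hval : ∫ g in Ioi (0 : ℝ), (Real.exp (-1 * g) - Real.exp (-(1 + a) * g)) = a / (1 + a) := by
    rw [integral_sub h1 h2, integral_exp_mul_Ioi (by norm_num), integral_exp_mul_Ioi (by linarith)]
    have : 1 + a ≠ 0 := by linarith
    rw [mul_zero, mul_zero, Real.exp_zero, neg_div_neg_eq]
    field_simp
    ring
  have hint : IntegrableOn (fun g : ℝ => Real.exp (-1 * g) - Real.exp (-(1 + a) * g)) (Ioi 0) :=
    h1.sub h2
  rw [hwd, lintegral_withDensity_eq_lintegral_mul _ hpdf hm, ← hval,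
    ofReal_integral_eq_lintegral_ofReal hint]
  · rw [← lintegral_indicator measurableSet_Ioi]
    refine lintegral_congr_ae ?_
    filter_upwards [compl_mem_ae_iff.2 (measure_singleton (μ := volume) (0 : ℝ))] with g hg
    rcases lt_or_gt_of_ne (show g ≠ 0 from hg) with hg | hg
    · rw [indicator_of_notMem (by simpa using hg.le), Pi.mul_apply, exponentialPDF_of_neg hg,
        zero_mul]
    · have hga := mul_nonneg hg.le ha
      rw [indicator_of_mem (by exact hg), Pi.mul_apply, exponentialPDF_of_nonneg hg.le,
        expNeg_ofReal hga, ← ENNReal.ofReal_one, ← ENNReal.ofReal_sub _ (Real.exp_nonneg _),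
        ← ENNReal.ofReal_mul (by positivity)]
      congr 1
      rw [mul_sub, one_mul, mul_one, ← Real.exp_add]
      ring_nf
  · refine (ae_restrict_mem measurableSet_Ioi).mono fun g (hg : 0 < g) => ?_
    simp only [Pi.zero_apply, sub_nonneg]
    exact Real.exp_le_exp.2 (by nlinarith [mul_nonneg hg.le ha])

variable (p : Params) (j k : Fin 2)

lemma pMT_nonneg (r u : ℝ) : 0 ≤ pMT p r u := ENNReal.toReal_nonneg

lemma pMT_le {r u : ℝ} (hu : 0 < u) : pMT p r u ≤ p.i0 * (p.τ * u) ^ p.α := by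
  have h1 := p.τ_pos
  have h3 := p.i0_pos
  refine ENNReal.toReal_le_of_le_ofReal (by positivity) ((min_le_left _ _).trans ?_)
  exact ENNReal.ofReal_le_ofReal (min_le_right _ _)

lemma interference_lt_iff {P d : ℝ} (hP : 0 ≤ P) (hd : 0 < d) :
    P * (p.τ * d) ^ (-p.α) < p.i0 ↔ 1 / p.τ * (P / p.i0) ^ (1 / p.α) < d := by
  have h1 := p.τ_pos
  have h3 := p.i0_pos
  have hα : 0 < p.α := by linarith [p.two_lt_α]
  have hτd : 0 < p.τ * d := by positivity
  rw [Real.rpow_neg hτd.le, ← div_eq_mul_inv, div_lt_iff₀ (by positivity), ← div_lt_iff₀' h3,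
    one_div, one_div, inv_mul_lt_iff₀ h1, Real.rpow_inv_lt_iff_of_pos (by positivity) hτd.le hα]

lemma exclusionRadius_nonneg (r u : ℝ) : 0 ≤ exclusionRadius p j k r u := by
  have h1 := p.τ_pos
  have h3 := p.i0_pos
  have h4 := pMT_nonneg p r u
  exact le_max_of_le_right (by positivity)

lemma exclusionRadius_pos {r : ℝ} (hr : 0 < r) (u : ℝ) : 0 < exclusionRadius p j k r u :=
  lt_max_of_lt_left (mul_pos (tierRatio_pos p j k) hr)

/-- The cap i₀(τu)^α on the power bounds the second threshold by u: interference at the most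
interfered base station never exceeds i₀. -/
lemma exclusionRadius_le {r u : ℝ} (hu : 0 < u) :
    exclusionRadius p j k r u ≤ max (tierRatio p j k * r) u := by
  have h1 := p.τ_pos
  have h3 := p.i0_pos
  have hα : 0 < p.α := by linarith [p.two_lt_α]
  refine max_le_max le_rfl ?_
  have h4 := pMT_nonneg p r u
  rw [one_div, one_div, inv_mul_le_iff₀ h1, Real.rpow_inv_le_iff_of_pos (by positivity)
    (by positivity) hα, div_le_iff₀' h3]
  exact pMT_le p hu

/-- At the exclusion radius the mean received power is at most i₀, since that radius is no smaller
than the threshold for i₀. -/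
lemma pMT_mul_exclusionRadius_le {r : ℝ} (hr : 0 < r) (u : ℝ) :
    pMT p r u * p.τ ^ (-p.α) * exclusionRadius p j k r u ^ (-p.α) ≤ p.i0 := by
  have hM := exclusionRadius_pos p j k hr u
  have h1 := p.τ_pos
  have h3 := p.i0_pos
  have h4 := pMT_nonneg p r u
  have hα : 0 < p.α := by linarith [p.two_lt_α]
  have hτM : 0 < p.τ * exclusionRadius p j k r u := by positivity
  rw [mul_assoc, ← Real.mul_rpow h1.le hM.le, Real.rpow_neg hτM.le, ← div_eq_mul_inv,
    div_le_iff₀ (by positivity), ← div_le_iff₀' h3,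
    ← Real.rpow_inv_le_iff_of_pos (by positivity) hτM.le hα, ← inv_mul_le_iff₀ h1, ← one_div,
    ← one_div]
  exact le_max_right _ _

/-- `chi` through the integral representation; the `min` is inactive. -/
lemma chi_eq {s : ℝ} (hs : 0 ≤ s) (r u : ℝ) : chi p j k s r u =
    s * pMT p r u * p.τ ^ (-p.α) / (p.α - 2) * exclusionRadius p j k r u ^ (2 - p.α) *
      hypIntegral p.α
        (min (-(s * pMT p r u * p.τ ^ (-p.α) * exclusionRadius p j k r u ^ (-p.α))) 0) := by
  have h1 := p.τ_pos
  have h4 := pMT_nonneg p r u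
  have h5 := exclusionRadius_nonneg p j k r u
  have hle : -(s * pMT p r u * p.τ ^ (-p.α) * exclusionRadius p j k r u ^ (-p.α)) ≤ 0 :=
    neg_nonpos.2 (by positivity)
  rw [min_eq_left hle, chi, gaussHypergeometric_eq_hypIntegral p.two_lt_α (hle.trans_lt one_pos)]

lemma chi_nonneg {s : ℝ} (hs : 0 ≤ s) (r u : ℝ) : 0 ≤ chi p j k s r u := by
  have h1 := p.τ_pos
  have h2 : 0 < p.α - 2 := by linarith [p.two_lt_α]
  have h4 := pMT_nonneg p r u
  have h5 := exclusionRadius_nonneg p j k r u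
  have h6 := hypIntegral_nonneg p.two_lt_α (min_le_right
    (-(s * pMT p r u * p.τ ^ (-p.α) * exclusionRadius p j k r u ^ (-p.α))) 0)
  rw [chi_eq p j k hs]
  positivity

/-- The hypergeometric factor is at most 1. Splitting M^(2-α) = M²·M^(-α), the power received at M
is at most i₀, and M² is bounded by the two squares. The bound is free of the power and linear in s,
so it serves both integrability and finiteness. -/
lemma chi_le {s r u : ℝ} (hs : 0 ≤ s) (hr : 0 < r) (hu : 0 < u) :
    chi p j k s r u ≤ s * (p.i0 / (p.α - 2) * (tierRatio p j k ^ 2 * r ^ 2 + u ^ 2)) := by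
  have h1 := p.τ_pos
  have h2 : 0 < p.α - 2 := by linarith [p.two_lt_α]
  have h4 := pMT_nonneg p r u
  have h5 := exclusionRadius_pos p j k hr u
  have h7 := pMT_mul_exclusionRadius_le p j k hr u
  have h6 := hypIntegral_le_one p.two_lt_α (min_le_right
    (-(s * pMT p r u * p.τ ^ (-p.α) * exclusionRadius p j k r u ^ (-p.α))) 0)
  have h8 : exclusionRadius p j k r u ^ 2 ≤ tierRatio p j k ^ 2 * r ^ 2 + u ^ 2 := by
    refine (pow_le_pow_left₀ h5.le (exclusionRadius_le p j k hu) 2).trans ?_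
    rcases max_cases (tierRatio p j k * r) u with h | h <;> rw [h.1] <;> nlinarith [sq_nonneg r, sq_nonneg u, sq_nonneg (tierRatio p j k * r)]
  rw [chi_eq p j k hs]
  set M := exclusionRadius p j k r u
  have h9 : M ^ (2 - p.α) = M ^ 2 * M ^ (-p.α) := by
    rw [sub_eq_add_neg, Real.rpow_add h5, Real.rpow_two]
  calc _ ≤ s * pMT p r u * p.τ ^ (-p.α) / (p.α - 2) * M ^ (2 - p.α) * 1 := by gcongr
    _ = s * ((pMT p r u * p.τ ^ (-p.α) * M ^ (-p.α)) / (p.α - 2) * M ^ 2) := by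
      rw [h9]; ring
    _ ≤ _ := by
      have h3 := p.i0_pos
      gcongr

lemma measurable_exclusionRadius :
    Measurable fun x : ℝ × ℝ => exclusionRadius p j k x.1 x.2 := by
  have := measurable_pMT p
  unfold exclusionRadius
  fun_prop

lemma measurable_chi {s : ℝ} (hs : 0 ≤ s) : Measurable fun x : ℝ × ℝ => chi p j k s x.1 x.2 := by
  simp only [chi_eq p j k hs]
  have h1 := measurable_pMT p
  have h2 := measurable_exclusionRadius p j k
  -- Analyticity is known only on x < 1; truncating the argument at 0 gives a function continuous on
  -- the whole line.
  have h3 : Continuous fun x : ℝ => hypIntegral p.α (min x 0) :=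
    (analyticOnNhd_hypIntegral p.two_lt_α).continuousOn.comp_continuous (by fun_prop)
      fun x => (min_le_right x 0).trans_lt one_pos
  have h4 : Measurable fun x : ℝ × ℝ => hypIntegral p.α
      (min (-(s * pMT p x.1 x.2 * p.τ ^ (-p.α) * exclusionRadius p j k x.1 x.2 ^ (-p.α))) 0) :=
    h3.measurable.comp (by fun_prop)
  fun_prop

/-- Each indicator is a lower bound on d; together they say that d exceeds the maximum of the two
thresholds. -/
lemma mul_interferenceTerm {s r u d : ℝ} (hs : 0 ≤ s) (hr : 0 < r) (hd : 0 < d) (g : ℝ) :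
    ENNReal.ofReal s * interferenceTerm p j k d ((r, u), g) = ENNReal.ofReal
      (g * (Ioi (exclusionRadius p j k r u)).indicator
        (fun x => s * pMT p r u * p.τ ^ (-p.α) * x ^ (-p.α)) d) := by
  rw [interferenceTerm, ← ENNReal.ofReal_mul hs]
  congr 1
  have hO := weighted_power_lt_iff p j k hr hd
  have hZ := interference_lt_iff p (pMT_nonneg p r u) hd
  by_cases h : exclusionRadius p j k r u < d
  · have h' := max_lt_iff.1 h
    have hd' : d ∈ Ioi (exclusionRadius p j k r u) := h
    rw [indicator_of_mem (by exact hO.2 h'.1), indicator_of_mem (by exact hZ.2 h'.2),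
      indicator_of_mem hd', Real.mul_rpow p.τ_pos.le hd.le]
    simp only [Pi.one_apply]
    ring
  · have hd' : d ∉ Ioi (exclusionRadius p j k r u) := h
    rw [indicator_of_notMem hd', mul_zero]
    rw [exclusionRadius, max_lt_iff, not_and_or] at h
    rcases h with h | h
    · rw [indicator_of_notMem (by exact fun hh => h (hO.1 hh)), mul_zero, zero_mul, mul_zero]
    · refine mul_eq_zero_of_right _ (mul_eq_zero_of_right _ ?_)
      rw [indicator_of_notMem (by exact fun hh => h (hZ.1 hh))]

/-- Averaging over the fading turns the integrand into `fadingLoss` outside the exclusion disc, and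
its planar integral is known. The origin, where the distance thresholds are not available, is a null
set. -/
theorem meanLoss_eq {s r u : ℝ} (hs : 0 ≤ s) (hr : 0 < r) :
    meanLoss p j k (ENNReal.ofReal s) (r, u) = ENNReal.ofReal (2 * Real.pi * chi p j k s r u) := by
  have h1 := p.τ_pos
  have h4 := pMT_nonneg p r u
  set A := s * pMT p r u * p.τ ^ (-p.α) with hA
  have hA0 : 0 ≤ A := by positivity
  have hM := exclusionRadius_pos p j k hr u
  have hle : -(A * exclusionRadius p j k r u ^ (-p.α)) ≤ 0 :=
    neg_nonpos.2 (by positivity)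
  rw [chi, gaussHypergeometric_eq_hypIntegral p.two_lt_α (hle.trans_lt one_pos), ← hA,
    show A / (p.α - 2) * exclusionRadius p j k r u ^ (2 - p.α) =
      A * exclusionRadius p j k r u ^ (2 - p.α) / (p.α - 2) by ring,
    ← lintegral_fadingLoss p.two_lt_α hA0 hM, meanLoss]
  refine lintegral_congr_ae ?_
  filter_upwards [compl_mem_ae_iff.2 (measure_singleton (μ := volume) (0 : Plane))] with z hz
  have hz : 0 < ‖z‖ := norm_pos_iff.2 hz
  simp only [mul_interferenceTerm p j k hs hr hz]
  rw [lintegral_one_sub_expNeg_expMeasure]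
  · congr 1
    by_cases h : exclusionRadius p j k r u < ‖z‖
    · rw [indicator_of_mem (by exact h), indicator_of_mem (by exact h)]
      rfl
    · rw [indicator_of_notMem (by exact h), indicator_of_notMem (by exact h), zero_div]
  · exact indicator_nonneg (fun x hx => by
      have : 0 < x := hM.trans hx
      positivity) _

end MeanLoss

/-! ### The Laplace transform of the interference -/

/-! ### Second moments of the distances, and integrability and evaluation of the exponent. -/

section Moments

variable {Ω : Type*} [MeasurableSpace Ω] {P : Measure Ω} [IsProbabilityMeasure P]
  {p : Params} {bs : Fin 2 → ℕ → Ω → Plane}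

lemma lintegral_sq_nearestLaw_lt_top {l : ℝ} (hl : 0 < l) :
    ∫⁻ w, ENNReal.ofReal (w ^ 2) ∂(nearestLaw l) < ∞ := by
  have hm : Measurable fun w : ℝ => ENNReal.ofReal (nearestPDF l w) := measurable_ofReal_nearestPDF l
  have hb : 0 < Real.pi * l := by positivity
  have hint : Integrable fun w : ℝ => |w| ^ (3 : ℝ) * Real.exp (-(Real.pi * l) * w ^ 2) := by
    refine ((integrable_rpow_mul_exp_neg_mul_sq hb (s := 3) (by norm_num)).norm).congr
      (ae_of_all _ fun w => ?_)
    simp only [norm_mul, Real.norm_eq_abs, Real.abs_exp]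
    congr 1
    norm_cast
    exact abs_pow w 3
  have hint2 := (hint.const_mul (2 * Real.pi * l)).lintegral_lt_top
  rw [nearestLaw, lintegral_withDensity_eq_lintegral_mul _ (hm.indicator measurableSet_Ioi)
    (by fun_prop)]
  refine (lintegral_mono fun w => ?_).trans_lt hint2
  by_cases hw : w ∈ Ioi (0 : ℝ)
  · rw [Pi.mul_apply, indicator_of_mem hw, ← ENNReal.ofReal_mul' (sq_nonneg w)]
    refine ENNReal.ofReal_le_ofReal (le_of_eq ?_)
    have hw : 0 < w := hw
    rw [abs_of_pos hw, nearestPDF]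
    norm_cast
    ring_nf
  · rw [Pi.mul_apply, indicator_of_notMem hw, zero_mul]
    exact zero_le

variable (hbs : IsTwoTierPoisson p P bs)
include hbs

lemma IsTwoTierPoisson.lintegral_sq_dist_lt_top (k : Fin 2) :
    ∫⁻ ω, ENNReal.ofReal (nthNearestDist (bs k) 0 1 ω ^ 2) ∂P < ∞ := by
  have h := lintegral_sq_nearestLaw_lt_top (p.lam_pos k)
  rwa [← map_nearestDist (p.lam_pos k) (hbs.poisson k),
    lintegral_map (by fun_prop) (hbs.measurable_dist k 1)] at h

/-- U is at most the nearest distance of the other tier, so two Gaussian-type second moments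
suffice. Conditioning costs at most the factor 1/P(E). -/
lemma IsTwoTierPoisson.lintegral_cond_sq_lt_top (k : Fin 2) {E : Set Ω} (hE : P E ≠ 0) {a c : ℝ}
    (hc : 0 ≤ c) :
    ∫⁻ x, ENNReal.ofReal (c * (a ^ 2 * x.1 ^ 2 + x.2 ^ 2))
      ∂((ProbabilityTheory.cond P E).map (typicalDistances bs k)) < ∞ := by
  have h1 := hbs.lintegral_sq_dist_lt_top k
  have h2 := hbs.lintegral_sq_dist_lt_top (otherTier k)
  have hm1 := hbs.measurable_dist k 1
  have hm2 := hbs.measurable_dist (otherTier k) 1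
  rw [lintegral_map (by fun_prop) (hbs.measurable_typicalDistances k), ProbabilityTheory.cond,
    lintegral_smul_measure]
  refine ENNReal.mul_lt_top (ENNReal.inv_lt_top.2 (pos_iff_ne_zero.2 hE)) ?_
  have hle : ∀ᵐ ω ∂P, ENNReal.ofReal (c * (a ^ 2 * (typicalDistances bs k ω).1 ^ 2 +
      (typicalDistances bs k ω).2 ^ 2)) ≤
      ENNReal.ofReal (c * a ^ 2) * ENNReal.ofReal (nthNearestDist (bs k) 0 1 ω ^ 2) +
      ENNReal.ofReal c * ENNReal.ofReal (nthNearestDist (bs (otherTier k)) 0 1 ω ^ 2) := by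
    filter_upwards [hbs.ae_dists_pos k, hbs.ae_dists_pos (otherTier k)] with ω hk ho
    rw [← ENNReal.ofReal_mul (by positivity), ← ENNReal.ofReal_mul hc,
      ← ENNReal.ofReal_add (by positivity) (by positivity)]
    refine ENNReal.ofReal_le_ofReal ?_
    rw [mul_add, mul_assoc]
    refine add_le_add le_rfl (mul_le_mul_of_nonneg_left ?_ hc)
    exact pow_le_pow_left₀ (le_min (hk.1.trans hk.2).le ho.1.le) (min_le_right _ _) 2
  refine (setLIntegral_le_lintegral _ _).trans_lt ((lintegral_mono_ae hle).trans_lt ?_)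
  rw [lintegral_add_left (by fun_prop), lintegral_const_mul _ (by fun_prop),
    lintegral_const_mul _ (by fun_prop)]
  exact ENNReal.add_lt_top.2 ⟨ENNReal.mul_lt_top ENNReal.ofReal_lt_top h1,
    ENNReal.mul_lt_top ENNReal.ofReal_lt_top h2⟩

omit [IsProbabilityMeasure P] hbs in
lemma jointPDF_nonneg (k n : Fin 2) (x : ℝ × ℝ) : 0 ≤ jointPDF p P bs k n x.1 x.2 := by
  rw [jointPDF_eq]
  exact div_nonneg (subPDF_nonneg p k n x) measureReal_nonneg

omit [IsProbabilityMeasure P] hbs in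
lemma measurable_jointPDF (k n : Fin 2) : Measurable fun x : ℝ × ℝ => jointPDF p P bs k n x.1 x.2 := by
  simp only [jointPDF_eq]
  exact (measurable_subPDF p k n).div_const _

omit [IsProbabilityMeasure P] hbs in
lemma jointPDF_eq_zero (k n : Fin 2) {r u : ℝ} (h : ¬ (0 < r ∧ tierRatio p n k * r < u)) :
    jointPDF p P bs k n r u = 0 :=
  if_neg h

omit [IsProbabilityMeasure P] hbs in
lemma ae_withDensity_jointPDF_pos (k n : Fin 2) :
    ∀ᵐ x ∂((volume : Measure (ℝ × ℝ)).withDensity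
      (fun x => ENNReal.ofReal (jointPDF p P bs k n x.1 x.2))), 0 < x.1 ∧ 0 < x.2 := by
  rw [ae_withDensity_iff (measurable_jointPDF k n).ennreal_ofReal]
  refine ae_of_all _ fun x hx => ?_
  by_cases h : 0 < x.1 ∧ tierRatio p n k * x.1 < x.2
  · exact ⟨h.1, (mul_pos (tierRatio_pos p n k) h.1).trans h.2⟩
  · exact absurd (by rw [jointPDF_eq_zero k n h, ENNReal.ofReal_zero]) hx

omit [IsProbabilityMeasure P] hbs in
lemma lintegral_withDensity_chi (j k n : Fin 2) {s : ℝ} (hs : 0 ≤ s) :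
    ∫⁻ x, ENNReal.ofReal (chi p j k s x.1 x.2) ∂((volume : Measure (ℝ × ℝ)).withDensity
      (fun x => ENNReal.ofReal (jointPDF p P bs k n x.1 x.2))) =
    ∫⁻ x : ℝ × ℝ, ENNReal.ofReal (jointPDF p P bs k n x.1 x.2 * chi p j k s x.1 x.2) := by
  rw [lintegral_withDensity_eq_lintegral_mul _ (measurable_jointPDF k n).ennreal_ofReal
    (measurable_chi p j k hs).ennreal_ofReal]
  refine lintegral_congr fun x => ?_
  rw [Pi.mul_apply, ENNReal.ofReal_mul (jointPDF_nonneg k n x)]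

theorem IsTwoTierPoisson.integrable_jointPDF_mul_chi (j k n : Fin 2) {s : ℝ} (hs : 0 ≤ s) :
    Integrable fun x : ℝ × ℝ => jointPDF p P bs k n x.1 x.2 * chi p j k s x.1 x.2 := by
  have h2 : 0 < p.α - 2 := by linarith [p.two_lt_α]
  have h3 := p.i0_pos
  refine ⟨((measurable_jointPDF k n).mul (measurable_chi p j k hs)).aestronglyMeasurable, ?_⟩
  rw [hasFiniteIntegral_iff_ofReal (ae_of_all _ fun x =>
    mul_nonneg (jointPDF_nonneg k n x) (chi_nonneg p j k hs x.1 x.2)),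
    ← lintegral_withDensity_chi j k n hs]
  have hfin := hbs.lintegral_cond_sq_lt_top k (hbs.measure_assoc_inter_pos k n).ne'
    (a := tierRatio p j k) (c := s * (p.i0 / (p.α - 2))) (by positivity)
  rw [(hbs.hasLaw_typicalDistances k n).map_eq] at hfin
  refine (lintegral_mono_ae ?_).trans_lt hfin
  filter_upwards [ae_withDensity_jointPDF_pos k n] with x hx
  refine ENNReal.ofReal_le_ofReal ((chi_le p j k hs hx.1 hx.2).trans_eq (mul_assoc _ _ _).symm)

lemma IsTwoTierPoisson.distancesLaw_eq (k : Fin 2) : distancesLaw p P bs k =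
    ∑ n, (ProbabilityTheory.cond P (assocEvent p bs k)) (mostInterferedEvent bs k n) •
      volume.withDensity (fun x => ENNReal.ofReal (jointPDF p P bs k n x.1 x.2)) :=
  hbs.map_cond_assocEvent k

lemma IsTwoTierPoisson.ae_distancesLaw_pos (k : Fin 2) :
    ∀ᵐ x ∂(distancesLaw p P bs k), 0 < x.1 ∧ 0 < x.2 := by
  rw [hbs.distancesLaw_eq, Fin.sum_univ_two]
  exact ae_add_measure_iff.2 ⟨Measure.ae_smul_measure (ae_withDensity_jointPDF_pos k 0) _,
    Measure.ae_smul_measure (ae_withDensity_jointPDF_pos k 1) _⟩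

/-- The density vanishes outside the stated domain, so the restricted iterated integral is the full
one, and Fubini's theorem applies. -/
lemma IsTwoTierPoisson.integral_jointPDF_mul_chi (j k n : Fin 2) {s : ℝ} (hs : 0 ≤ s) :
    ∫ r in Ioi (0 : ℝ), ∫ u in Ioi ((p.t n / p.t k) ^ (1 / p.α) * r),
      jointPDF p P bs k n r u * chi p j k s r u =
    ∫ x : ℝ × ℝ, jointPDF p P bs k n x.1 x.2 * chi p j k s x.1 x.2 := by
  have hint := hbs.integrable_jointPDF_mul_chi j k n hs
  rw [Measure.volume_eq_prod] at hint ⊢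
  have hzero {r u : ℝ} (h : ¬ (0 < r ∧ tierRatio p n k * r < u)) :
      jointPDF p P bs k n r u * chi p j k s r u = 0 := by
    rw [jointPDF_eq_zero k n h, zero_mul]
  rw [integral_prod _ hint]
  have hinner (r : ℝ) : ∫ u in Ioi ((p.t n / p.t k) ^ (1 / p.α) * r),
      jointPDF p P bs k n r u * chi p j k s r u =
      ∫ u, jointPDF p P bs k n r u * chi p j k s r u :=
    setIntegral_eq_integral_of_forall_compl_eq_zero fun u hu => hzero fun h => hu h.2
  simp only [hinner]
  refine setIntegral_eq_integral_of_forall_compl_eq_zero fun r hr => ?_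
  simp only [hzero fun h => hr h.1, integral_zero]

lemma IsTwoTierPoisson.lintegral_meanLoss (j k : Fin 2) {s : ℝ} (hs : 0 ≤ s) :
    ∫⁻ x, meanLoss p j k (ENNReal.ofReal s) x ∂(distancesLaw p P bs k) =
      ENNReal.ofReal (∑ n, (ProbabilityTheory.cond P (assocEvent p bs k)).real
        (mostInterferedEvent bs k n) * (2 * Real.pi *
          ∫ x : ℝ × ℝ, jointPDF p P bs k n x.1 x.2 * chi p j k s x.1 x.2)) := by
  have hI (n : Fin 2) :
      0 ≤ ∫ x : ℝ × ℝ, jointPDF p P bs k n x.1 x.2 * chi p j k s x.1 x.2 :=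
    integral_nonneg fun x => mul_nonneg (jointPDF_nonneg k n x) (chi_nonneg p j k hs x.1 x.2)
  have hcong : ∀ᵐ x ∂(distancesLaw p P bs k), meanLoss p j k (ENNReal.ofReal s) x =
      ENNReal.ofReal (2 * Real.pi) * ENNReal.ofReal (chi p j k s x.1 x.2) := by
    filter_upwards [hbs.ae_distancesLaw_pos k] with x hx
    rw [← ENNReal.ofReal_mul (by positivity)]
    exact meanLoss_eq p j k hs hx.1
  rw [lintegral_congr_ae hcong, lintegral_const_mul _ (measurable_chi p j k hs).ennreal_ofReal,
    hbs.distancesLaw_eq, lintegral_finsetSum_measure, Finset.mul_sum,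
    ENNReal.ofReal_sum_of_nonneg fun n _ => by have := hI n; positivity]
  refine Finset.sum_congr rfl fun n _ => ?_
  rw [lintegral_smul_measure, lintegral_withDensity_chi j k n hs,
    ← ofReal_integral_eq_lintegral_ofReal (hbs.integrable_jointPDF_mul_chi j k n hs)
      (ae_of_all _ fun x => mul_nonneg (jointPDF_nonneg k n x) (chi_nonneg p j k hs x.1 x.2)),
    ENNReal.ofReal_mul measureReal_nonneg,
    ENNReal.ofReal_mul (p := 2 * Real.pi) (by positivity), Measure.real,
    ENNReal.ofReal_toReal (measure_ne_top _ _), smul_eq_mul]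
  ring

theorem IsTwoTierPoisson.sum_lintegral_meanLoss (j : Fin 2) {s : ℝ} (hs : 0 ≤ s) :
    ∑ k, ENNReal.ofReal (p.lam k) *
      ∫⁻ x, meanLoss p j k (ENNReal.ofReal s) x ∂(distancesLaw p P bs k) =
    ENNReal.ofReal (-beta p P bs j s) := by
  have hI (k n : Fin 2) :
      0 ≤ ∫ x : ℝ × ℝ, jointPDF p P bs k n x.1 x.2 * chi p j k s x.1 x.2 :=
    integral_nonneg fun x => mul_nonneg (jointPDF_nonneg k n x) (chi_nonneg p j k hs x.1 x.2)
  rw [beta, neg_neg, ENNReal.ofReal_sum_of_nonneg]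
  · refine Finset.sum_congr rfl fun k _ => ?_
    rw [hbs.lintegral_meanLoss j k hs, ← ENNReal.ofReal_mul (p.lam_pos k).le]
    congr 1
    simp only [hbs.integral_jointPDF_mul_chi j k _ hs, Finset.mul_sum]
    exact Finset.sum_congr rfl fun n _ => by ring
  · intro k _
    have := p.lam_pos k
    refine mul_nonneg (by positivity) (Finset.sum_nonneg fun n _ => ?_)
    rw [hbs.integral_jointPDF_mul_chi j k _ hs]
    exact mul_nonneg measureReal_nonneg (hI k n)

lemma IsTwoTierPoisson.beta_nonpos (j : Fin 2) {s : ℝ} (hs : 0 ≤ s) : beta p P bs j s ≤ 0 := by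
  refine neg_nonpos.2 (Finset.sum_nonneg fun k _ => ?_)
  have := p.lam_pos k
  refine mul_nonneg (by positivity) (Finset.sum_nonneg fun n _ => ?_)
  rw [hbs.integral_jointPDF_mul_chi j k _ hs]
  exact mul_nonneg measureReal_nonneg (integral_nonneg fun x =>
    mul_nonneg (jointPDF_nonneg k n x) (chi_nonneg p j k hs x.1 x.2))

/-- The exponent grows at most linearly. -/
lemma IsTwoTierPoisson.exists_sum_lintegral_meanLoss_le (j : Fin 2) : ∃ K : ℝ≥0∞, K ≠ ∞ ∧
    ∀ s : ℝ, 0 ≤ s → ∑ k, ENNReal.ofReal (p.lam k) *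
      ∫⁻ x, meanLoss p j k (ENNReal.ofReal s) x ∂(distancesLaw p P bs k) ≤
        ENNReal.ofReal s * K := by
  have h2 : 0 < p.α - 2 := by linarith [p.two_lt_α]
  have h3 := p.i0_pos
  set c := 2 * Real.pi * (p.i0 / (p.α - 2)) with hc
  have hc0 : 0 ≤ c := by positivity
  refine ⟨∑ k, ENNReal.ofReal (p.lam k) * ∫⁻ x, ENNReal.ofReal
    (c * (tierRatio p j k ^ 2 * x.1 ^ 2 + x.2 ^ 2)) ∂(distancesLaw p P bs k), ?_, fun s hs => ?_⟩
  · exact ENNReal.sum_ne_top.2 fun k _ => (ENNReal.mul_lt_top ENNReal.ofReal_lt_top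
      (hbs.lintegral_cond_sq_lt_top k (hbs.measure_assocEvent_pos k).ne' hc0)).ne
  · rw [Finset.mul_sum]
    refine Finset.sum_le_sum fun k _ => ?_
    rw [mul_left_comm, ← lintegral_const_mul (ENNReal.ofReal s) (by fun_prop)]
    gcongr ENNReal.ofReal (p.lam k) * ?_
    refine lintegral_mono_ae ?_
    filter_upwards [hbs.ae_distancesLaw_pos k] with x hx
    rw [← ENNReal.ofReal_mul hs]
    refine (meanLoss_eq p j k hs hx.1).trans_le (ENNReal.ofReal_le_ofReal ?_)
    calc 2 * Real.pi * chi p j k s x.1 x.2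
        ≤ 2 * Real.pi * (s * (p.i0 / (p.α - 2) * (tierRatio p j k ^ 2 * x.1 ^ 2 + x.2 ^ 2))) :=
          mul_le_mul_of_nonneg_left (chi_le p j k hs hx.1 hx.2) (by positivity)
      _ = _ := by rw [hc]; ring

end Moments

/-! ### Almost sure finiteness and the final formula. -/

section Laplace

variable {Ω : Type*} [MeasurableSpace Ω] {P : Measure Ω} [IsProbabilityMeasure P]
  {p : Params} {bs mt : Fin 2 → ℕ → Ω → Plane} {ru : Fin 2 → ℕ → Ω → ℝ × ℝ}
  {h : Fin 2 → ℕ → Ω → ℝ} (hmodel : IsUplinkModel p P bs mt ru h)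
include hmodel

omit [IsProbabilityMeasure P] in
lemma IsUplinkModel.measurable_interference (j : Fin 2) :
    Measurable (interference p bs mt ru h j) := by
  have h1 : Measurable fun ω => nearestPoint (bs j) ω :=
    measurable_nearestPoint_eval.comp (measurable_pi_lambda _ (hmodel.bs_poisson j).measurable)
  have h2 : interference p bs mt ru h j = fun ω => ∑ k, tierInterference p j k
      (terminals mt ru h k ω) (nearestPoint (bs j) ω) :=
    funext fun ω => interference_eq p bs mt ru h j ω
  rw [h2]
  exact Finset.measurable_fun_sum _ fun k _ =>
    measurable_tierInterference p j k (hmodel.measurable_terminals k) h1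

lemma IsUplinkModel.lintegral_cond_expNeg_interference (j : Fin 2) (s : ℝ≥0∞) :
    ∫⁻ ω, expNeg (s * interference p bs mt ru h j ω)
        ∂(ProbabilityTheory.cond P (assocEvent p bs j)) =
      expNeg (∑ k, ENNReal.ofReal (p.lam k) *
        ∫⁻ x, meanLoss p j k s x ∂(distancesLaw p P bs k)) := by
  rw [ProbabilityTheory.cond, lintegral_smul_measure, hmodel.setLIntegral_expNeg_interference,
    smul_eq_mul, ← mul_assoc, ENNReal.inv_mul_cancel
      (hmodel.isTwoTierPoisson.measure_assocEvent_pos j).ne' (measure_ne_top _ _), one_mul]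

/-- Since exp(-∞) = 0, E exp(-sI) ≤ Pr(I < ∞) for every s > 0. The linear bound on the exponent
gives E exp(-sI) ≥ exp(-sK), which tends to 1 along s = 1/(n+1). -/
theorem IsUplinkModel.ae_interference_lt_top (j : Fin 2) :
    ∀ᵐ ω ∂(ProbabilityTheory.cond P (assocEvent p bs j)), interference p bs mt ru h j ω < ∞ := by
  have hbs := hmodel.isTwoTierPoisson
  have := cond_isProbabilityMeasure (hbs.measure_assocEvent_pos j).ne'
  set μ := ProbabilityTheory.cond P (assocEvent p bs j)
  have hm := hmodel.measurable_interference j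
  have hS : MeasurableSet {ω | interference p bs mt ru h j ω < ∞} :=
    measurableSet_lt hm measurable_const
  obtain ⟨K, hK, hle⟩ := hbs.exists_sum_lintegral_meanLoss_le j
  have hs0 : Tendsto (fun n : ℕ => ENNReal.ofReal (1 / ((n : ℝ) + 1)) * K) atTop (𝓝 0) := by
    have h1 := ENNReal.tendsto_ofReal (tendsto_one_div_add_atTop_nhds_zero_nat (𝕜 := ℝ))
    have h2 := ENNReal.Tendsto.mul_const h1 (Or.inr hK)
    rwa [ENNReal.ofReal_zero, zero_mul] at h2
  have hlim := (continuous_expNeg.tendsto 0).comp hs0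
  rw [expNeg_zero] at hlim
  have hbound (n : ℕ) : expNeg (ENNReal.ofReal (1 / ((n : ℝ) + 1)) * K) ≤
      μ {ω | interference p bs mt ru h j ω < ∞} := by
    have hn : (0 : ℝ) < 1 / ((n : ℝ) + 1) := by positivity
    refine (expNeg_antitone (hle _ hn.le)).trans ?_
    rw [← hmodel.lintegral_cond_expNeg_interference, ← lintegral_indicator_one hS]
    refine lintegral_mono fun ω => ?_
    by_cases hω : interference p bs mt ru h j ω < ∞
    · rw [indicator_of_mem (by exact hω)]
      exact expNeg_le_one _
    · rw [not_lt_top_iff.1 hω, ENNReal.mul_top (ENNReal.ofReal_pos.2 hn).ne', expNeg_top]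
      exact zero_le
  have hone := le_of_tendsto' hlim hbound
  exact (prob_compl_eq_zero_iff hS).2 (le_antisymm prob_le_one hone)

theorem IsUplinkModel.laplace_interference (j : Fin 2) {s : ℝ} (hs : 0 ≤ s) :
    ∫ ω, Real.exp (-s * (interference p bs mt ru h j ω).toReal)
        ∂(ProbabilityTheory.cond P (assocEvent p bs j)) = Real.exp (beta p P bs j s) := by
  have hbs := hmodel.isTwoTierPoisson
  have hm := hmodel.measurable_interference j
  rw [integral_eq_lintegral_of_nonneg_ae (ae_of_all _ fun ω => (Real.exp_nonneg _))
    (by fun_prop : Measurable _).aestronglyMeasurable]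
  have hcong : ∀ᵐ ω ∂(ProbabilityTheory.cond P (assocEvent p bs j)),
      ENNReal.ofReal (Real.exp (-s * (interference p bs mt ru h j ω).toReal)) =
        expNeg (ENNReal.ofReal s * interference p bs mt ru h j ω) := by
    -- Where I = ∞ the two sides would differ for s > 0, since `toReal` sends ∞ to 0; finiteness
    -- removes this case.
    filter_upwards [hmodel.ae_interference_lt_top j] with ω hω
    rw [expNeg_of_ne_top (ENNReal.mul_ne_top ENNReal.ofReal_ne_top hω.ne), ENNReal.toReal_mul,
      ENNReal.toReal_ofReal hs, neg_mul]
  rw [lintegral_congr_ae hcong, hmodel.lintegral_cond_expNeg_interference,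
    hbs.sum_lintegral_meanLoss j hs, expNeg_ofReal (neg_nonneg.2 (hbs.beta_nonpos j hs)), neg_neg,
    ENNReal.toReal_ofReal (Real.exp_nonneg _)]

end Laplace

end IAFPC

theorem mainTheorem1 {Ω : Type*} [MeasurableSpace Ω] (P : Measure Ω) [IsProbabilityMeasure P]
    (p : IAFPC.Params) (bs mt : Fin 2 → ℕ → Ω → IAFPC.Plane) (ru : Fin 2 → ℕ → Ω → ℝ × ℝ)
    (h : Fin 2 → ℕ → Ω → ℝ) (hmodel : IAFPC.IsUplinkModel p P bs mt ru h) :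
    -- `jointPDF` is the conditional joint density of the two distances
    (∀ k n : Fin 2,
      HasLaw (IAFPC.typicalDistances bs k)
        ((volume : Measure (ℝ × ℝ)).withDensity
          (fun x => ENNReal.ofReal (IAFPC.jointPDF p P bs k n x.1 x.2)))
        (ProbabilityTheory.cond P
          (IAFPC.assocEvent p bs k ∩ IAFPC.mostInterferedEvent bs k n))) ∧
    ∀ j : Fin 2,
      0 < P (IAFPC.assocEvent p bs j) ∧
      -- the interference is almost surely finite
      (∀ᵐ ω ∂(ProbabilityTheory.cond P (IAFPC.assocEvent p bs j)),
        IAFPC.interference p bs mt ru h j ω < ∞) ∧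
      ∀ s : ℝ, 0 ≤ s →
        -- the double integrals in the exponent converge
        (∀ k n : Fin 2, Integrable
          (fun x : ℝ × ℝ => IAFPC.jointPDF p P bs k n x.1 x.2 * IAFPC.chi p j k s x.1 x.2)) ∧
        -- the Laplace transform
        ∫ ω, Real.exp (-s * (IAFPC.interference p bs mt ru h j ω).toReal)
            ∂(ProbabilityTheory.cond P (IAFPC.assocEvent p bs j)) =
          Real.exp (IAFPC.beta p P bs j s) := by
  have hbs := hmodel.isTwoTierPoisson
  exact ⟨hbs.hasLaw_typicalDistances, fun j => ⟨hbs.measure_assocEvent_pos j,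
    hmodel.ae_interference_lt_top j, fun s hs =>
      ⟨fun k n => hbs.integrable_jointPDF_mul_chi j k n hs, hmodel.laplace_interference j hs⟩⟩⟩
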